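/- Let $\mathcal Z$ be a complex Hilbert space, $\overline{\mathcal Z}$ its conjugate Hilbert space with the antiunitary bijection $z\mapsto\overline z$, and let $\overline{B}\,\overline z=\overline{Bz}$. Let $\Gamma_{\rm s}(\mathcal Z)$ and $\Gamma_{\rm a}(\mathcal Z)$ be the bosonic and fermionic Fock spaces, realized as the ranges in $\bigoplus_n\otimes^n\mathcal Z$ of the (anti)symmetrizer $\Theta_{\rm s/a}$; upper signs refer to bosons (s), lower signs to fermions (a). Write $z_1\otimes_{\rm s/a}\cdots\otimes_{\rm s/a}z_n=\Theta_{\rm s/a}(z_1\otimes\cdots\otimes z_n)$, let $\Omega$ be the vacuum, $N$ the number operator, $\Lambda=(-1)^{N(N-1)/2}$, $\Gamma(p)$ and ${\rm d}\Gamma(h)$ the usual second quantizations, and $a^*(\Phi)\Psi=\sqrt{(n+1)\cdots(n+m)}\,\Phi\otimes_{\rm s/a}\Psi$ for an $m$-particle vector $\Phi$ and an $n$-particle vector $\Psi$. Hilbert–Schmidt operators $\overline{\mathcal W}\to\mathcal W$ are identified with vectors of $\mathcal W\otimes\mathcal W$ so that $|x)(\overline y|$ corresponds to $x\otimes y$.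 Let $\gamma\ge0$ be a trace class operator on $\mathcal Z$; in the bosonic case assume also $\gamma\le1$ and ${\rm Ker}(1-\gamma)=\{0\}$. Let $h$ be a (possibly unbounded) self-adjoint operator on $\mathcal Z$. On $B(\Gamma_{\rm s/a}(\mathcal Z))$ consider the state $\omega_\gamma(A)={\rm Tr}(\Gamma(\gamma)A)/{\rm Tr}\,\Gamma(\gamma)$ and the dynamics $\tau^t(A)={\rm e}^{{\rm i}t{\rm d}\Gamma(h)}A\,{\rm e}^{-{\rm i}t{\rm d}\Gamma(h)}$. Let $\epsilon(z_1,\overline z_2)=(z_2,\overline z_1)$ on $\mathcal Z\oplus\overline{\mathcal Z}$, and $J_{\rm s}=\Gamma(\epsilon)$, $J_{\rm a}=\Lambda\Gamma(\epsilon)$ on $\Gamma_{\rm s/a}(\mathcal Z\oplus\overline{\mathcal Z})$. There is a unique unitary $W$ from the Hilbert space $B^2(\Gamma_{\rm s/a}(\mathcal Z))$ of Hilbert–Schmidt operators, with $(A|B)={\rm Tr}A^*B$, onto $\Gamma_{\rm s/a}(\mathcal Z\oplus\overline{\mathcal Z})$ such that for all $n,m$ and all $z_i,w_j\in\mathcal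 Z$ $$W\,|z_1\otimes_{\rm s/a}\cdots\otimes_{\rm s/a}z_n)(w_1\otimes_{\rm s/a}\cdots\otimes_{\rm s/a}w_m|=\sqrt{\tfrac{(n+m)!}{n!\,m!}}\;z_1\otimes_{\rm s/a}\cdots\otimes_{\rm s/a}z_n\otimes_{\rm s/a}\overline w_m\otimes_{\rm s/a}\cdots\otimes_{\rm s/a}\overline w_1 .$$ Let $\theta_{\rm l}(A)$ and $\theta_{\rm r}(\overline A)$ be the images under $W$ of the operators $B\mapsto AB$ and $B\mapsto BA^*$ on $B^2(\Gamma_{\rm s/a}(\mathcal Z))$, and let $\Gamma^+_{\rm s/a}(\mathcal Z\oplus\overline{\mathcal Z})$ be the image under $W$ of the positive Hilbert–Schmidt operators. Then: 1. $\big(\theta_{\rm l},\Gamma_{\rm s/a}(\mathcal Z\oplus\overline{\mathcal Z}),J_{\rm s/a},\Gamma^+_{\rm s/a}(\mathcal Z\oplus\overline{\mathcal Z})\big)$ is a standard representation of $\mathfrak M=B(\Gamma_{\rm s/a}(\mathcal Z))$. That is: $\theta_{\rm l}$ is an injective $\sigma$-weakly continuous $*$-representation, $J=J_{\rm s/a}$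 is an antiunitary involution, $\mathcal H^+=\Gamma^+_{\rm s/a}(\mathcal Z\oplus\overline{\mathcal Z})$ is a self-dual cone, $J\theta_{\rm l}(\mathfrak M)J=\theta_{\rm l}(\mathfrak M)'$, $J\theta_{\rm l}(A)J=\theta_{\rm l}(A)^*$ for $A$ in the center of $\mathfrak M$, $J\Psi=\Psi$ for $\Psi\in\mathcal H^+$, and $\theta_{\rm l}(A)J\theta_{\rm l}(A)\mathcal H^+\subset\mathcal H^+$ for all $A\in\mathfrak M$. 2. $J_{\rm s/a}\theta_{\rm l}(A)J_{\rm s/a}=\theta_{\rm r}(\overline A)$ for all $A\in B(\Gamma_{\rm s/a}(\mathcal Z))$. 3. $L={\rm d}\Gamma(h\oplus(-\overline h))$ is the standard Liouvillean of $\tau$ in this representation, i.e. the unique self-adjoint operator with $\theta_{\rm l}(\tau^t(A))={\rm e}^{{\rm i}tL}\theta_{\rm l}(A){\rm e}^{-{\rm i}tL}$ and ${\rm e}^{{\rm i}tL}\mathcal H^+=\mathcal H^+$ for all $t\in\mathbb R$ and $A$. 4. The standard vector representative of $\omega_\gamma$, i.e. the unique unit vector $\Omega_\gamma\in\mathcal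 H^+$ with $\omega_\gamma(A)=(\Omega_\gamma|\theta_{\rm l}(A)\Omega_\gamma)$ for all $A$, is $$\Omega_\gamma=\det(1\mp\gamma)^{\pm\frac12}\exp\big(\tfrac12a^*(c)\big)\Omega,\qquad c=\begin{bmatrix}0&\gamma^{1/2}\\ \pm\overline\gamma^{1/2}&0\end{bmatrix},$$ where $c$ maps $\overline{\mathcal Z}\oplus\mathcal Z$ to $\mathcal Z\oplus\overline{\mathcal Z}$, $\det$ is the Fredholm determinant, and $\exp(\frac12a^*(c))\Omega=\sum_{k\ge0}\frac1{k!}\big(\frac12a^*(c)\big)^k\Omega$. -/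

import Mathlib

open scoped ComplexConjugate InnerProductSpace ComplexOrder

noncomputable section

/-! ### The full Fock space `⊗Z = ⊕ₙ ⊗ⁿ Z` -/

section FullFock

variable {Z : Type*} [NormedAddCommGroup Z] [InnerProductSpace ℂ Z]

/-- `(z₁ ⊗ ⋯ ⊗ zₙ | w₁ ⊗ ⋯ ⊗ wₘ)`, which is `∏ (zᵢ | wᵢ)` if `n = m` and `0` otherwise. -/
def tensorKernel : List Z → List Z → ℂ
  | [], [] => 1
  | z :: l, w :: m => inner ℂ z w * tensorKernel l m
  | _, _ => 0

theorem tensorKernel_conj (l m : List Z) : conj (tensorKernel l m) = tensorKernel m l := by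
  induction l generalizing m with
  | nil => cases m <;> simp [tensorKernel]
  | cons z l ih => cases m <;> simp [tensorKernel, ih]

theorem gram_posSemidef {ι E : Type*} [NormedAddCommGroup E] [InnerProductSpace ℂ E] (v : ι → E) :
    (Matrix.gram ℂ v).PosSemidef := by
  refine ⟨Matrix.isHermitian_gram ℂ v, fun f => ?_⟩
  have h : (f.sum fun i a => f.sum fun j b => star a * Matrix.gram ℂ v i j * b) =
      inner ℂ (f.sum fun i a => a • v i) (f.sum fun i a => a • v i) := by
    simp only [Finsupp.sum, sum_inner, inner_sum, inner_smul_left, inner_smul_right,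
      Matrix.gram_apply, Finset.mul_sum]
    rw [Finset.sum_comm]
    refine Finset.sum_congr rfl fun i _ => Finset.sum_congr rfl fun j _ => ?_
    rw [RCLike.star_def]
    ring
  rw [h, inner_self_eq_norm_sq_to_K]
  positivity

/-- Auxiliary truncations of `tensorKernel`. -/
def tensorKernelTrunc : ℕ → Matrix (List Z) (List Z) ℂ
  | 0 => 0
  | n + 1 =>
      Matrix.gram ℂ (fun l : List Z => if l = [] then (1 : ℂ) else 0) +
        (Matrix.gram ℂ (fun l : List Z => l.headD 0)).hadamard
          ((tensorKernelTrunc n).submatrix List.tail List.tail)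

theorem tensorKernelTrunc_posSemidef (n : ℕ) :
    (tensorKernelTrunc n : Matrix (List Z) (List Z) ℂ).PosSemidef := by
  induction n with
  | zero => exact Matrix.PosSemidef.zero
  | succ n ih =>
      exact Matrix.PosSemidef.add (gram_posSemidef _)
        (Matrix.PosSemidef.hadamard (gram_posSemidef _) (ih.submatrix _))

theorem tensorKernelTrunc_apply (n : ℕ) (l m : List Z) (h : l.length < n) :
    tensorKernelTrunc n l m = tensorKernel l m := by
  induction n generalizing l m with
  | zero => omega
  | succ n ih =>
      cases l with
      | nil => cases m <;>
          simp [tensorKernelTrunc, tensorKernel, Matrix.gram_apply, Matrix.hadamard_apply]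
      | cons z l =>
        have hl : l.length < n := by simpa using h
        cases m <;>
          simp [tensorKernelTrunc, tensorKernel, Matrix.gram_apply, Matrix.hadamard_apply,
            ih _ _ hl]

/-- The sesquilinear form extending `(z₁ ⊗ ⋯ ⊗ zₙ | w₁ ⊗ ⋯ ⊗ wₙ) = ∏ (zᵢ | wᵢ)` to the free vector
space on the formal products `z₁ ⊗ ⋯ ⊗ zₙ`. -/
@[reducible]
def tensorCore : PreInnerProductSpace.Core ℂ (List Z →₀ ℂ) where
  inner f g := f.sum fun l a => g.sum fun m b => conj a * tensorKernel l m * b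
  conj_inner_symm f g := by
    simp only [map_finsuppSum]
    rw [Finsupp.sum_comm]
    congr! 4
    funext m b
    simp only [map_mul, Complex.conj_conj, tensorKernel_conj]
    ring
  re_inner_nonneg f := by
    obtain ⟨n, hn⟩ : ∃ n : ℕ, ∀ l ∈ f.support, l.length < n :=
      ⟨f.support.sup List.length + 1, fun l hl =>
        Nat.lt_succ_of_le (Finset.le_sup (f := List.length) hl)⟩
    have h := (tensorKernelTrunc_posSemidef (Z := Z) n).2 f
    have h2 : (f.sum fun l a => f.sum fun m b => star a * tensorKernelTrunc n l m * b) =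
        f.sum fun l a => f.sum fun m b => conj a * tensorKernel l m * b := by
      refine Finset.sum_congr rfl fun l hl => Finset.sum_congr rfl fun m _ => ?_
      dsimp only
      rw [tensorKernelTrunc_apply n l m (hn l hl)]
      rfl
    rw [h2] at h
    exact (Complex.le_def.1 h).1
  add_left f g k := by
    refine Finsupp.sum_add_index' (fun l => by simp) (fun l a b => ?_)
    rw [← Finsupp.sum_add]
    simp only [map_add, add_mul]
  smul_left f g r := by
    refine (Finsupp.sum_smul_index (fun l => by simp)).trans ?_
    simp only [Finsupp.mul_sum, map_mul, mul_assoc]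

variable (Z) in
/-- The free vector space on the formal products `z₁ ⊗ ⋯ ⊗ zₙ`, with the form `tensorCore`. -/
def PreFock : Type _ := List Z →₀ ℂ

instance : AddCommGroup (PreFock Z) := inferInstanceAs (AddCommGroup (List Z →₀ ℂ))

instance : Module ℂ (PreFock Z) := inferInstanceAs (Module ℂ (List Z →₀ ℂ))

variable (Z) in
@[reducible]
def PreFock.core : PreInnerProductSpace.Core ℂ (PreFock Z) := tensorCore (Z := Z)

instance : SeminormedAddCommGroup (PreFock Z) :=
  @InnerProductSpace.Core.toSeminormedAddCommGroup ℂ (PreFock Z) _ _ _ (PreFock.core Z)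

instance : InnerProductSpace ℂ (PreFock Z) := InnerProductSpace.ofCore (PreFock.core Z)

variable (Z) in
/-- The full Fock space `⊗Z = ⊕ₙ ⊗ⁿ Z`: the Hilbert space completion of the tensor algebra of `Z`
(null vectors being divided out). -/
abbrev FullFock : Type _ := UniformSpace.Completion (PreFock Z)

/-- The formal product `z₁ ⊗ ⋯ ⊗ zₙ`. -/
def preTens (l : List Z) : PreFock Z := Finsupp.single (M := ℂ) l 1

/-- The simple tensor `z₁ ⊗ ⋯ ⊗ zₙ` in the full Fock space; the empty one is the vacuum. -/
def tens (l : List Z) : FullFock Z := (preTens l : PreFock Z)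

theorem inner_tens (l m : List Z) : inner ℂ (tens l) (tens m) = tensorKernel l m := by
  refine (UniformSpace.Completion.inner_coe _ _).trans ?_
  refine (Finsupp.sum_single_index (by simp [Finsupp.sum])).trans ?_
  refine (Finsupp.sum_single_index (by simp)).trans ?_
  simp

theorem span_tens_dense : Dense (Submodule.span ℂ (Set.range (tens (Z := Z))) : Set (FullFock Z)) := by
  refine UniformSpace.Completion.denseRange_coe.mono ?_
  rintro _ ⟨f, rfl⟩
  refine Finsupp.induction_linear (motive := fun f : List Z →₀ ℂ =>
    ((show PreFock Z from f : PreFock Z) : FullFock Z) ∈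
      Submodule.span ℂ (Set.range (tens (Z := Z)))) f ?_ ?_ ?_
  · exact Submodule.zero_mem _
  · intro f g hf hg
    have := Submodule.add_mem _ hf hg
    rwa [← UniformSpace.Completion.coe_add] at this
  · intro l a
    have := Submodule.smul_mem _ a (Submodule.subset_span (R := ℂ) (Set.mem_range_self l) :
      tens l ∈ Submodule.span ℂ (Set.range (tens (Z := Z))))
    unfold tens at this
    rw [← UniformSpace.Completion.coe_smul] at this
    have h : (Finsupp.single l a : List Z →₀ ℂ) = a • (Finsupp.single l 1 : List Z →₀ ℂ) :=
      (Finsupp.smul_single_one l a).symm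
    rw [h]
    exact this

end FullFock

/-! ### Symmetric and antisymmetric Fock spaces -/

/-- Bose or Fermi statistics (the subscript `s/a`). -/
inductive Statistics
  | bose
  | fermi

namespace Statistics

/-- The sign `±`: `+` for bosons, `-` for fermions. -/
def sign : Statistics → ℂ
  | bose => 1
  | fermi => -1

/-- The character of the permutation group: trivial for bosons, the signature for fermions. -/
def char (s : Statistics) {n : ℕ} (σ : Equiv.Perm (Fin n)) : ℂ :=
  match s with
  | bose => 1
  | fermi => ((Equiv.Perm.sign σ : ℤ) : ℂ)

end Statistics

section Fock

variable {Z : Type*} [NormedAddCommGroup Z] [InnerProductSpace ℂ Z]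

/-- `Θⁿ (z₁ ⊗ ⋯ ⊗ zₙ) = (n!)⁻¹ ∑_σ χ(σ) z_{σ 1} ⊗ ⋯ ⊗ z_{σ n}`, with `Θ` the (anti)symmetrizer. -/
def symTens (s : Statistics) {n : ℕ} (z : Fin n → Z) : FullFock Z :=
  ((n.factorial : ℂ)⁻¹) • ∑ σ : Equiv.Perm (Fin n), s.char σ • tens (List.ofFn (z ∘ σ))

variable (Z) in
/-- `Γ_{s/a}(Z) = Θ_{s/a}(⊗Z)` as a closed subspace of the full Fock space. -/
def fockSubspace (s : Statistics) : Submodule ℂ (FullFock Z) :=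
  (Submodule.span ℂ {v | ∃ (n : ℕ) (z : Fin n → Z), v = symTens s z}).topologicalClosure

variable (Z) in
/-- The bosonic/fermionic Fock space `Γ_{s/a}(Z)`. -/
abbrev FockSpace (s : Statistics) : Type _ := fockSubspace Z s

instance (s : Statistics) : CompleteSpace (FockSpace Z s) :=
  (Submodule.isClosed_topologicalClosure _).completeSpace_coe

/-- The product vector `z₁ ⊗_{s/a} ⋯ ⊗_{s/a} zₙ ∈ Γ_{s/a}(Z)`. -/
def symVec (s : Statistics) {n : ℕ} (z : Fin n → Z) : FockSpace Z s :=
  ⟨symTens s z, Submodule.le_topologicalClosure _ (Submodule.subset_span ⟨n, z, rfl⟩)⟩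

variable (Z) in
/-- The vacuum `Ω`. -/
def vacuum (s : Statistics) : FockSpace Z s := symVec s (fun i : Fin 0 => i.elim0)

/-- Product vectors are total in `Γ_{s/a}(Z)`. -/
theorem span_symVec_dense (s : Statistics) :
    Dense (Submodule.span ℂ {v : FockSpace Z s | ∃ (n : ℕ) (z : Fin n → Z), v = symVec s z} :
      Set (FockSpace Z s)) := by
  intro x
  rw [closure_subtype]
  refine closure_mono ?_ x.2
  rw [← Submodule.coe_subtype, ← Submodule.map_coe, Submodule.map_span]
  refine Submodule.span_mono ?_
  rintro _ ⟨n, z, rfl⟩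
  exact ⟨symVec s z, ⟨n, z, rfl⟩, rfl⟩

/-- The bounded (anti)linear operator `G` on `Γ_{s/a}(Z)` with `G (z₁ ⊗ ⋯ ⊗ zₙ) = F n z` on all
product vectors. Product vectors being total, there is at most one; the value is `0` if there is
none. -/
def ofProducts (s : Statistics) {σ : ℂ →+* ℂ} {K : Type*} [NormedAddCommGroup K]
    [NormedSpace ℂ K] (F : (n : ℕ) → (Fin n → Z) → K) : FockSpace Z s →SL[σ] K :=
  open scoped Classical in
  if h : ∃ G : FockSpace Z s →SL[σ] K, ∀ (n : ℕ) (z : Fin n → Z), G (symVec s z) = F n z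
  then h.choose else 0

/-- `Γ(p)`: `z₁ ⊗ ⋯ ⊗ zₙ ↦ p z₁ ⊗ ⋯ ⊗ p zₙ`. -/
def secondQuant (s : Statistics) (p : Z →L[ℂ] Z) : FockSpace Z s →L[ℂ] FockSpace Z s :=
  ofProducts s fun _ z => symVec s (p ∘ z)

/-- `Γ(ε)` for an antilinear `ε`. -/
def antiSecondQuant (s : Statistics) (ε : Z → Z) : FockSpace Z s →L⋆[ℂ] FockSpace Z s :=
  ofProducts s fun _ z => symVec s (ε ∘ z)

variable (Z) in
/-- `Λ = (-1)^{N(N-1)/2}`. -/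
def lambdaOp (s : Statistics) : FockSpace Z s →L[ℂ] FockSpace Z s :=
  ofProducts s fun n z => ((-1 : ℂ) ^ (n * (n - 1) / 2)) • symVec s z

/-- `dΓ(h)`: the closure of the operator
`z₁ ⊗ ⋯ ⊗ zₙ ↦ ∑ⱼ z₁ ⊗ ⋯ ⊗ h zⱼ ⊗ ⋯ ⊗ zₙ`, `zᵢ ∈ Dom h`. -/
def dGamma (s : Statistics) (h : Z →ₗ.[ℂ] Z) : FockSpace Z s →ₗ.[ℂ] FockSpace Z s :=
  (Submodule.span ℂ {x : FockSpace Z s × FockSpace Z s |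
    ∃ (n : ℕ) (z : Fin n → h.domain), x = (symVec s (fun i => (z i : Z)),
      ∑ j : Fin n, symVec s (Function.update (fun i => (z i : Z)) j (h (z j))))}
    ).topologicalClosure.toLinearPMap

end Fock

/-! ### Traces, Hilbert--Schmidt operators and determinants -/

section Trace

variable (H : Type*) [NormedAddCommGroup H] [InnerProductSpace ℂ H] [CompleteSpace H]

/-- The index set of a fixed orthonormal basis of `H`. -/
def onbSet : Set H := (exists_hilbertBasis ℂ H).choose

/-- A fixed orthonormal basis of `H`. -/
def onb : HilbertBasis (onbSet H) ℂ H := (exists_hilbertBasis ℂ H).choose_spec.choose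

variable {H}

/-- `T` is trace class: `Tr |T| < ∞`. -/
def IsTraceClass (T : H →L[ℂ] H) : Prop :=
  Summable fun i => inner ℂ (onb H i) (CFC.abs T (onb H i))

/-- The trace `Tr T`. -/
def opTrace (T : H →L[ℂ] H) : ℂ := ∑' i, inner ℂ (onb H i) (T (onb H i))

variable (H) in
/-- The Hilbert--Schmidt operators `B²(H)`: those `A` with `Tr A*A = ∑ ‖A eᵢ‖² < ∞`. -/
def HilbertSchmidt : Submodule ℂ (H →L[ℂ] H) where
  carrier := {A | Memℓp (fun i => A (onb H i)) 2}
  add_mem' hA hB := hA.add hB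
  zero_mem' := zero_memℓp
  smul_mem' c _ hA := hA.const_smul c

/-- `|x)(y|` is Hilbert--Schmidt. -/
theorem rankOne_mem_HilbertSchmidt (x y : H) :
    InnerProductSpace.rankOne ℂ x y ∈ HilbertSchmidt H := by
  have h : Summable fun i => ‖inner ℂ (onb H i) y‖ ^ 2 :=
    (onb H).orthonormal.inner_products_summable y
  refine memℓp_gen ?_
  refine (h.mul_right (‖x‖ ^ 2)).congr fun i => ?_
  simp [norm_smul, mul_pow, norm_inner_symm]

/-- `det r` for `r ∈ 1 + B¹(H)`: the limit of the determinants of the compressions of `r` to the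
finite dimensional subspaces `S`, directed by inclusion. -/
def fredholmDet (r : H →L[ℂ] H) : ℂ :=
  Filter.limUnder (Filter.atTop : Filter {S : Submodule ℂ H // FiniteDimensional ℂ S}) fun S =>
    haveI := S.2
    LinearMap.det (S.1.orthogonalProjectionOnto ∘L r ∘L S.1.subtypeL : S.1 →L[ℂ] S.1).toLinearMap

end Trace

/-! ### Creation operators and Gaussian vectors -/

section Creation

variable {Z : Type*} [NormedAddCommGroup Z] [InnerProductSpace ℂ Z] [CompleteSpace Z]

/-- The orthonormal basis `e_{i₁} ⊗ ⋯ ⊗ e_{iₙ}` of the full Fock space. -/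
def basisTens (l : List (onbSet Z)) : FullFock Z := tens (l.map (onb Z))

/-- `a*(Φ)Ψ`, where `a*(Φ)Ψ = √((n+1)⋯(n+m)) Φ ⊗_{s/a} Ψ` for `Φ` an `m`-particle and `Ψ` an
`n`-particle vector: the product `Φ ⊗_{s/a} Ψ = Θ(Φ ⊗ Ψ)` is expanded bilinearly
in product basis vectors (the sum converges if `Ψ` has finitely many particles). -/
def creation (s : Statistics) (Φ : FullFock Z) (Ψ : FockSpace Z s) : FockSpace Z s :=
  ∑' p : List (onbSet Z) × List (onbSet Z),
    (((√(((p.2.length + 1).ascFactorial p.1.length : ℕ) : ℝ) : ℝ) : ℂ) *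
        inner ℂ (basisTens p.1) Φ * inner ℂ (basisTens p.2) (Ψ : FullFock Z)) •
      symVec s (fun i => onb Z ((p.1 ++ p.2).get i))

/-- `exp(½ a*(Φ)) Ω = ∑ₖ (k!)⁻¹ (½ a*(Φ))ᵏ Ω`. -/
def expCreationVacuum (s : Statistics) (Φ : FullFock Z) : FockSpace Z s :=
  ∑' k : ℕ, ((k.factorial : ℂ)⁻¹) •
    (fun Ψ : FockSpace Z s => (1 / 2 : ℂ) • creation s Φ Ψ)^[k] (vacuum Z s)

/-- The two-particle vector identified with a Hilbert--Schmidt operator `c : Z̄ → Z`, where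
`|x)(ȳ|` corresponds to `x ⊗ y`: as `c = ∑ᵢ |c ēᵢ)(ēᵢ|`, it is `∑ᵢ c ēᵢ ⊗ eᵢ`. The
antiunitary `Z → Z̄`, `z ↦ z̄`, is the argument `bar`. -/
def twoParticle {Zc : Type*} (bar : Z → Zc) (c : Zc → Z) : FullFock Z :=
  ∑' i, tens [c (bar (onb Z i)), onb Z i]

end Creation

/-! ### Standard representations of `B(H)` -/

section Standard

variable {H K : Type*} [NormedAddCommGroup H] [InnerProductSpace ℂ H] [CompleteSpace H]
  [NormedAddCommGroup K] [InnerProductSpace ℂ K] [CompleteSpace K]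

/-- The `σ`-weakly continuous functionals on `B(H)`:
`ψ(A) = ∑ₙ (xₙ | A yₙ)` with `∑ ‖xₙ‖² < ∞`, `∑ ‖yₙ‖² < ∞`. -/
def IsNormalFunctional (ψ : (H →L[ℂ] H) → ℂ) : Prop :=
  ∃ x y : ℕ → H, Summable (fun n => ‖x n‖ ^ 2) ∧ Summable (fun n => ‖y n‖ ^ 2) ∧
    ∀ A, ψ A = ∑' n, inner ℂ (x n) (A (y n))

/-- `J B J`, for `J` antilinear. -/
def antiConj (J : K →L⋆[ℂ] K) (B : K →L[ℂ] K) : K →L[ℂ] K := (J.comp B).comp J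

/-- `P = {Φ | (Φ|Ψ) ≥ 0 for all Ψ ∈ P}`. -/
def IsSelfDualCone (P : Set K) : Prop :=
  P = {Φ | ∀ Ψ ∈ P, 0 ≤ inner ℂ Φ Ψ}

/-- `(π, K, J, P)` is a standard representation of the `W*`-algebra `B(H)`. -/
structure IsStandardRep (π : (H →L[ℂ] H) →⋆ₐ[ℂ] (K →L[ℂ] K)) (J : K →L⋆[ℂ] K) (P : Set K) :
    Prop where
  injective : Function.Injective π
  normal : ∀ ψ : (K →L[ℂ] K) → ℂ, IsNormalFunctional ψ → IsNormalFunctional fun A => ψ (π A)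
  involution : ∀ Φ, J (J Φ) = Φ
  antiunitary : ∀ Φ Ψ, inner ℂ (J Φ) (J Ψ) = conj (inner ℂ Φ Ψ)
  selfDual : IsSelfDualCone P
  commutant : (Set.range fun A => antiConj J (π A)) = Set.centralizer (Set.range π)
  center : ∀ A ∈ Set.center (H →L[ℂ] H), antiConj J (π A) = (π A).adjoint
  fixed : ∀ Ψ ∈ P, J Ψ = Ψ
  preserves : ∀ A, ∀ Ψ ∈ P, π A (J (π A Ψ)) ∈ P

/-- `u t = e^{itL}`: `u` is the strongly continuous unitary group with generator `L`. -/
structure IsUnitaryGroupOf (L : K →ₗ.[ℂ] K) (u : ℝ → K →L[ℂ] K) : Prop where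
  zero : u 0 = 1
  add : ∀ t r, u (t + r) = u t * u r
  unitary : ∀ t, u t ∈ unitary (K →L[ℂ] K)
  continuous : ∀ Φ, Continuous fun t => u t Φ
  generator : ∀ Φ Ψ, (Φ, Ψ) ∈ L.graph ↔ HasDerivAt (fun t => u t Φ) (Complex.I • Ψ) 0

/-- `e^{itL}` for a self-adjoint operator `L` (Stone's theorem: exactly one group exists). -/
def expI (L : K →ₗ.[ℂ] K) : ℝ → K →L[ℂ] K :=
  open scoped Classical in
  if h : ∃ u, IsUnitaryGroupOf L u then h.choose else 0

/-- The self-adjoint operator `L` implements `τ` and preserves the cone `P`. -/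
def ImplementsDynamics (π : (H →L[ℂ] H) →⋆ₐ[ℂ] (K →L[ℂ] K)) (P : Set K)
    (τ : ℝ → (H →L[ℂ] H) → (H →L[ℂ] H)) (L : K →ₗ.[ℂ] K) : Prop :=
  IsSelfAdjoint L ∧ (∀ t A, π (τ t A) = expI L t * π A * expI L (-t)) ∧
    ∀ t, (expI L t) '' P = P

/-- `L` is the standard Liouvillean of `τ`. -/
def IsStandardLiouvillean (π : (H →L[ℂ] H) →⋆ₐ[ℂ] (K →L[ℂ] K)) (P : Set K)
    (τ : ℝ → (H →L[ℂ] H) → (H →L[ℂ] H)) (L : K →ₗ.[ℂ] K) : Prop :=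
  ImplementsDynamics π P τ L ∧ ∀ L', ImplementsDynamics π P τ L' → L' = L

/-- The unit vector `Ω` lies in `P` and `ω(A) = (Ω | π(A) Ω)`. -/
def RepresentsState (π : (H →L[ℂ] H) →⋆ₐ[ℂ] (K →L[ℂ] K)) (P : Set K)
    (ω : (H →L[ℂ] H) → ℂ) (Ω : K) : Prop :=
  Ω ∈ P ∧ ‖Ω‖ = 1 ∧ ∀ A, ω A = inner ℂ Ω (π A Ω)

/-- `Ω` is the standard vector representative of `ω`. -/
def IsStandardVector (π : (H →L[ℂ] H) →⋆ₐ[ℂ] (K →L[ℂ] K)) (P : Set K)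
    (ω : (H →L[ℂ] H) → ℂ) (Ω : K) : Prop :=
  RepresentsState π P ω Ω ∧ ∀ Ω', RepresentsState π P ω Ω' → Ω' = Ω

end Standard

/-! ### The confined gas -/

section Confined

variable {Z Zc : Type*} [NormedAddCommGroup Z] [InnerProductSpace ℂ Z] [CompleteSpace Z]
  [NormedAddCommGroup Zc] [InnerProductSpace ℂ Zc] [CompleteSpace Zc]

variable (Z Zc) in
/-- The Hilbert space `Z ⊕ Z̄`. Throughout, the conjugate space is given by a Hilbert space `Zc`
with an antiunitary bijection `bar : Z → Zc`, `z ↦ z̄`. -/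
abbrev Doubled : Type _ := WithLp 2 (Z × Zc)

/-- The antilinear map `ε (z₁, z̄₂) = (z₂, z̄₁)` of `Z ⊕ Z̄`. -/
def epsMap (bar : Z ≃ₗᵢ⋆[ℂ] Zc) (x : Doubled Z Zc) : Doubled Z Zc :=
  WithLp.toLp 2 (bar.symm x.snd, bar x.fst)

/-- `J_s = Γ(ε)`, `J_a = Λ Γ(ε)`. -/
def modularConj (s : Statistics) (bar : Z ≃ₗᵢ⋆[ℂ] Zc) :
    FockSpace (Doubled Z Zc) s →L⋆[ℂ] FockSpace (Doubled Z Zc) s :=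
  match s with
  | .bose => antiSecondQuant .bose (epsMap bar)
  | .fermi => (lambdaOp (Doubled Z Zc) .fermi).comp (antiSecondQuant .fermi (epsMap bar))

/-- `W` is the unitary identification
`B²(Γ(Z)) ≃ Γ(Z) ⊗ conj Γ(Z) ≃ Γ(Z) ⊗ Γ(Z̄) ≃ Γ(Z ⊕ Z̄)`, where `B²` carries
`(A|B) = Tr A*B`; with `Ψ₁ = z₁ ⊗ ⋯ ⊗ zₙ`, `Ψ₂ = w₁ ⊗ ⋯ ⊗ wₘ` its steps are
`|Ψ₁)(Ψ₂| ↦ Ψ₁ ⊗ conj Ψ₂ ↦ Ψ₁ ⊗ (w̄ₘ ⊗ ⋯ ⊗ w̄₁)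
 ↦ √((n+m)!/(n!m!)) z₁ ⊗ ⋯ ⊗ zₙ ⊗ w̄ₘ ⊗ ⋯ ⊗ w̄₁`. -/
structure IsFockIdentification (s : Statistics) (bar : Z ≃ₗᵢ⋆[ℂ] Zc)
    (W : HilbertSchmidt (FockSpace Z s) ≃ₗ[ℂ] FockSpace (Doubled Z Zc) s) : Prop where
  inner_eq : ∀ A B : HilbertSchmidt (FockSpace Z s),
    inner ℂ (W A) (W B) = opTrace (A.1.adjoint ∘L B.1)
  apply_rankOne : ∀ (n m : ℕ) (z : Fin n → Z) (w : Fin m → Z),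
    W ⟨InnerProductSpace.rankOne ℂ (symVec s z) (symVec s w), rankOne_mem_HilbertSchmidt _ _⟩ =
      ((√(((n + m).factorial : ℝ) / (n.factorial * m.factorial)) : ℝ) : ℂ) •
        symVec s (Fin.append (fun i => (WithLp.toLp 2 (z i, 0) : Doubled Z Zc))
          (fun j => WithLp.toLp 2 (0, bar (w j.rev))))

/-- `Γ⁺(Z ⊕ Z̄)`: the image of the positive Hilbert--Schmidt operators. -/
def fockCone {s : Statistics}
    (W : HilbertSchmidt (FockSpace Z s) ≃ₗ[ℂ] FockSpace (Doubled Z Zc) s) :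
    Set (FockSpace (Doubled Z Zc) s) :=
  W '' {A | A.1.IsPositive}

/-- The operator `h̄ z̄ = conj (h z)` on `Z̄`. -/
def conjPMap (bar : Z ≃ₗᵢ⋆[ℂ] Zc) (h : Z →ₗ.[ℂ] Z) : Zc →ₗ.[ℂ] Zc where
  domain := h.domain.comap (bar.symm : Zc →ₗ⋆[ℂ] Z)
  toFun :=
    { toFun := fun w => bar (h ⟨bar.symm w, w.2⟩)
      map_add' := fun v w => by
        rw [← map_add, ← LinearPMap.map_add]
        congr 2
        exact Subtype.ext (map_add bar.symm _ _)
      map_smul' := fun a w => by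
        have h1 : (⟨bar.symm (a • w : _), (a • w).2⟩ : h.domain) =
            conj a • ⟨bar.symm w, w.2⟩ := Subtype.ext (map_smulₛₗ bar.symm _ _)
        rw [h1, LinearPMap.map_smul, map_smulₛₗ]
        simp }

/-- The direct sum `p ⊕ q` of two operators. -/
def dirSum (p : Z →ₗ.[ℂ] Z) (q : Zc →ₗ.[ℂ] Zc) : Doubled Z Zc →ₗ.[ℂ] Doubled Z Zc where
  domain := (p.domain.prod q.domain).comap
    (WithLp.linearEquiv 2 ℂ (Z × Zc) : WithLp 2 (Z × Zc) →ₗ[ℂ] Z × Zc)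
  toFun :=
    { toFun := fun x => WithLp.toLp 2 (p ⟨x.1.fst, x.2.1⟩, q ⟨x.1.snd, x.2.2⟩)
      map_add' := fun x y => by
        rw [← WithLp.toLp_add, Prod.mk_add_mk, ← LinearPMap.map_add, ← LinearPMap.map_add]
        rfl
      map_smul' := fun a x => by
        rw [RingHom.id_apply, ← WithLp.toLp_smul, Prod.smul_mk, ← LinearPMap.map_smul,
          ← LinearPMap.map_smul]
        rfl }

/-- The dynamics `τᵗ(A) = e^{it dΓ(h)} A e^{-it dΓ(h)}`. -/
def fockDynamics (s : Statistics) (h : Z →ₗ.[ℂ] Z) (t : ℝ)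
    (A : FockSpace Z s →L[ℂ] FockSpace Z s) : FockSpace Z s →L[ℂ] FockSpace Z s :=
  expI (dGamma s h) t * A * expI (dGamma s h) (-t)

/-- The state `ω_γ(A) = Tr (Γ(γ) A) / Tr Γ(γ)`. -/
def gibbsState (s : Statistics) (γ : Z →L[ℂ] Z) (A : FockSpace Z s →L[ℂ] FockSpace Z s) : ℂ :=
  opTrace (secondQuant s γ * A) / opTrace (secondQuant s γ)

/-- The operator `c = [[0, γ^{1/2}], [± γ̄^{1/2}, 0]]` from `conj (Z ⊕ Z̄) = Z̄ ⊕ Z` to `Z ⊕ Z̄`. -/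
def pairOp (s : Statistics) (bar : Z ≃ₗᵢ⋆[ℂ] Zc) (γ : Z →L[ℂ] Z) (x : Doubled Zc Z) :
    Doubled Z Zc :=
  WithLp.toLp 2 (CFC.sqrt γ x.snd, s.sign • bar (CFC.sqrt γ (bar.symm x.fst)))

/-- `Ω_γ = det(1 ∓ γ)^{±1/2} exp(½ a*(c)) Ω`. -/
def gaussianVector (s : Statistics) (bar : Z ≃ₗᵢ⋆[ℂ] Zc) (γ : Z →L[ℂ] Z) :
    FockSpace (Doubled Z Zc) s :=
  (fredholmDet (1 - s.sign • γ) ^ (s.sign / 2)) •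
    expCreationVacuum s (twoParticle
      (fun x : Doubled Z Zc => (WithLp.toLp 2 (bar x.fst, bar.symm x.snd) : Doubled Zc Z))
      (pairOp s bar γ))

end Confined

end

/-! Everything is transported from Hilbert–Schmidt operators. The vectors `pairVec`, that is
√((n+m)!/(n!m!)) z₁⊗⋯⊗zₙ⊗w̄ₘ⊗⋯⊗w̄₁, have the Gram matrix (z|z')(w'|w), which is also the Gram matrix
of the rank one operators |z)(w| for Tr A*B (`inner_pairVec_eq`). Both families are total, so
exactly one unitary W matches them.

On Hilbert–Schmidt operators the standard representation is explicit: 𝔐 acts by left multiplication,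
J is B ↦ B*, and the cone consists of the positive operators. The cone is self-dual because Tr AB ≥
0 for positive A, B (Schur's product theorem) and because |x)(x| tests positivity. The commutant
consists of the right multiplications (`exists_eq_rightMul`) and the center of scalars. Taking
adjoints exchanges z and w, which on the Fock side means applying ε and reversing all factors.
Reversal costs nothing for bosons and (-1)^{N(N-1)/2} for fermions, whence Λ
(`modularConj_pairVec`).

With u the group e^{ith}, the group Γ(u ⊕ ū) acts as B ↦ Γ(u)BΓ(u)*, so it implements the dynamics
and preserves the cone. Stone's theorem and Nelson's invariant core theorem identify its generator
with dΓ(h ⊕ (-h̄)). A competing group differs from it by a unitary of the commutant preserving the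
cone. Such a unitary is B ↦ BR* with every |x)(Rx| positive, which forces R = 1
(`eq_one_of_commute`).

For the state, let γ have eigenvectors fⱼ with eigenvalues gⱼ. Then c is the vector ∑ √gⱼ (fⱼ⊗f̄ⱼ ±
f̄ⱼ⊗fⱼ), and ½a*(c) adds one pair with fⱼ outermost on the left and f̄ⱼ outermost on the right.
Hence (k!)⁻¹(½a*(c))ᵏΩ is W of the restriction of Γ(γ^{1/2}) to k particles, and the exponential
vector is W(Γ(γ^{1/2})). This operator is positive with square Γ(γ), so its normalization represents
ω_γ. Uniqueness is uniqueness of positive square roots. The squared norm is Tr Γ(γ) = ∏(1∓gⱼ)^{∓1},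
computed by adding one mode at a time, and `hasProd_fredholmDet` identifies this product with the
power of the Fredholm determinant. -/

open scoped ComplexConjugate InnerProductSpace ComplexOrder

noncomputable section

set_option linter.unusedSectionVars false
set_option linter.style.haveILetI false

/-! ### One-parameter unitary groups and Stone's theorem -/

section UnitaryGroup

variable {K : Type*} [NormedAddCommGroup K] [InnerProductSpace ℂ K] [CompleteSpace K]

/-- `u` is a strongly continuous one-parameter unitary group. -/
structure IsUnitaryGroup (u : ℝ → K →L[ℂ] K) : Prop where
  zero : u 0 = 1
  add : ∀ t r, u (t + r) = u t * u r
  unitary : ∀ t, u t ∈ unitary (K →L[ℂ] K)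
  continuous : ∀ Φ, Continuous fun t => u t Φ

theorem IsUnitaryGroupOf.isUnitaryGroup {L : K →ₗ.[ℂ] K} {u : ℝ → K →L[ℂ] K}
    (hu : IsUnitaryGroupOf L u) : IsUnitaryGroup u :=
  ⟨hu.zero, hu.add, hu.unitary, hu.continuous⟩

namespace IsUnitaryGroup

variable {u : ℝ → K →L[ℂ] K} (hu : IsUnitaryGroup u)
include hu

theorem neg_mul (t : ℝ) : u (-t) * u t = 1 := by rw [← hu.add, neg_add_cancel, hu.zero]

theorem mul_neg (t : ℝ) : u t * u (-t) = 1 := by rw [← hu.add, add_neg_cancel, hu.zero]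

theorem neg_apply (t : ℝ) (Φ : K) : u (-t) (u t Φ) = Φ :=
  congrArg (fun A : K →L[ℂ] K => A Φ) (hu.neg_mul t)

theorem apply_neg (t : ℝ) (Φ : K) : u t (u (-t) Φ) = Φ :=
  congrArg (fun A : K →L[ℂ] K => A Φ) (hu.mul_neg t)

theorem adjoint_eq (t : ℝ) : (u t).adjoint = u (-t) := by
  have h1 : (u t).adjoint * u t = 1 := (Unitary.mem_iff.1 (hu.unitary t)).1
  calc (u t).adjoint = (u t).adjoint * (u t * u (-t)) := by rw [hu.mul_neg, mul_one]
    _ = u (-t) := by rw [← mul_assoc, h1, one_mul]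

theorem inner_left (t : ℝ) (Φ Ψ : K) : inner ℂ (u t Φ) Ψ = inner ℂ Φ (u (-t) Ψ) := by
  rw [← hu.adjoint_eq, ContinuousLinearMap.adjoint_inner_right]

theorem inner_map (t : ℝ) (Φ Ψ : K) : inner ℂ (u t Φ) (u t Ψ) = inner ℂ Φ Ψ := by
  rw [hu.inner_left, hu.neg_apply]

theorem norm_map (t : ℝ) (Φ : K) : ‖u t Φ‖ = ‖Φ‖ := by
  rw [@norm_eq_sqrt_re_inner ℂ, hu.inner_map, ← @norm_eq_sqrt_re_inner ℂ]

theorem hasDerivAt {Φ Ψ : K} (h : HasDerivAt (fun t => u t Φ) (Complex.I • Ψ) 0) (t : ℝ) :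
    HasDerivAt (fun t => u t Φ) (Complex.I • u t Ψ) t := by
  have h1 : HasDerivAt (fun r => u (r - t) Φ) (Complex.I • Ψ) t := by
    have := (sub_self t).symm ▸ h
    exact HasDerivAt.comp_sub_const t t this
  have h2 := ((u t).restrictScalars ℝ).hasFDerivAt.comp_hasDerivAt t h1
  simp only [ContinuousLinearMap.coe_restrictScalars', map_smul] at h2
  refine h2.congr_of_eventuallyEq (Filter.Eventually.of_forall fun r => ?_)
  change u r Φ = (u t * u (r - t)) Φ
  rw [← hu.add]
  congr 2
  ring

theorem hasDerivAt_map {Φ Ψ : K} (h : HasDerivAt (fun t => u t Φ) (Complex.I • Ψ) 0) (t : ℝ) :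
    HasDerivAt (fun r => u r (u t Φ)) (Complex.I • u t Ψ) 0 := by
  have h2 := ((u t).restrictScalars ℝ).hasFDerivAt.comp_hasDerivAt 0 h
  simp only [ContinuousLinearMap.coe_restrictScalars', map_smul] at h2
  refine h2.congr_of_eventuallyEq (Filter.Eventually.of_forall fun r => ?_)
  change (u r * u t) Φ = (u t * u r) Φ
  rw [← hu.add, ← hu.add, add_comm]

/-- Generators of unitary groups are symmetric. -/
theorem inner_generator {Φ Ψ Φ' Ψ' : K} (h : HasDerivAt (fun t => u t Φ) (Complex.I • Ψ) 0)
    (h' : HasDerivAt (fun t => u t Φ') (Complex.I • Ψ') 0) :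
    inner ℂ Φ Ψ' = inner ℂ Ψ Φ' := by
  have h1 := HasDerivAt.inner ℂ h h'
  simp only [hu.inner_map, hu.zero, one_apply_eq_self, inner_smul_left,
    inner_smul_right, Complex.conj_I] at h1
  have h2 := h1.unique (hasDerivAt_const (0 : ℝ) (inner ℂ Φ Φ'))
  have h3 : Complex.I * (inner ℂ Φ Ψ' - inner ℂ Ψ Φ') = 0 := by linear_combination h2
  simpa [sub_eq_zero] using h3

/-- The adjoint of an invariant densely defined restriction of the generator is contained in the
generator. -/
theorem hasDerivAt_of_adjoint {D : Submodule ℂ (K × K)}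
    (hD : ∀ p ∈ D, HasDerivAt (fun t => u t p.1) (Complex.I • p.2) 0)
    (hdense : Dense (Prod.fst '' (D : Set (K × K))))
    (hinv : ∀ t, ∀ p ∈ D, (u t p.1, u t p.2) ∈ D) {x y : K}
    (h : ∀ p ∈ D, inner ℂ x p.2 = inner ℂ y p.1) :
    HasDerivAt (fun t => u t x) (Complex.I • y) 0 := by
  -- If y is the value of the generator at x, then u_t x - x must be this integral. Proving that
  -- identity for all t suffices, since the integral is differentiable.
  set F : ℝ → K := fun t => ∫ s in (0 : ℝ)..t, Complex.I • u s y with hF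
  have hcont : Continuous fun s => Complex.I • u s y := (hu.continuous y).const_smul _
  have hF' : ∀ t, HasDerivAt F (Complex.I • u t y) t := fun t =>
    intervalIntegral.integral_hasDerivAt_right (hcont.intervalIntegrable _ _)
      (hcont.stronglyMeasurableAtFilter _ _) hcont.continuousAt
  have key : ∀ t, u t x = x + F t := by
    intro t
    rw [← sub_eq_iff_eq_add]
    refine hdense.eq_of_inner_left ℂ ?_
    rintro _ ⟨p, hp, rfl⟩
    -- The orbit of x is not yet known to be differentiable, so u_r is moved onto p.1. Invariance of
    -- D keeps the moved pair in D, where the hypothesis on x and y makes the two derivatives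
    -- cancel.
    have hder : ∀ r, HasDerivAt (fun r => inner ℂ (u r x - F r) p.1) 0 r := by
      intro r
      have h1 : HasDerivAt (fun r => inner ℂ x (u (-r) p.1))
          (inner ℂ x (-(Complex.I • u (-r) p.2))) r := by
        have h2 : HasDerivAt (fun r => u (-r) p.1) (-(Complex.I • u (-r) p.2)) r := by
          have := (hu.hasDerivAt (hD p hp) (-r)).scomp r (hasDerivAt_neg r)
          rw [neg_smul, one_smul] at this
          exact this
        have := HasDerivAt.inner ℂ (hasDerivAt_const r x) h2
        simpa using this
      have h2 := HasDerivAt.inner ℂ (hF' r) (hasDerivAt_const r p.1)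
      have h3 := h1.sub h2
      refine (h3.congr_deriv ?_).congr_of_eventuallyEq (Filter.Eventually.of_forall fun r => ?_)
      · have := h _ (hinv (-r) p hp)
        simp only [inner_neg_right, inner_smul_right, inner_smul_left, Complex.conj_I,
          inner_zero_right, this, hu.inner_left]
        ring
      · simp only [inner_sub_left, hu.inner_left, Pi.sub_apply]
    have := is_const_of_deriv_eq_zero (fun r => (hder r).differentiableAt)
      (fun r => (hder r).deriv) t 0
    rw [this]
    simp [hF, hu.zero]
  have h0 := (hF' 0).const_add x
  rw [hu.zero] at h0
  exact h0.congr_of_eventuallyEq (Filter.Eventually.of_forall key)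

/-- The derivative condition at 0 is equivalent to the integral equation u_t x = x + ∫₀ᵗ i u_s y ds
for all t. Both sides of the latter are continuous in (x, y), so the condition is closed. -/
theorem isClosed_generator :
    IsClosed {p : K × K | HasDerivAt (fun t => u t p.1) (Complex.I • p.2) 0} := by
  set F : K → ℝ → K := fun y t => ∫ s in (0 : ℝ)..t, Complex.I • u s y with hF
  have hcont : ∀ y, Continuous fun s => Complex.I • u s y :=
    fun y => (hu.continuous y).const_smul _
  have hF' : ∀ y t, HasDerivAt (F y) (Complex.I • u t y) t := fun y t =>
    intervalIntegral.integral_hasDerivAt_right ((hcont y).intervalIntegrable _ _)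
      ((hcont y).stronglyMeasurableAtFilter _ _) (hcont y).continuousAt
  have hFc : ∀ t, Continuous fun y => F y t := by
    intro t
    have : ∀ y y', ‖F y t - F y' t‖ ≤ |t| * ‖y - y'‖ := by
      intro y y'
      rw [hF]
      dsimp only
      rw [← intervalIntegral.integral_sub ((hcont y).intervalIntegrable _ _)
        ((hcont y').intervalIntegrable _ _)]
      refine (intervalIntegral.norm_integral_le_of_norm_le_const (C := ‖y - y'‖) ?_).trans_eq ?_
      · intro s _
        rw [← smul_sub, ← map_sub, norm_smul, hu.norm_map, Complex.norm_I, one_mul]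
      · rw [sub_zero, mul_comm]
    exact (LipschitzWith.of_dist_le_mul (K := ‖t‖₊) fun y y' => by
      rw [dist_eq_norm, dist_eq_norm]; exact this y y').continuous
  have hset : {p : K × K | HasDerivAt (fun t => u t p.1) (Complex.I • p.2) 0} =
      {p : K × K | ∀ t, u t p.1 = p.1 + F p.2 t} := by
    ext p
    constructor
    · intro hp t
      have hder : ∀ r, HasDerivAt (fun r => u r p.1 - F p.2 r) 0 r := fun r =>
        ((hu.hasDerivAt hp r).sub (hF' p.2 r)).congr_deriv (sub_self _)
      have := is_const_of_deriv_eq_zero (fun r => (hder r).differentiableAt)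
        (fun r => (hder r).deriv) t 0
      simp only [hF, hu.zero, intervalIntegral.integral_same, sub_zero,
        one_apply_eq_self] at this
      exact sub_eq_iff_eq_add.1 this
    · intro hp
      have h0 := (hF' p.2 0).const_add p.1
      rw [hu.zero] at h0
      exact h0.congr_of_eventuallyEq (Filter.Eventually.of_forall hp)
  rw [hset, Set.ofPred_forall]
  refine isClosed_iInter fun t => isClosed_eq ((u t).continuous.comp continuous_fst) ?_
  exact continuous_fst.add ((hFc t).comp continuous_snd)

/-- Nelson's invariant core theorem, in terms of graphs. -/
theorem mem_topologicalClosure_iff {D : Submodule ℂ (K × K)}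
    (hD : ∀ p ∈ D, HasDerivAt (fun t => u t p.1) (Complex.I • p.2) 0)
    (hdense : Dense (Prod.fst '' (D : Set (K × K))))
    (hinv : ∀ t, ∀ p ∈ D, (u t p.1, u t p.2) ∈ D) (p : K × K) :
    p ∈ D.topologicalClosure ↔ HasDerivAt (fun t => u t p.1) (Complex.I • p.2) 0 := by
  constructor
  · intro hp
    exact closure_minimal (t := {p : K × K | HasDerivAt (fun t => u t p.1) (Complex.I • p.2) 0})
      hD hu.isClosed_generator hp
  · intro hp
    -- In the Hilbert space norm on K × K the closure of D is its double orthogonal complement.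
    set e := (WithLp.prodContinuousLinearEquiv 2 ℂ K K) with he
    set D' : Submodule ℂ (WithLp 2 (K × K)) := D.comap (e : WithLp 2 (K × K) →ₗ[ℂ] K × K)
    have hmem : WithLp.toLp 2 p ∈ D'.topologicalClosure := by
      rw [← Submodule.orthogonal_orthogonal_eq_closure, Submodule.mem_orthogonal]
      intro q hq
      rw [Submodule.mem_orthogonal] at hq
      -- Orthogonality of q = (q₁, q₂) to D says that q₂ is in the domain of the adjoint of D, with
      -- value -q₁. So (q₂, -q₁) belongs to the generator, and symmetry of the generator makes q
      -- orthogonal to p.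
      have h1 : HasDerivAt (fun t => u t q.snd) (Complex.I • (-q.fst)) 0 := by
        refine hu.hasDerivAt_of_adjoint hD hdense hinv fun r hr => ?_
        have := hq (WithLp.toLp 2 r) hr
        rw [WithLp.prod_inner_apply] at this
        have h2 := congrArg conj this
        simp only [map_add, inner_conj_symm, map_zero] at h2
        rw [inner_neg_left]
        exact eq_neg_of_add_eq_zero_right h2
      have h2 := hu.inner_generator h1 hp
      rw [WithLp.prod_inner_apply]
      rw [inner_neg_left] at h2
      change inner ℂ q.fst p.1 + inner ℂ q.snd p.2 = 0
      rw [h2]; ring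
    have := map_mem_closure e.continuous (s := (D' : Set (WithLp 2 (K × K)))) (t := D) hmem
      fun x hx => hx
    exact this

theorem isUnitaryGroupOf_closure {D : Submodule ℂ (K × K)}
    (hD : ∀ p ∈ D, HasDerivAt (fun t => u t p.1) (Complex.I • p.2) 0)
    (hdense : Dense (Prod.fst '' (D : Set (K × K))))
    (hinv : ∀ t, ∀ p ∈ D, (u t p.1, u t p.2) ∈ D) :
    IsUnitaryGroupOf D.topologicalClosure.toLinearPMap u := by
  refine ⟨hu.zero, hu.add, hu.unitary, hu.continuous, fun Φ Ψ => ?_⟩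
  rw [Submodule.toLinearPMap_graph_eq, hu.mem_topologicalClosure_iff hD hdense hinv]
  -- The closure is the graph of a function because a derivative at 0 is unique.
  rintro ⟨x, y⟩ hx (rfl : x = 0)
  rw [hu.mem_topologicalClosure_iff hD hdense hinv] at hx
  have h0 : HasDerivAt (fun t => u t (0 : K)) 0 0 := by
    simpa using hasDerivAt_const (0 : ℝ) (0 : K)
  have := hx.unique h0
  simpa using this

end IsUnitaryGroup

namespace IsUnitaryGroupOf

variable {L : K →ₗ.[ℂ] K} {u v : ℝ → K →L[ℂ] K}

/-- L ⊆ L* is symmetry of the generator. For L* ⊆ L, the graph of L is itself an invariant core, so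
`hasDerivAt_of_adjoint` applies to it. -/
theorem isSelfAdjoint (hu : IsUnitaryGroupOf L u) (hL : Dense (L.domain : Set K)) :
    IsSelfAdjoint L := by
  have hG := hu.isUnitaryGroup
  rw [LinearPMap.isSelfAdjoint_def]
  refine LinearPMap.eq_of_eq_graph ?_
  rw [LinearPMap.adjoint_graph_eq_graph_adjoint hL]
  ext ⟨x, y⟩
  rw [Submodule.mem_adjoint_iff]
  constructor
  · intro h
    rw [hu.generator]
    refine hG.hasDerivAt_of_adjoint (D := L.graph) (fun p hp => (hu.generator _ _).1 hp) ?_ ?_ ?_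
    · convert hL using 1
      ext z
      rw [← LinearPMap.graph_map_fst_eq_domain]
      rfl
    · intro t p hp
      rw [hu.generator] at hp ⊢
      exact hG.hasDerivAt_map hp t
    · intro p hp
      have := congrArg conj (h p.1 p.2 hp)
      simp only [map_sub, inner_conj_symm, map_zero] at this
      linear_combination this
  · intro h a b hab
    rw [hu.generator] at h hab
    rw [hG.inner_generator hab h]; ring

/-- For a and x in the domain, (u_r a | v_r x) has zero derivative by symmetry of the common
generator. Hence u_{-t} v_t is the identity on a dense set. -/
theorem eq (hu : IsUnitaryGroupOf L u) (hv : IsUnitaryGroupOf L v)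
    (hL : Dense (L.domain : Set K)) : u = v := by
  have hG := hu.isUnitaryGroup
  have hG' := hv.isUnitaryGroup
  funext t
  refine DFunLike.coe_injective ((u t).continuous.ext_on hL (v t).continuous fun x hx => ?_)
  obtain ⟨y, hxy⟩ := LinearPMap.mem_domain_iff.1 hx
  have hx' := (hv.generator _ _).1 hxy
  have key : u (-t) (v t x) = x := by
    refine hL.eq_of_inner_right ℂ ?_
    intro a ha
    obtain ⟨b, hab⟩ := LinearPMap.mem_domain_iff.1 ha
    have ha' := (hu.generator _ _).1 hab
    have hder : ∀ r, HasDerivAt (fun r => inner ℂ (u r a) (v r x)) 0 r := fun r => by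
      refine (HasDerivAt.inner ℂ (hG.hasDerivAt ha' r) (hG'.hasDerivAt hx' r)).congr_deriv ?_
      have h1 := hG.inner_generator (hG.hasDerivAt_map ha' r)
        ((hu.generator _ _).1 ((hv.generator _ _).2 (hG'.hasDerivAt_map hx' r)))
      simp only [inner_smul_left, inner_smul_right, h1, Complex.conj_I]
      ring
    have := is_const_of_deriv_eq_zero (fun r => (hder r).differentiableAt)
      (fun r => (hder r).deriv) t 0
    simpa [hG.inner_left, hu.zero, hv.zero] using this
  have := congrArg (u t) key
  rw [hG.apply_neg] at this
  exact this.symm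

theorem expI_eq (hu : IsUnitaryGroupOf L u) (hL : Dense (L.domain : Set K)) : expI L = u := by
  have h : ∃ u, IsUnitaryGroupOf L u := ⟨u, hu⟩
  rw [expI, dif_pos h]
  exact h.choose_spec.eq hu hL

theorem generator_unique {L' : K →ₗ.[ℂ] K} (hu : IsUnitaryGroupOf L u)
    (hu' : IsUnitaryGroupOf L' u) : L = L' := by
  refine LinearPMap.eq_of_eq_graph ?_
  ext ⟨x, y⟩
  rw [hu.generator, hu'.generator]

end IsUnitaryGroupOf

end UnitaryGroup

/-! ### Resolvents and bounded approximants of a self-adjoint operator -/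

section Stone

variable {K : Type*} [NormedAddCommGroup K] [InnerProductSpace ℂ K] [CompleteSpace K]
  {h : K →ₗ.[ℂ] K}

theorem IsSelfAdjoint.mem_graph_iff (hh : IsSelfAdjoint h) (x y : K) :
    (x, y) ∈ h.graph ↔ ∀ a b, (a, b) ∈ h.graph → inner ℂ b x = inner ℂ a y := by
  conv_lhs => rw [← LinearPMap.isSelfAdjoint_def.1 hh]
  rw [LinearPMap.adjoint_graph_eq_graph_adjoint hh.dense_domain, Submodule.mem_adjoint_iff]
  simp only [sub_eq_zero]

theorem IsSelfAdjoint.graph_inner (hh : IsSelfAdjoint h) {a b x y : K} (hab : (a, b) ∈ h.graph)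
    (hxy : (x, y) ∈ h.graph) : inner ℂ b x = inner ℂ a y :=
  (hh.mem_graph_iff x y).1 hxy a b hab

/-- The cross term vanishes because (a|b) is real for (a, b) in the graph. The resulting bound gives
both injectivity and closed range of 1 + iεh. -/
theorem IsSelfAdjoint.norm_add_I_smul (hh : IsSelfAdjoint h) {a b : K} (hab : (a, b) ∈ h.graph)
    (ε : ℝ) : ‖a + (Complex.I * ε) • b‖ ^ 2 = ‖a‖ ^ 2 + (ε * ‖b‖) ^ 2 := by
  have h1 := hh.graph_inner hab hab
  have h2 : (inner ℂ a b : ℂ).im = 0 := by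
    have h3 := inner_conj_symm (𝕜 := ℂ) a b
    rw [h1] at h3
    exact Complex.conj_eq_iff_im.1 h3
  rw [@norm_add_sq ℂ, inner_smul_right, norm_smul]
  simp [h2, mul_pow]

theorem IsSelfAdjoint.norm_le_norm_add_I_smul (hh : IsSelfAdjoint h) {a b : K}
    (hab : (a, b) ∈ h.graph) (ε : ℝ) : ‖a‖ ≤ ‖a + (Complex.I * ε) • b‖ := by
  refine le_of_sq_le_sq ?_ (norm_nonneg _)
  rw [hh.norm_add_I_smul hab]
  have := sq_nonneg (ε * ‖b‖)
  linarith

theorem IsSelfAdjoint.eq_of_add_I_smul_eq (hh : IsSelfAdjoint h) {a b a' b' y : K} {ε : ℝ}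
    (hab : (a, b) ∈ h.graph) (hab' : (a', b') ∈ h.graph) (h1 : a + (Complex.I * ε) • b = y)
    (h2 : a' + (Complex.I * ε) • b' = y) : a = a' := by
  have h3 := hh.norm_le_norm_add_I_smul (h.graph.sub_mem hab hab') ε
  have h4 : (a - a') + (Complex.I * ε) • (b - b') = 0 := by
    rw [smul_sub, sub_add_sub_comm, h1, h2, sub_self]
  rw [h4, norm_zero] at h3
  exact sub_eq_zero.1 (norm_le_zero_iff.1 h3)

/-- The map (a, b) ↦ a + iεb on the closed graph is bounded below, so its range is closed. A vector
z orthogonal to the range lies in the domain of h* = h with hz = (iε)⁻¹z. Then (1 - iεh)z = 0, so z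
= 0. -/
theorem IsSelfAdjoint.exists_add_I_smul_eq (hh : IsSelfAdjoint h) {ε : ℝ} (hε : ε ≠ 0) (y : K) :
    ∃ p ∈ h.graph, p.1 + (Complex.I * ε) • p.2 = y := by
  have hcl : IsClosed (h.graph : Set (K × K)) := hh.isClosed
  have : CompleteSpace h.graph := hcl.completeSpace_coe
  let S : h.graph →L[ℂ] K := (ContinuousLinearMap.fst ℂ K K +
    (Complex.I * ε : ℂ) • ContinuousLinearMap.snd ℂ K K) ∘L h.graph.subtypeL
  have hS : ∀ p, S p = p.1.1 + (Complex.I * ε) • p.1.2 := fun p => rfl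
  have hanti : AntilipschitzWith (Real.toNNReal (max 1 |ε|⁻¹)) S := by
    refine AddMonoidHomClass.antilipschitz_of_bound S fun p => ?_
    have h1 := hh.norm_le_norm_add_I_smul p.2 ε
    have h2 : |ε| * ‖p.1.2‖ ≤ ‖S p‖ := by
      refine le_of_sq_le_sq ?_ (norm_nonneg _)
      rw [hS, hh.norm_add_I_smul p.2, mul_pow, mul_pow, sq_abs]
      have := sq_nonneg ‖p.1.1‖
      linarith
    rw [Real.coe_toNNReal _ (le_max_of_le_left zero_le_one)]
    change max ‖p.1.1‖ ‖p.1.2‖ ≤ _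
    refine max_le ?_ ?_
    · refine h1.trans ?_
      rw [← hS]
      exact le_mul_of_one_le_left (norm_nonneg _) (le_max_left _ _)
    · refine le_trans ?_ (mul_le_mul_of_nonneg_right (le_max_right 1 |ε|⁻¹) (norm_nonneg _))
      rw [inv_mul_eq_div, le_div_iff₀ (abs_pos.2 hε), mul_comm]
      exact h2
  have hrange : IsClosed (S.range : Set K) := by
    rw [LinearMap.coe_range]
    exact hanti.isClosed_range S.uniformContinuous
  have : CompleteSpace S.range := hrange.completeSpace_coe
  have hbot : S.rangeᗮ = ⊥ := by
    rw [Submodule.eq_bot_iff]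
    intro z hz
    rw [Submodule.mem_orthogonal] at hz
    have hc : (Complex.I * ε : ℂ) ≠ 0 := mul_ne_zero Complex.I_ne_zero (by exact_mod_cast hε)
    have hz' : (z, ((Complex.I * ε : ℂ)⁻¹) • z) ∈ h.graph := by
      rw [hh.mem_graph_iff]
      intro a b hab
      have h1 := hz (S ⟨(a, b), hab⟩) ⟨_, rfl⟩
      rw [hS, inner_add_left, inner_smul_left] at h1
      rw [inner_smul_right]
      have h2 : conj (Complex.I * ε : ℂ) = -(Complex.I * ε) := by simp
      rw [h2] at h1
      field_simp
      linear_combination -h1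
    have h1 := hh.norm_le_norm_add_I_smul hz' (-ε)
    have h2 : z + (Complex.I * ((-ε : ℝ) : ℂ)) • (Complex.I * ε : ℂ)⁻¹ • z = 0 := by
      rw [smul_smul]
      have : Complex.I * ((-ε : ℝ) : ℂ) * (Complex.I * ε : ℂ)⁻¹ = -1 := by
        push_cast
        field_simp
      rw [this]
      simp
    rw [h2, norm_zero] at h1
    exact norm_le_zero_iff.1 h1
  have htop : S.range = ⊤ := (Submodule.orthogonal_eq_bot_iff).1 hbot
  obtain ⟨p, hp⟩ : y ∈ S.range := htop ▸ Submodule.mem_top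
  exact ⟨p.1, p.2, hp⟩

/-- The resolvent `(1 + iεh)⁻¹` of a self-adjoint operator. -/
theorem IsSelfAdjoint.exists_resolvent (hh : IsSelfAdjoint h) {ε : ℝ} (hε : ε ≠ 0) :
    ∃ T : K →L[ℂ] K, (∀ y, ∃ w, (T y, w) ∈ h.graph ∧ T y + (Complex.I * ε) • w = y) ∧
      ∀ y, ‖T y‖ ≤ ‖y‖ := by
  choose p hp hpy using fun y => hh.exists_add_I_smul_eq hε y
  have hadd : ∀ x y, (p (x + y)).1 = (p x).1 + (p y).1 := fun x y =>
    hh.eq_of_add_I_smul_eq (hp _) (h.graph.add_mem (hp x) (hp y)) (hpy _) (by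
      change (p x).1 + (p y).1 + (Complex.I * ε : ℂ) • ((p x).2 + (p y).2) = x + y
      rw [smul_add, add_add_add_comm, hpy, hpy])
  have hsmul : ∀ (c : ℂ) y, (p (c • y)).1 = c • (p y).1 := fun c y =>
    hh.eq_of_add_I_smul_eq (hp _) (h.graph.smul_mem c (hp y)) (hpy _) (by
      change c • (p y).1 + (Complex.I * ε : ℂ) • (c • (p y).2) = c • y
      rw [smul_comm _ c, ← smul_add, hpy])
  have hnorm : ∀ y, ‖(p y).1‖ ≤ ‖y‖ := fun y => by
    have := hh.norm_le_norm_add_I_smul (hp y) ε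
    rwa [hpy] at this
  let T : K →ₗ[ℂ] K := { toFun := fun y => (p y).1, map_add' := hadd, map_smul' := hsmul }
  refine ⟨T.mkContinuous 1 fun y => by rw [one_mul]; exact hnorm y, fun y =>
    ⟨(p y).2, hp y, hpy y⟩, hnorm⟩

open Filter Topology in
/-- Commuting bounded self-adjoint operators `Aₙ` converging strongly to the self-adjoint
operator `h` on its domain. -/
theorem IsSelfAdjoint.exists_approx (hh : IsSelfAdjoint h) :
    ∃ A : ℕ → K →L[ℂ] K, (∀ n, IsSelfAdjoint (A n)) ∧ (∀ n m, Commute (A n) (A m)) ∧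
      ∀ x y, (x, y) ∈ h.graph → Tendsto (fun n => A n x) atTop (𝓝 y) := by
  choose! T hT hTn using fun (ε : ℝ) (hε : ε ≠ 0) => hh.exists_resolvent hε
  have hTeq : ∀ {ε : ℝ}, ε ≠ 0 → ∀ {a b y}, (a, b) ∈ h.graph → a + (Complex.I * ε) • b = y →
      T ε y = a := by
    intro ε hε a b y hab hy
    obtain ⟨w, hw, hwy⟩ := hT ε hε y
    exact hh.eq_of_add_I_smul_eq hw hab hwy hy
  have hTh : ∀ {ε : ℝ}, ε ≠ 0 → ∀ {a b}, (a, b) ∈ h.graph → (T ε a, T ε b) ∈ h.graph := by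
    intro ε hε a b hab
    obtain ⟨w, hw, hwa⟩ := hT ε hε a
    have hc : (Complex.I * ε : ℂ) ≠ 0 := mul_ne_zero Complex.I_ne_zero (by exact_mod_cast hε)
    have hw2 : w = (Complex.I * ε : ℂ)⁻¹ • (a - T ε a) := by
      rw [eq_inv_smul_iff₀ hc, eq_sub_iff_add_eq, add_comm, hwa]
    have h1 : (w, (Complex.I * ε : ℂ)⁻¹ • (b - w)) ∈ h.graph := by
      have := h.graph.smul_mem (Complex.I * ε : ℂ)⁻¹ (h.graph.sub_mem hab hw)
      rw [Prod.mk_sub_mk, Prod.smul_mk, ← hw2] at this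
      exact this
    have h2 : T ε b = w := hTeq hε h1 (by rw [smul_inv_smul₀ hc]; abel)
    rw [h2]
    exact hw
  have hTadj : ∀ {ε : ℝ}, ε ≠ 0 → ∀ x y, inner ℂ (T ε x) y = inner ℂ x (T (-ε) y) := by
    intro ε hε x y
    obtain ⟨w, hw, hwx⟩ := hT ε hε x
    obtain ⟨v, hv, hvy⟩ := hT (-ε) (neg_ne_zero.2 hε) y
    conv_lhs => rw [← hvy]
    conv_rhs => rw [← hwx]
    simp only [inner_add_left, inner_add_right, inner_smul_left, inner_smul_right,
      hh.graph_inner hw hv]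
    simp
  have hTcomm : ∀ {ε δ : ℝ}, ε ≠ 0 → δ ≠ 0 → Commute (T ε) (T δ) := by
    intro ε δ hε hδ
    ext y
    obtain ⟨w, hw, hwy⟩ := hT ε hε y
    change T ε (T δ y) = T δ (T ε y)
    refine hTeq hε (hTh hδ hw) ?_
    rw [← map_smul, ← map_add, hwy]
  set e : ℕ → ℝ := fun n => 1 / ((n : ℝ) + 1) with he
  have hepos : ∀ n, 0 < e n := fun n => Nat.one_div_pos_of_nat
  have hene : ∀ n, e n ≠ 0 := fun n => (hepos n).ne'
  have hene' : ∀ n, -e n ≠ 0 := fun n => neg_ne_zero.2 (hene n)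
  have hc : ∀ n, (2 * Complex.I * e n : ℂ) ≠ 0 := fun n =>
    mul_ne_zero (mul_ne_zero two_ne_zero Complex.I_ne_zero) (by exact_mod_cast hene n)
  -- With T(ε) = (1 + iεh)⁻¹ this is formally h(1 + ε²h²)⁻¹, at ε = 1/(n+1).
  refine ⟨fun n => (2 * Complex.I * e n : ℂ)⁻¹ • (T (-e n) - T (e n)), fun n => ?_, fun n m => ?_,
    fun x y hxy => ?_⟩
  · rw [ContinuousLinearMap.isSelfAdjoint_iff_isSymmetric]
    intro x y
    change inner ℂ ((2 * Complex.I * e n : ℂ)⁻¹ • (T (-e n) x - T (e n) x)) y =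
      inner ℂ x ((2 * Complex.I * e n : ℂ)⁻¹ • (T (-e n) y - T (e n) y))
    rw [inner_smul_left, inner_smul_right, inner_sub_left, inner_sub_right, hTadj (hene n),
      hTadj (hene' n), neg_neg]
    have : conj ((2 * Complex.I * e n : ℂ)⁻¹) = -(2 * Complex.I * e n : ℂ)⁻¹ := by
      have h2 : conj (2 : ℂ) = 2 := Complex.conj_ofNat 2
      simp [h2]
    rw [this]
    ring
  · refine (Commute.smul_left ?_ _).smul_right _
    exact ((hTcomm (hene' n) (hene' m)).sub_left (hTcomm (hene n) (hene' m))).sub_right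
      ((hTcomm (hene' n) (hene m)).sub_left (hTcomm (hene n) (hene m)))
  -- On the domain T(ε)a - a = -iεT(ε)ha tends to 0, and the contraction bound extends the
  -- convergence to all z. On the graph Aₙx is the average of T(-ε)y and T(ε)y, hence tends to y.
  · have hstrong : ∀ z, ∀ s : ℕ → ℝ, (∀ n, s n ≠ 0) → Tendsto s atTop (𝓝 0) →
        Tendsto (fun n => T (s n) z) atTop (𝓝 z) := by
      intro z s hs hs0
      rw [Metric.tendsto_atTop]
      intro δ hδ
      obtain ⟨a, ha, haz⟩ := Metric.mem_closure_iff.1 (hh.dense_domain z) (δ / 3) (by positivity)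
      obtain ⟨b, hab⟩ := LinearPMap.mem_domain_iff.1 ha
      have h1 : Tendsto (fun n => |s n| * ‖b‖) atTop (𝓝 0) := by
        simpa using hs0.abs.mul_const ‖b‖
      obtain ⟨N, hN⟩ := (h1.eventually (gt_mem_nhds (show 0 < δ / 3 by positivity))).exists_forall_of_atTop
      refine ⟨N, fun n hn => ?_⟩
      have h2 : T (s n) a - a = -((Complex.I * s n : ℂ) • T (s n) b) := by
        obtain ⟨w, hw, hwa⟩ := hT (s n) (hs n) a
        have h3 : w = T (s n) b := LinearPMap.mem_graph_snd_inj _ hw (hTh (hs n) hab) rfl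
        rw [← h3]
        nth_rewrite 2 [← hwa]
        abel
      have h4 : ‖T (s n) a - a‖ < δ / 3 := by
        rw [h2, norm_neg, norm_smul, norm_mul, Complex.norm_I, one_mul, Complex.norm_real]
        exact lt_of_le_of_lt (mul_le_mul_of_nonneg_left (hTn _ (hs n) _) (norm_nonneg _)) (hN n hn)
      have h5 : ‖T (s n) (z - a)‖ < δ / 3 := by
        refine lt_of_le_of_lt (hTn _ (hs n) _) ?_
        rwa [← dist_eq_norm]
      rw [dist_eq_norm]
      have h6 : T (s n) z - z = T (s n) (z - a) + (T (s n) a - a) + (a - z) := by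
        rw [map_sub]; abel
      rw [dist_eq_norm, norm_sub_rev] at haz
      rw [h6]
      calc _ ≤ ‖T (s n) (z - a)‖ + ‖T (s n) a - a‖ + ‖a - z‖ := norm_add₃_le
        _ < δ := by linarith
    have he0 : Tendsto e atTop (𝓝 0) := tendsto_one_div_add_atTop_nhds_zero_nat
    have h1 := ((hstrong y (fun n => -e n) hene' (by simpa using he0.neg)).add
      (hstrong y e hene he0)).const_smul (1 / 2 : ℂ)
    have h2 : (1 / 2 : ℂ) • (y + y) = y := by rw [← two_smul ℂ, smul_smul]; norm_num
    rw [h2] at h1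
    refine h1.congr fun n => ?_
    change _ = (2 * Complex.I * e n : ℂ)⁻¹ • (T (-e n) x - T (e n) x)
    have h3 : ∀ δ : ℝ, δ ≠ 0 → T δ x = x - (Complex.I * δ : ℂ) • T δ y := by
      intro δ hδ
      obtain ⟨w, hw, hwa⟩ := hT δ hδ x
      have h3 : w = T δ y := LinearPMap.mem_graph_snd_inj _ hw (hTh hδ hxy) rfl
      rw [← h3]
      exact eq_sub_of_add_eq hwa
    have h4 : T (-e n) x - T (e n) x = (Complex.I * e n : ℂ) • (T (-e n) y + T (e n) y) := by
      rw [h3 _ (hene' n), h3 _ (hene n), smul_add]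
      push_cast
      rw [mul_neg, neg_smul]
      abel
    rw [h4, smul_smul]
    congr 1
    have hen : (e n : ℂ) ≠ 0 := by exact_mod_cast hene n
    field_simp

end Stone

/-! ### Exponentials of bounded operators and their limit -/

section Stone

variable {K : Type*} [NormedAddCommGroup K] [InnerProductSpace ℂ K] [CompleteSpace K]

/-- The unitary group `e^{itA}` of a bounded operator. -/
def expBounded (A : K →L[ℂ] K) (t : ℝ) : K →L[ℂ] K := NormedSpace.exp (t • (Complex.I • A))

theorem hasDerivAt_expBounded (A : K →L[ℂ] K) (x : K) (t : ℝ) :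
    HasDerivAt (fun t => expBounded A t x) (Complex.I • expBounded A t (A x)) t := by
  have h1 := hasDerivAt_exp_smul_const (𝕂 := ℝ) (Complex.I • A) t
  have h2 := ((ContinuousLinearMap.apply ℂ K x).restrictScalars ℝ).hasFDerivAt.comp_hasDerivAt t h1
  refine h2.congr_deriv ?_
  change NormedSpace.exp (t • (Complex.I • A)) (Complex.I • A x) = _
  rw [map_smul]
  rfl

theorem isUnitaryGroup_expBounded {A : K →L[ℂ] K} (hA : IsSelfAdjoint A) :
    IsUnitaryGroup (expBounded A) where
  zero := by simp [expBounded]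
  add t r := by
    letI : NormedAlgebra ℚ (K →L[ℂ] K) := NormedAlgebra.restrictScalars ℚ ℂ _
    rw [expBounded, add_smul, NormedSpace.exp_add_of_commute]
    · rfl
    · exact ((Commute.refl _).smul_left _).smul_right _
  unitary t := by
    letI : NormedAlgebra ℚ (K →L[ℂ] K) := NormedAlgebra.restrictScalars ℚ ℂ _
    refine NormedSpace.exp_mem_unitary_of_mem_skewAdjoint ?_
    rw [skewAdjoint.mem_iff]
    have : t • (Complex.I • A) = ((t : ℂ) * Complex.I) • A := by
      rw [mul_smul]; rfl
    rw [this, star_smul, hA.star_eq]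
    simp
  continuous Φ := continuous_iff_continuousAt.2 fun t =>
    (hasDerivAt_expBounded A Φ t).continuousAt

theorem norm_expBounded_sub_le {A : K →L[ℂ] K} (hA : IsSelfAdjoint A) (t : ℝ) (x : K) :
    ‖expBounded A t x - x‖ ≤ ‖A x‖ * |t| := by
  have h := Convex.norm_image_sub_le_of_norm_hasDerivWithin_le (𝕜 := ℝ) (C := ‖A x‖)
    (s := Set.univ) (x := 0) (y := t)
    (fun r _ => (hasDerivAt_expBounded A x r).hasDerivWithinAt) (fun r _ => by
      rw [norm_smul, Complex.norm_I, one_mul, (isUnitaryGroup_expBounded hA).norm_map])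
    convex_univ trivial trivial
  simpa [(isUnitaryGroup_expBounded hA).zero] using h

theorem expBounded_add {A B : K →L[ℂ] K} (h : Commute A B) (t : ℝ) :
    expBounded (A + B) t = expBounded A t * expBounded B t := by
  letI : NormedAlgebra ℚ (K →L[ℂ] K) := NormedAlgebra.restrictScalars ℚ ℂ _
  rw [expBounded, smul_add, smul_add, NormedSpace.exp_add_of_commute]
  · rfl
  · exact ((((h.smul_left _).smul_right _).smul_left _).smul_right _)

/-- Commutation allows the factorization e^{itB} = e^{itA}e^{it(B-A)}, which reduces the comparison
to the deviation of one group from the identity. -/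
theorem norm_expBounded_sub_expBounded_le {A B : K →L[ℂ] K} (hA : IsSelfAdjoint A)
    (hB : IsSelfAdjoint B) (h : Commute A B) (t : ℝ) (x : K) :
    ‖expBounded B t x - expBounded A t x‖ ≤ ‖B x - A x‖ * |t| := by
  have h1 : expBounded B t = expBounded A t * expBounded (B - A) t := by
    rw [← expBounded_add (h.sub_right (Commute.refl A)), add_sub_cancel]
  have h2 : expBounded B t x - expBounded A t x =
      expBounded A t (expBounded (B - A) t x - x) := by
    rw [h1, map_sub]; rfl
  rw [h2, (isUnitaryGroup_expBounded hA).norm_map]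
  exact norm_expBounded_sub_le (hB.sub hA) t x

open Filter Topology in
/-- Stone's theorem: a self-adjoint operator generates a unitary group. -/
theorem IsSelfAdjoint.exists_isUnitaryGroupOf {h : K →ₗ.[ℂ] K} (hh : IsSelfAdjoint h) :
    ∃ u, IsUnitaryGroupOf h u := by
  obtain ⟨A, hA, hcomm, hlim⟩ := hh.exists_approx
  have hU := fun n => isUnitaryGroup_expBounded (hA n)
  -- On the domain this follows from convergence of Aₙ and the comparison of commuting groups.
  -- Unitarity extends it to all vectors.
  have hcauchy : ∀ t x, CauchySeq fun n => expBounded (A n) t x := by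
    intro t x
    rw [Metric.cauchySeq_iff]
    intro ε hε
    obtain ⟨a, ha, hax⟩ := Metric.mem_closure_iff.1 (hh.dense_domain x) (ε / 3) (by positivity)
    obtain ⟨b, hab⟩ := LinearPMap.mem_domain_iff.1 ha
    have hδ : 0 < ε / 3 / (|t| + 1) := by positivity
    obtain ⟨N, hN⟩ := Metric.cauchySeq_iff.1 (hlim a b hab).cauchySeq _ hδ
    refine ⟨N, fun m hm n hn => ?_⟩
    have h1 : ‖expBounded (A m) t a - expBounded (A n) t a‖ < ε / 3 := by
      refine (norm_expBounded_sub_expBounded_le (hA n) (hA m) (hcomm n m) t a).trans_lt ?_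
      have h2 := hN m hm n hn
      rw [dist_eq_norm, lt_div_iff₀ (by positivity)] at h2
      refine lt_of_le_of_lt ?_ h2
      exact mul_le_mul_of_nonneg_left (by linarith) (norm_nonneg _)
    rw [dist_eq_norm] at hax ⊢
    have h3 : expBounded (A m) t x - expBounded (A n) t x =
        expBounded (A m) t (x - a) + (expBounded (A m) t a - expBounded (A n) t a) -
          expBounded (A n) t (x - a) := by
      rw [map_sub, map_sub]; abel
    rw [h3]
    refine (norm_sub_le _ _).trans_lt ?_
    have h4 := norm_add_le (expBounded (A m) t (x - a))
      (expBounded (A m) t a - expBounded (A n) t a)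
    rw [(hU m).norm_map] at h4
    rw [(hU n).norm_map]
    linarith
  choose v hv using fun t x => cauchySeq_tendsto_of_complete (hcauchy t x)
  have hnorm : ∀ t x, ‖v t x‖ = ‖x‖ := fun t x =>
    tendsto_nhds_unique (hv t x).norm (by simp only [(hU _).norm_map]; exact tendsto_const_nhds)
  let u : ℝ → K →L[ℂ] K := fun t => LinearMap.mkContinuous
    { toFun := v t
      map_add' := fun x y => tendsto_nhds_unique (hv t (x + y))
        (by simp only [map_add]; exact (hv t x).add (hv t y))
      map_smul' := fun c x => tendsto_nhds_unique (hv t (c • x))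
        (by simp only [map_smul]; exact (hv t x).const_smul c) } 1
    fun x => by rw [one_mul]; exact (hnorm t x).le
  have hu : ∀ t x, Tendsto (fun n => expBounded (A n) t x) atTop (𝓝 (u t x)) := hv
  have hnorm' : ∀ t x, ‖u t x‖ = ‖x‖ := hnorm
  have hzero : u 0 = 1 := by
    ext x
    refine tendsto_nhds_unique (hu 0 x) ?_
    simp only [(hU _).zero]
    exact tendsto_const_nhds
  have hadd : ∀ t r, u (t + r) = u t * u r := by
    intro t r
    ext x
    refine tendsto_nhds_unique (hu (t + r) x) ?_
    have h1 : Tendsto (fun n => expBounded (A n) t (expBounded (A n) r x - u r x)) atTop (𝓝 0) := by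
      rw [tendsto_zero_iff_norm_tendsto_zero]
      simp only [(hU _).norm_map]
      exact tendsto_iff_norm_sub_tendsto_zero.1 (hu r x)
    have h2 := h1.add (hu t (u r x))
    rw [zero_add] at h2
    refine h2.congr fun n => ?_
    rw [map_sub, sub_add_cancel, (hU n).add]
    rfl
  -- Continuity at t = 0 uniformly in n. Pointwise limits in n alone would give neither continuity
  -- nor differentiability of u.
  have hequi : ∀ y : K, ∀ ε > 0, ∃ δ > 0, ∀ t : ℝ, |t| < δ → ∀ n,
      ‖expBounded (A n) t y - y‖ ≤ ε := by
    intro y ε hε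
    obtain ⟨a, ha, hay⟩ := Metric.mem_closure_iff.1 (hh.dense_domain y) (ε / 3) (by positivity)
    obtain ⟨b, hab⟩ := LinearPMap.mem_domain_iff.1 ha
    obtain ⟨C, hC⟩ := (hlim a b hab).norm.bddAbove_range
    have hC' : ∀ n, ‖A n a‖ ≤ |C| + 1 := fun n =>
      ((hC ⟨n, rfl⟩).trans (le_abs_self C)).trans (by linarith)
    refine ⟨ε / 3 / (|C| + 1), by positivity, fun t ht n => ?_⟩
    rw [lt_div_iff₀ (by positivity)] at ht
    have h1 : ‖expBounded (A n) t a - a‖ ≤ ε / 3 := by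
      refine (norm_expBounded_sub_le (hA n) t a).trans ?_
      have := mul_le_mul_of_nonneg_right (hC' n) (abs_nonneg t)
      linarith
    rw [dist_eq_norm] at hay
    have h3 : expBounded (A n) t y - y =
        expBounded (A n) t (y - a) + (expBounded (A n) t a - a) - (y - a) := by
      rw [map_sub]; abel
    rw [h3]
    refine (norm_sub_le _ _).trans ?_
    have h4 := norm_add_le (expBounded (A n) t (y - a)) (expBounded (A n) t a - a)
    rw [(hU n).norm_map] at h4
    linarith
  have hcont0 : ∀ y, Tendsto (fun t => u t y) (𝓝 0) (𝓝 y) := by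
    intro y
    rw [Metric.tendsto_nhds_nhds]
    intro ε hε
    obtain ⟨δ, hδ, H⟩ := hequi y (ε / 2) (by positivity)
    refine ⟨δ, hδ, fun t ht => ?_⟩
    rw [Real.dist_eq, sub_zero] at ht
    have h1 : ‖u t y - y‖ ≤ ε / 2 :=
      le_of_tendsto ((hu t y).sub_const y).norm (Eventually.of_forall fun n => H t ht n)
    rw [dist_eq_norm]
    linarith
  have hcont : ∀ y, Continuous fun t => u t y := by
    intro y
    rw [continuous_iff_continuousAt]
    intro t
    have h1 : Tendsto (fun r => u t (u (r - t) y)) (𝓝 t) (𝓝 (u t y)) := by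
      refine ((u t).continuous.tendsto y).comp ((hcont0 y).comp ?_)
      have : Tendsto (fun r => r - t) (𝓝 t) (𝓝 (t - t)) := tendsto_id.sub_const t
      rwa [sub_self] at this
    refine h1.congr fun r => ?_
    change (u t * u (r - t)) y = u r y
    rw [← hadd, add_sub_cancel]
  have hinner : ∀ t x y, inner ℂ (u t x) (u t y) = inner ℂ x y := fun t x y =>
    (LinearMap.norm_map_iff_inner_map_map (𝕜 := ℂ) (u t)).1 (hnorm' t) x y
  have hunit : ∀ t, u t ∈ unitary (K →L[ℂ] K) := by
    intro t
    have h1 : (u t).adjoint * u t = 1 := by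
      ext x
      refine ext_inner_left ℂ fun y => ?_
      change inner ℂ y ((u t).adjoint (u t x)) = inner ℂ y x
      rw [ContinuousLinearMap.adjoint_inner_right, hinner]
    have h2 : u t * u (-t) = 1 := by rw [← hadd, add_neg_cancel, hzero]
    have h3 : (u t).adjoint = u (-t) := by
      calc (u t).adjoint = (u t).adjoint * (u t * u (-t)) := by rw [h2, mul_one]
        _ = u (-t) := by rw [← mul_assoc, h1, one_mul]
    rw [Unitary.mem_iff, ContinuousLinearMap.star_eq_adjoint]
    exact ⟨h1, by rw [h3, h2]⟩
  -- The mean value inequality for e^{itAₙ}x - ity bounds the increment by (‖Aₙx - y‖ + ε)|t| on an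
  -- interval independent of n. Letting n tend to infinity leaves ε|t|.
  have hder : ∀ x y, (x, y) ∈ h.graph → HasDerivAt (fun t => u t x) (Complex.I • y) 0 := by
    intro x y hxy
    rw [hasDerivAt_iff_isLittleO, Asymptotics.isLittleO_iff]
    intro ε hε
    obtain ⟨δ, hδ, H⟩ := hequi y ε hε
    filter_upwards [Metric.ball_mem_nhds (0 : ℝ) hδ] with t ht
    rw [Metric.mem_ball, Real.dist_eq, sub_zero] at ht
    have h1 : ∀ n, ‖expBounded (A n) t x - x - t • (Complex.I • y)‖ ≤
        (‖A n x - y‖ + ε) * |t| := by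
      intro n
      have h2 := Convex.norm_image_sub_le_of_norm_hasDerivWithin_le (𝕜 := ℝ)
        (f := fun r : ℝ => expBounded (A n) r x - r • (Complex.I • y))
        (f' := fun r => Complex.I • (expBounded (A n) r (A n x) - y))
        (C := ‖A n x - y‖ + ε) (s := Metric.ball 0 δ) (x := 0) (y := t)
        (fun r _ => by
          have h3 := (hasDerivAt_expBounded (A n) x r).sub
            ((hasDerivAt_id r).smul_const (Complex.I • y))
          rw [one_smul, ← smul_sub] at h3
          exact h3.hasDerivWithinAt)
        (fun r hr => by
          rw [norm_smul, Complex.norm_I, one_mul]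
          have h3 : expBounded (A n) r (A n x) - y =
              expBounded (A n) r (A n x - y) + (expBounded (A n) r y - y) := by
            rw [map_sub]; abel
          rw [h3]
          refine (norm_add_le _ _).trans ?_
          rw [(hU n).norm_map]
          have := H r (by simpa using hr) n
          linarith)
        (convex_ball 0 δ) (by simpa using hδ) (by simpa using ht)
      simp only [(hU n).zero, zero_smul, sub_zero, one_apply_eq_self] at h2
      rw [sub_right_comm]
      exact h2
    have h2 : ‖u t x - x - t • (Complex.I • y)‖ ≤ (0 + ε) * |t| := by
      refine le_of_tendsto_of_tendsto (((hu t x).sub_const x).sub_const _).norm ?_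
        (Eventually.of_forall h1)
      exact ((tendsto_iff_norm_sub_tendsto_zero.1 (hlim x y hxy)).add_const ε).mul_const _
    rw [zero_add] at h2
    simpa [hzero] using h2
  have hG : IsUnitaryGroup u := ⟨hzero, hadd, hunit, hcont⟩
  refine ⟨u, hzero, hadd, hunit, hcont, fun x y => ⟨hder x y, fun hxy => ?_⟩⟩
  -- The generator of u is a symmetric extension of h, and a self-adjoint operator has no proper
  -- one.
  rw [hh.mem_graph_iff]
  intro a b hab
  exact (hG.inner_generator (hder a b hab) hxy).symm

end Stone

/-! ### Hilbert--Schmidt operators -/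

section HilbertSchmidtNorm

variable {H₁ H₂ : Type*} [NormedAddCommGroup H₁] [InnerProductSpace ℂ H₁] [CompleteSpace H₁]
  [NormedAddCommGroup H₂] [InnerProductSpace ℂ H₂] [CompleteSpace H₂]

theorem HilbertBasis.tsum_enorm_inner_sq {ι : Type*} (b : HilbertBasis ι ℂ H₁) (x : H₁) :
    ∑' i, ‖inner ℂ (b i) x‖ₑ ^ 2 = ‖x‖ₑ ^ 2 := by
  have h1 : HasSum (fun i => ‖inner ℂ (b i) x‖ ^ 2) (‖x‖ ^ 2) := by
    have h := (Complex.hasSum_iff _ _).1 (b.hasSum_inner_mul_inner x x)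
    have h2 := h.1
    rw [inner_self_eq_norm_sq_to_K] at h2
    convert h2 using 1
    · funext i
      rw [← inner_conj_symm x, ← Complex.normSq_eq_conj_mul_self, Complex.ofReal_re,
        Complex.normSq_eq_norm_sq]
    · norm_cast
  have h2 : ∀ z : ℝ, 0 ≤ z → ENNReal.ofReal (z ^ 2) = ENNReal.ofReal z ^ 2 := fun z hz =>
    ENNReal.ofReal_pow hz 2
  simp only [← ofReal_norm]
  simp_rw [← h2 _ (norm_nonneg _)]
  rw [← ENNReal.ofReal_tsum_of_nonneg (fun _ => by positivity) h1.summable, h1.tsum_eq]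

/-- Both sums equal the double sum of |(cⱼ|A bᵢ)|². Working in [0,∞] makes the exchange of sums
unconditional. -/
theorem tsum_enorm_sq_adjoint {ι κ : Type*} (b : HilbertBasis ι ℂ H₁) (c : HilbertBasis κ ℂ H₂)
    (A : H₁ →L[ℂ] H₂) : ∑' i, ‖A (b i)‖ₑ ^ 2 = ∑' j, ‖A.adjoint (c j)‖ₑ ^ 2 := by
  simp_rw [← c.tsum_enorm_inner_sq (A _), ← b.tsum_enorm_inner_sq (A.adjoint _)]
  rw [ENNReal.tsum_comm]
  refine tsum_congr fun j => tsum_congr fun i => ?_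
  rw [ContinuousLinearMap.adjoint_inner_right, ← inner_conj_symm, ← ofReal_norm, RCLike.norm_conj,
    ofReal_norm]

/-- The Hilbert--Schmidt norm does not depend on the orthonormal basis. -/
theorem tsum_enorm_sq_eq {ι κ : Type*} (b : HilbertBasis ι ℂ H₁) (c : HilbertBasis κ ℂ H₁)
    (A : H₁ →L[ℂ] H₂) : ∑' i, ‖A (b i)‖ₑ ^ 2 = ∑' j, ‖A (c j)‖ₑ ^ 2 := by
  rw [tsum_enorm_sq_adjoint b (onb H₂), tsum_enorm_sq_adjoint c (onb H₂)]

theorem summable_sq_of_tsum_enorm_ne_top {ι : Type*} {x : ι → H₁}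
    (h : ∑' i, ‖x i‖ₑ ^ 2 ≠ ⊤) : Summable fun i => ‖x i‖ ^ 2 := by
  have h1 := ENNReal.summable_toReal h
  refine h1.congr fun i => ?_
  rw [ENNReal.toReal_pow, toReal_enorm]

theorem tsum_enorm_sq_eq_ofReal {ι : Type*} {x : ι → H₁} (h : Summable fun i => ‖x i‖ ^ 2) :
    ∑' i, ‖x i‖ₑ ^ 2 = ENNReal.ofReal (∑' i, ‖x i‖ ^ 2) := by
  rw [ENNReal.ofReal_tsum_of_nonneg (fun _ => by positivity) h]
  refine tsum_congr fun i => ?_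
  rw [ENNReal.ofReal_pow (norm_nonneg _), ofReal_norm]

theorem memℓp_two_iff {ι : Type*} {x : ι → H₁} :
    Memℓp x 2 ↔ ∑' i, ‖x i‖ₑ ^ 2 ≠ ⊤ := by
  constructor
  · intro h
    have h1 : Summable fun i => ‖x i‖ ^ 2 := by
      simpa using h.summable (by norm_num)
    rw [tsum_enorm_sq_eq_ofReal h1]
    exact ENNReal.ofReal_ne_top
  · intro h
    refine memℓp_gen ?_
    simpa using summable_sq_of_tsum_enorm_ne_top h

end HilbertSchmidtNorm

section HilbertSchmidt

variable {H : Type*} [NormedAddCommGroup H] [InnerProductSpace ℂ H] [CompleteSpace H]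

theorem mem_HilbertSchmidt_iff {ι : Type*} (b : HilbertBasis ι ℂ H) {A : H →L[ℂ] H} :
    A ∈ HilbertSchmidt H ↔ ∑' i, ‖A (b i)‖ₑ ^ 2 ≠ ⊤ := by
  rw [tsum_enorm_sq_eq b (onb H)]
  exact memℓp_two_iff

theorem adjoint_mem_HilbertSchmidt {A : H →L[ℂ] H} (hA : A ∈ HilbertSchmidt H) :
    A.adjoint ∈ HilbertSchmidt H := by
  rw [mem_HilbertSchmidt_iff (onb H), ← tsum_enorm_sq_adjoint (onb H) (onb H),
    ← mem_HilbertSchmidt_iff (onb H)]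
  exact hA

theorem tsum_enorm_comp_le {ι : Type*} (v : ι → H) (A B : H →L[ℂ] H) :
    ∑' i, ‖(A ∘L B) (v i)‖ₑ ^ 2 ≤ ‖A‖ₑ ^ 2 * ∑' i, ‖B (v i)‖ₑ ^ 2 := by
  rw [← ENNReal.tsum_mul_left]
  refine ENNReal.tsum_le_tsum fun i => ?_
  rw [← mul_pow]
  exact pow_le_pow_left₀ (by positivity) (A.le_opENorm _) 2

theorem comp_mem_HilbertSchmidt (A : H →L[ℂ] H) {B : H →L[ℂ] H} (hB : B ∈ HilbertSchmidt H) :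
    A ∘L B ∈ HilbertSchmidt H := by
  rw [mem_HilbertSchmidt_iff (onb H)] at hB ⊢
  exact ((tsum_enorm_comp_le _ A B).trans_lt
    (ENNReal.mul_lt_top (by simp) hB.lt_top)).ne

theorem comp_mem_HilbertSchmidt' {B : H →L[ℂ] H} (hB : B ∈ HilbertSchmidt H) (A : H →L[ℂ] H) :
    B ∘L A ∈ HilbertSchmidt H := by
  have := adjoint_mem_HilbertSchmidt (comp_mem_HilbertSchmidt A.adjoint
    (adjoint_mem_HilbertSchmidt hB))
  rwa [ContinuousLinearMap.adjoint_comp, ContinuousLinearMap.adjoint_adjoint,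
    ContinuousLinearMap.adjoint_adjoint] at this

/-- The rank one operator `|x)(y|` as a Hilbert--Schmidt operator. -/
def hsRankOne (x y : H) : HilbertSchmidt H :=
  ⟨InnerProductSpace.rankOne ℂ x y, rankOne_mem_HilbertSchmidt x y⟩

theorem hsRankOne_apply (x y z : H) : (hsRankOne x y).1 z = inner ℂ y z • x := rfl

theorem adjoint_hsRankOne (x y : H) : (hsRankOne x y).1.adjoint = (hsRankOne y x).1 := by
  refine ContinuousLinearMap.ext fun z => ext_inner_left ℂ fun w => ?_
  rw [ContinuousLinearMap.adjoint_inner_right, hsRankOne_apply, hsRankOne_apply, inner_smul_left,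
    inner_smul_right, inner_conj_symm, mul_comm]

theorem comp_hsRankOne (A : H →L[ℂ] H) (x y : H) : A ∘L (hsRankOne x y).1 = (hsRankOne (A x) y).1 := by
  ext z
  simp [hsRankOne_apply]

theorem hsRankOne_comp_adjoint (A : H →L[ℂ] H) (x y : H) :
    (hsRankOne x y).1 ∘L A.adjoint = (hsRankOne x (A y)).1 := by
  ext z
  simp [hsRankOne_apply, ContinuousLinearMap.adjoint_inner_right]

/-- `W` is a unitary identification of `B²(H)` with `K`. -/
def IsHSUnitary {K : Type*} [NormedAddCommGroup K] [InnerProductSpace ℂ K]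
    (W : HilbertSchmidt H ≃ₗ[ℂ] K) : Prop :=
  ∀ A B : HilbertSchmidt H, inner ℂ (W A) (W B) = opTrace (A.1.adjoint ∘L B.1)

theorem opTrace_adjoint_comp (A B : H →L[ℂ] H) :
    opTrace (A.adjoint ∘L B) = ∑' i, inner ℂ (A (onb H i)) (B (onb H i)) := by
  refine tsum_congr fun i => ?_
  rw [ContinuousLinearMap.comp_apply, ContinuousLinearMap.adjoint_inner_right]

variable (H) in
/-- Hilbert--Schmidt operators are the square summable families `(A eᵢ)ᵢ`. -/
def hsToLp : HilbertSchmidt H ≃ₗ[ℂ] lp (fun _ : onbSet H => H) 2 :=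
  LinearEquiv.ofBijective
    { toFun := fun A => ⟨fun i => A.1 (onb H i), A.2⟩
      map_add' := fun _ _ => rfl
      map_smul' := fun _ _ => rfl } <| by
    constructor
    · intro A B h
      refine Subtype.ext (ContinuousLinearMap.ext_on
        (Submodule.dense_iff_topologicalClosure_eq_top.2 (onb H).dense_span) ?_)
      rintro _ ⟨i, rfl⟩
      exact congrArg (fun f : lp (fun _ : onbSet H => H) 2 => f i) h
    · intro f
      have h2 : ((2 : ENNReal).toReal).HolderConjugate ((2 : ENNReal).toReal) := by
        rw [ENNReal.toReal_ofNat]; exact Real.HolderConjugate.two_two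
      -- For surjectivity, the operator with prescribed columns fᵢ is x ↦ ∑ (eᵢ|x) fᵢ. The
      -- Cauchy–Schwarz inequality gives convergence and boundedness.
      have hle : ∀ x : H, (Summable fun i => ‖(onb H).repr x i‖ * ‖f i‖) ∧
          ∑' i, ‖(onb H).repr x i‖ * ‖f i‖ ≤ ‖(onb H).repr x‖ * ‖f‖ := fun x => by
        have h3 := Real.summable_and_inner_le_Lp_mul_Lq_tsum_of_nonneg h2
          (fun i => norm_nonneg ((onb H).repr x i)) (fun i => norm_nonneg (f i))
          (((onb H).repr x).2.summable (by norm_num)) (f.2.summable (by norm_num))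
        rwa [← lp.norm_eq_tsum_rpow (by norm_num), ← lp.norm_eq_tsum_rpow (by norm_num)] at h3
      have hsum : ∀ x : H, Summable fun i => (onb H).repr x i • f i := fun x =>
        Summable.of_norm (by simpa only [norm_smul] using (hle x).1)
      let F : H →ₗ[ℂ] H :=
        { toFun := fun x => ∑' i, (onb H).repr x i • f i
          map_add' := fun x y => by
            rw [← (hsum x).tsum_add (hsum y)]
            simp [add_smul]
          map_smul' := fun c x => by
            rw [RingHom.id_apply, ← (hsum x).tsum_const_smul]
            simp [mul_smul] }
      let A : H →L[ℂ] H := F.mkContinuous ‖f‖ fun x => by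
        refine (norm_tsum_le_tsum_norm (by simpa only [norm_smul] using (hle x).1)).trans ?_
        simp only [norm_smul]
        refine (hle x).2.trans_eq ?_
        rw [LinearIsometryEquiv.norm_map, mul_comm]
      have hA : ∀ i, A (onb H i) = f i := by
        intro i
        classical
        change ∑' j, (onb H).repr (onb H i) j • f j = f i
        rw [tsum_eq_single i]
        · simp [HilbertBasis.repr_self, lp.single_apply]
        · intro j hj
          simp [HilbertBasis.repr_self, lp.single_apply, hj]
      have hmem : A ∈ HilbertSchmidt H := by
        change Memℓp (fun i => A (onb H i)) 2
        simp only [hA]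
        exact f.2
      exact ⟨⟨A, hmem⟩, lp.ext (funext hA)⟩

theorem isHSUnitary_hsToLp : IsHSUnitary (hsToLp H) := fun A B => by
  rw [opTrace_adjoint_comp, lp.inner_eq_tsum]
  rfl

namespace IsHSUnitary

variable {K : Type*} [NormedAddCommGroup K] [InnerProductSpace ℂ K]
  {W : HilbertSchmidt H ≃ₗ[ℂ] K} (hW : IsHSUnitary W)
include hW

theorem inner_eq_tsum (A B : HilbertSchmidt H) :
    inner ℂ (W A) (W B) = ∑' i, inner ℂ (A.1 (onb H i)) (B.1 (onb H i)) := by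
  rw [hW, opTrace_adjoint_comp]

theorem enorm_sq {ι : Type*} (b : HilbertBasis ι ℂ H) (A : HilbertSchmidt H) :
    ‖W A‖ₑ ^ 2 = ∑' i, ‖A.1 (b i)‖ₑ ^ 2 := by
  rw [tsum_enorm_sq_eq b (onb H), tsum_enorm_sq_eq_ofReal (by simpa using A.2.summable (by norm_num)),
    ← ofReal_norm, ← ENNReal.ofReal_pow (norm_nonneg _)]
  congr 1
  have h1 := hW.inner_eq_tsum A A
  rw [inner_self_eq_norm_sq_to_K] at h1
  have h2 : (∑' i, inner ℂ (A.1 (onb H i)) (A.1 (onb H i)) : ℂ) =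
      ((∑' i, ‖A.1 (onb H i)‖ ^ 2 : ℝ) : ℂ) := by
    rw [Complex.ofReal_tsum]
    refine tsum_congr fun i => ?_
    rw [inner_self_eq_norm_sq_to_K]
    norm_cast
  apply Complex.ofReal_injective
  rw [← h2, ← h1]
  simp

/-- Rank one operators read off matrix elements, so identities between vectors of K can be tested on
product vectors. -/
theorem inner_hsRankOne_left (x y : H) (A : HilbertSchmidt H) :
    inner ℂ (W (hsRankOne x y)) (W A) = inner ℂ x (A.1 y) := by
  rw [hW.inner_eq_tsum, ← ContinuousLinearMap.adjoint_inner_left, ← (onb H).tsum_inner_mul_inner]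
  refine tsum_congr fun i => ?_
  rw [hsRankOne_apply, inner_smul_left, inner_conj_symm, ContinuousLinearMap.adjoint_inner_left,
    mul_comm]

theorem inner_hsRankOne_right (x y : H) (A : HilbertSchmidt H) :
    inner ℂ (W A) (W (hsRankOne x y)) = inner ℂ (A.1 y) x := by
  rw [← inner_conj_symm, hW.inner_hsRankOne_left, inner_conj_symm]

theorem norm_hsRankOne (x y : H) : ‖W (hsRankOne x y)‖ = ‖x‖ * ‖y‖ := by
  have h1 : (‖W (hsRankOne x y)‖ : ℂ) ^ 2 = (‖x‖ * ‖y‖ : ℂ) ^ 2 := by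
    have := hW.inner_hsRankOne_left x y (hsRankOne x y)
    rw [inner_self_eq_norm_sq_to_K, hsRankOne_apply, inner_smul_right,
      inner_self_eq_norm_sq_to_K, inner_self_eq_norm_sq_to_K] at this
    rw [mul_pow, mul_comm]
    exact this
  have h2 : ‖W (hsRankOne x y)‖ ^ 2 = (‖x‖ * ‖y‖) ^ 2 := by exact_mod_cast h1
  exact (pow_left_inj₀ (norm_nonneg _) (by positivity) two_ne_zero).1 h2

/-- Testing A against |Ay)(y| gives ‖Ay‖² ≤ ‖Ay‖ ‖y‖ ‖WA‖. -/
theorem opNorm_le (A : HilbertSchmidt H) : ‖A.1‖ ≤ ‖W A‖ := by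
  refine ContinuousLinearMap.opNorm_le_bound _ (norm_nonneg _) fun y => ?_
  by_cases h0 : A.1 y = 0
  · rw [h0, norm_zero]; positivity
  have h1 := norm_inner_le_norm (𝕜 := ℂ) (W (hsRankOne (A.1 y) y)) (W A)
  rw [hW.inner_hsRankOne_left, hW.norm_hsRankOne, inner_self_eq_norm_sq_to_K, norm_pow] at h1
  simp only [RCLike.norm_ofReal, abs_norm] at h1
  have h2 : 0 < ‖A.1 y‖ := norm_pos_iff.2 h0
  nlinarith

theorem norm_comp_le (A : H →L[ℂ] H) (B : HilbertSchmidt H) :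
    ‖W ⟨A ∘L B.1, comp_mem_HilbertSchmidt A B.2⟩‖ ≤ ‖A‖ * ‖W B‖ := by
  have h1 := tsum_enorm_comp_le (onb H) A B.1
  rw [← hW.enorm_sq (onb H) ⟨A ∘L B.1, comp_mem_HilbertSchmidt A B.2⟩, ← hW.enorm_sq,
    ← mul_pow, ← ofReal_norm, ← ofReal_norm, ← ofReal_norm, ← ENNReal.ofReal_mul (norm_nonneg _),
    ← ENNReal.ofReal_pow (norm_nonneg _), ← ENNReal.ofReal_pow (by positivity),
    ENNReal.ofReal_le_ofReal_iff (by positivity)] at h1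
  exact le_of_sq_le_sq h1 (by positivity)

/-- Rank one operators built from total sets are total. -/
theorem dense_span_hsRankOne [CompleteSpace K] {S : Set H}
    (hS : Dense (Submodule.span ℂ S : Set H)) :
    Dense (Submodule.span ℂ {Φ | ∃ x ∈ S, ∃ y ∈ S, Φ = W (hsRankOne x y)} : Set K) := by
  rw [Submodule.dense_iff_topologicalClosure_eq_top, Submodule.topologicalClosure_eq_top_iff,
    Submodule.eq_bot_iff]
  intro Φ hΦ
  obtain ⟨A, rfl⟩ := W.surjective Φ
  have h0 : ∀ x ∈ S, ∀ y ∈ S, inner ℂ x (A.1 y) = 0 := fun x hx y hy => by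
    rw [← hW.inner_hsRankOne_left]
    exact (Submodule.mem_orthogonal _ _).1 hΦ _ (Submodule.subset_span ⟨x, hx, y, hy, rfl⟩)
  have h1 : A.1 = 0 := by
    refine ContinuousLinearMap.ext_on hS fun y hy => ?_
    refine hS.eq_zero_of_inner_right ℂ fun x hx => ?_
    have : Submodule.span ℂ S ≤ (ℂ ∙ A.1 y)ᗮ := Submodule.span_le.2 fun x hx => by
      rw [SetLike.mem_coe, Submodule.mem_orthogonal_singleton_iff_inner_left]
      exact h0 x hx y hy
    exact Submodule.mem_orthogonal_singleton_iff_inner_left.1 (this hx)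
  rw [show A = 0 from Subtype.ext h1, map_zero]

/-- Left multiplication `B ↦ A B`. -/
def leftMul (A : H →L[ℂ] H) : K →L[ℂ] K :=
  LinearMap.mkContinuous
    { toFun := fun Φ => W ⟨A ∘L (W.symm Φ).1, comp_mem_HilbertSchmidt A (W.symm Φ).2⟩
      map_add' := fun Φ Ψ => by
        rw [← map_add]
        congr 1
        refine Subtype.ext (ContinuousLinearMap.ext fun x => ?_)
        simp
      map_smul' := fun c Φ => by
        rw [RingHom.id_apply, ← map_smul]
        congr 1
        refine Subtype.ext (ContinuousLinearMap.ext fun x => ?_)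
        simp } ‖A‖ fun Φ => by
    refine (hW.norm_comp_le A (W.symm Φ)).trans_eq ?_
    rw [W.apply_symm_apply]

theorem symm_leftMul (A : H →L[ℂ] H) (Φ : K) : (W.symm (hW.leftMul A Φ)).1 = A ∘L (W.symm Φ).1 :=
  congrArg Subtype.val (W.symm_apply_apply _)

theorem leftMul_hsRankOne (A : H →L[ℂ] H) (x y : H) :
    hW.leftMul A (W (hsRankOne x y)) = W (hsRankOne (A x) y) := by
  apply W.symm.injective
  refine Subtype.ext ?_
  rw [symm_leftMul, W.symm_apply_apply, W.symm_apply_apply, comp_hsRankOne]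

/-- The antilinear isometry `B ↦ B*`. -/
def conjMap : K →L⋆[ℂ] K :=
  LinearMap.mkContinuous
    { toFun := fun Φ => W ⟨(W.symm Φ).1.adjoint, adjoint_mem_HilbertSchmidt (W.symm Φ).2⟩
      map_add' := fun Φ Ψ => by
        rw [← map_add]
        congr 1
        refine Subtype.ext ?_
        simp
      map_smul' := fun c Φ => by
        rw [← map_smul]
        congr 1
        refine Subtype.ext ?_
        simp [map_smulₛₗ] } 1 fun Φ => by
    rw [one_mul]
    refine le_of_eq ?_
    have h1 := hW.enorm_sq (onb H)
      ⟨(W.symm Φ).1.adjoint, adjoint_mem_HilbertSchmidt (W.symm Φ).2⟩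
    rw [← tsum_enorm_sq_adjoint (onb H), ← hW.enorm_sq, W.apply_symm_apply, ← ofReal_norm,
      ← ofReal_norm, ← ENNReal.ofReal_pow (norm_nonneg _), ← ENNReal.ofReal_pow (norm_nonneg _),
      ENNReal.ofReal_eq_ofReal_iff (by positivity) (by positivity)] at h1
    exact (pow_left_inj₀ (norm_nonneg _) (norm_nonneg _) two_ne_zero).1 h1

theorem symm_conjMap (Φ : K) : (W.symm (hW.conjMap Φ)).1 = (W.symm Φ).1.adjoint :=
  congrArg Subtype.val (W.symm_apply_apply _)

theorem conjMap_conjMap (Φ : K) : hW.conjMap (hW.conjMap Φ) = Φ := by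
  apply W.symm.injective
  refine Subtype.ext ?_
  rw [symm_conjMap, symm_conjMap, ContinuousLinearMap.adjoint_adjoint]

theorem conjMap_hsRankOne (x y : H) :
    hW.conjMap (W (hsRankOne x y)) = W (hsRankOne y x) := by
  apply W.symm.injective
  refine Subtype.ext ?_
  rw [symm_conjMap, W.symm_apply_apply, W.symm_apply_apply, adjoint_hsRankOne]

theorem norm_conjMap (Φ : K) : ‖hW.conjMap Φ‖ = ‖Φ‖ := by
  have h : ∀ Φ, ‖hW.conjMap Φ‖ ≤ ‖Φ‖ := fun Φ => by
    refine (ContinuousLinearMap.le_of_opNorm_le _ (LinearMap.mkContinuous_norm_le _ zero_le_one _)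
      Φ).trans_eq (one_mul _)
  refine le_antisymm (h Φ) ?_
  conv_lhs => rw [← hW.conjMap_conjMap Φ]
  exact h _

/-- Polarization: the norm is preserved, while antilinearity replaces i by -i and so exchanges the
two imaginary terms. -/
theorem inner_conjMap (Φ Ψ : K) : inner ℂ (hW.conjMap Φ) (hW.conjMap Ψ) = conj (inner ℂ Φ Ψ) := by
  rw [inner_conj_symm, inner_eq_sum_norm_sq_div_four, inner_eq_sum_norm_sq_div_four (𝕜 := ℂ) Ψ Φ]
  have h1 : (RCLike.I : ℂ) • hW.conjMap Ψ = - hW.conjMap ((RCLike.I : ℂ) • Ψ) := by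
    rw [map_smulₛₗ]
    simp
  rw [h1, sub_neg_eq_add, ← sub_eq_add_neg, ← map_add, ← map_sub, ← map_add, ← map_sub]
  simp only [norm_conjMap]
  have h2 : ‖Φ - (RCLike.I : ℂ) • Ψ‖ = ‖Ψ + (RCLike.I : ℂ) • Φ‖ := by
    have : Φ - (RCLike.I : ℂ) • Ψ = (-RCLike.I : ℂ) • (Ψ + (RCLike.I : ℂ) • Φ) := by
      rw [smul_add, smul_smul]
      simp only [neg_smul, RCLike.I_to_complex, neg_mul, Complex.I_mul_I]
      simp; abel
    rw [this, norm_smul]; simp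
  have h3 : ‖Φ + (RCLike.I : ℂ) • Ψ‖ = ‖Ψ - (RCLike.I : ℂ) • Φ‖ := by
    have : Φ + (RCLike.I : ℂ) • Ψ = (RCLike.I : ℂ) • (Ψ - (RCLike.I : ℂ) • Φ) := by
      rw [smul_sub, smul_smul]
      simp only [RCLike.I_to_complex, Complex.I_mul_I]
      simp; abel
    rw [this, norm_smul]; simp
  rw [h2, h3, add_comm Φ Ψ, norm_sub_rev Φ Ψ]

/-- Right multiplication `B ↦ B A*`. -/
def rightMul (A : H →L[ℂ] H) : K →L[ℂ] K :=
  (hW.conjMap.comp (hW.leftMul A)).comp hW.conjMap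

theorem symm_rightMul (A : H →L[ℂ] H) (Φ : K) :
    (W.symm (hW.rightMul A Φ)).1 = (W.symm Φ).1 ∘L A.adjoint := by
  change (W.symm (hW.conjMap (hW.leftMul A (hW.conjMap Φ)))).1 = _
  rw [symm_conjMap, symm_leftMul, symm_conjMap, ContinuousLinearMap.adjoint_comp,
    ContinuousLinearMap.adjoint_adjoint]

theorem rightMul_hsRankOne (A : H →L[ℂ] H) (x y : H) :
    hW.rightMul A (W (hsRankOne x y)) = W (hsRankOne x (A y)) := by
  apply W.symm.injective
  refine Subtype.ext ?_
  rw [symm_rightMul, W.symm_apply_apply, W.symm_apply_apply, hsRankOne_comp_adjoint]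

theorem ext_symm {Φ Ψ : K} (h : (W.symm Φ).1 = (W.symm Ψ).1) : Φ = Ψ :=
  W.symm.injective (Subtype.ext h)

theorem inner_leftMul (A : H →L[ℂ] H) (Φ Ψ : K) :
    inner ℂ (hW.leftMul A Φ) Ψ = inner ℂ Φ (hW.leftMul A.adjoint Ψ) := by
  conv_lhs => rw [← W.apply_symm_apply Ψ, ← W.apply_symm_apply (hW.leftMul A Φ)]
  conv_rhs => rw [← W.apply_symm_apply Φ, ← W.apply_symm_apply (hW.leftMul A.adjoint Ψ)]
  rw [hW.inner_eq_tsum, hW.inner_eq_tsum]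
  refine tsum_congr fun i => ?_
  rw [symm_leftMul, symm_leftMul, ContinuousLinearMap.comp_apply, ContinuousLinearMap.comp_apply,
    ContinuousLinearMap.adjoint_inner_right]

/-- The left regular representation of `B(H)` on Hilbert--Schmidt operators. -/
def leftRep [CompleteSpace K] : (H →L[ℂ] H) →⋆ₐ[ℂ] (K →L[ℂ] K) where
  toFun := hW.leftMul
  map_one' := ContinuousLinearMap.ext fun Φ => hW.ext_symm (by rw [symm_leftMul]; rfl)
  map_mul' A B := ContinuousLinearMap.ext fun Φ => hW.ext_symm (by
    change _ = (W.symm (hW.leftMul A (hW.leftMul B Φ))).1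
    rw [symm_leftMul, symm_leftMul, symm_leftMul]; rfl)
  map_zero' := ContinuousLinearMap.ext fun Φ => hW.ext_symm (by
    rw [symm_leftMul, ContinuousLinearMap.zero_comp]; simp)
  map_add' A B := ContinuousLinearMap.ext fun Φ => hW.ext_symm (by
    change _ = (W.symm (hW.leftMul A Φ + hW.leftMul B Φ)).1
    rw [symm_leftMul, map_add, Submodule.coe_add, symm_leftMul, symm_leftMul,
      ContinuousLinearMap.add_comp])
  commutes' c := ContinuousLinearMap.ext fun Φ => hW.ext_symm (by
    change _ = (W.symm (c • Φ)).1
    rw [symm_leftMul, map_smul, Algebra.algebraMap_eq_smul_one]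
    ext x
    simp)
  map_star' A := by
    rw [ContinuousLinearMap.star_eq_adjoint, ContinuousLinearMap.star_eq_adjoint,
      ContinuousLinearMap.eq_adjoint_iff]
    intro Φ Ψ
    rw [hW.inner_leftMul, ContinuousLinearMap.adjoint_adjoint]

theorem leftRep_apply [CompleteSpace K] (A : H →L[ℂ] H) : hW.leftRep A = hW.leftMul A := rfl

end IsHSUnitary

end HilbertSchmidt

/-! ### The standard representation on Hilbert–Schmidt operators -/

section Standard

variable {H : Type*} [NormedAddCommGroup H] [InnerProductSpace ℂ H] [CompleteSpace H]

theorem ContinuousLinearMap.isPositive_of_inner_nonneg {A : H →L[ℂ] H}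
    (h : ∀ x, 0 ≤ inner ℂ x (A x)) : A.IsPositive := by
  rw [ContinuousLinearMap.isPositive_iff_complex]
  intro x
  have h1 := h x
  rw [← inner_conj_symm, Complex.le_def] at h1
  have h2 := h1.1
  have h3 := h1.2
  simp only [Complex.conj_re, Complex.conj_im, Complex.zero_re, Complex.zero_im] at h2 h3
  refine ⟨Complex.ext ?_ ?_, h2⟩
  · simp
  · simp only [RCLike.re_to_complex, Complex.ofReal_im]
    linarith

theorem ContinuousLinearMap.IsPositive.inner_right_nonneg {A : H →L[ℂ] H} (h : A.IsPositive)
    (x : H) : 0 ≤ inner ℂ x (A x) := h.inner_nonneg_right x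

theorem isPositive_hsRankOne (x : H) : (hsRankOne x x).1.IsPositive :=
  ContinuousLinearMap.isPositive_of_inner_nonneg fun y => by
    rw [hsRankOne_apply, inner_smul_right, ← inner_conj_symm x y, mul_comm, Complex.mul_conj]
    exact_mod_cast Complex.normSq_nonneg _

/-- `IsNormalFunctional` asks for sequences. Square summable families have countable support, so
they embed into ℕ with zero padding, which `F 0 0 = 0` makes harmless. -/
theorem exists_nat_reindex {ι : Type*} {H' : Type*} [NormedAddCommGroup H'] {f g : ι → H'}
    (hf : Summable fun p => ‖f p‖ ^ 2) (hg : Summable fun p => ‖g p‖ ^ 2) :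
    ∃ x y : ℕ → H', Summable (fun n => ‖x n‖ ^ 2) ∧ Summable (fun n => ‖y n‖ ^ 2) ∧
      ∀ F : H' → H' → ℂ, F 0 0 = 0 → ∑' p, F (f p) (g p) = ∑' n, F (x n) (y n) := by
  set S : Set ι := {p | f p ≠ 0 ∨ g p ≠ 0} with hS
  have hc : S.Countable := by
    refine (hf.countable_support.union hg.countable_support).mono ?_
    rintro p (hp | hp)
    · left; simpa using hp
    · right; simpa using hp
  have : Countable S := hc.to_subtype
  obtain ⟨e, he⟩ := exists_injective_nat S
  set x : ℕ → H' := Function.extend e (fun p => f p) 0 with hx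
  set y : ℕ → H' := Function.extend e (fun p => g p) 0 with hy
  have hx1 : ∀ p, x (e p) = f p := fun p => he.extend_apply _ _ p
  have hy1 : ∀ p, y (e p) = g p := fun p => he.extend_apply _ _ p
  have hx0 : ∀ n, n ∉ Set.range e → x n = 0 := fun n hn => Function.extend_apply' _ _ _ hn
  have hy0 : ∀ n, n ∉ Set.range e → y n = 0 := fun n hn => Function.extend_apply' _ _ _ hn
  refine ⟨x, y, ?_, ?_, fun F hF => ?_⟩
  · rw [← he.summable_iff (fun n hn => by rw [hx0 n hn]; simp)]
    refine (hf.subtype S).congr fun p => ?_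
    simp [hx1]
  · rw [← he.summable_iff (fun n hn => by rw [hy0 n hn]; simp)]
    refine (hg.subtype S).congr fun p => ?_
    simp [hy1]
  · rw [← he.tsum_eq (f := fun n => F (x n) (y n))]
    · simp only [hx1, hy1]
      symm
      refine Function.Injective.tsum_eq (f := fun p => F (f p) (g p)) Subtype.val_injective ?_
      intro p hp
      simp only [Subtype.range_coe_subtype, Set.mem_ofPred_eq]
      by_contra h
      simp only [S, Set.mem_ofPred_eq, not_or, not_not] at h
      rw [Function.mem_support, h.1, h.2] at hp
      exact hp hF
    · intro n hn
      by_contra h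
      rw [Function.mem_support, hx0 n h, hy0 n h] at hn
      exact hn hF

namespace IsHSUnitary

variable {K : Type*} [NormedAddCommGroup K] [InnerProductSpace ℂ K] [CompleteSpace K]
  {W : HilbertSchmidt H ≃ₗ[ℂ] K} (hW : IsHSUnitary W)
include hW

/-- For X = W⁻¹x and Y = W⁻¹y one has (x|π(A)y) = ∑ᵢ (Xeᵢ|A Yeᵢ). A sum of such terms over n is of
the same form, with index set ℕ times the basis. -/
theorem isNormalFunctional_leftRep {ψ : (K →L[ℂ] K) → ℂ} (hψ : IsNormalFunctional ψ) :
    IsNormalFunctional fun A => ψ (hW.leftRep A) := by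
  obtain ⟨x, y, hx, hy, hxy⟩ := hψ
  have key : ∀ x : ℕ → K, Summable (fun n => ‖x n‖ ^ 2) →
      Summable fun p : ℕ × onbSet H => ‖(W.symm (x p.1)).1 (onb H p.2)‖ ^ 2 := by
    intro x hx
    refine summable_sq_of_tsum_enorm_ne_top ?_
    rw [ENNReal.tsum_prod']
    simp_rw [← hW.enorm_sq (onb H), W.apply_symm_apply]
    rw [tsum_enorm_sq_eq_ofReal hx]
    exact ENNReal.ofReal_ne_top
  have hx' := key x hx
  have hy' := key y hy
  obtain ⟨x', y', hx1, hy1, h⟩ := exists_nat_reindex hx' hy'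
  refine ⟨x', y', hx1, hy1, fun A => ?_⟩
  refine (hxy (hW.leftRep A)).trans ?_
  rw [← h (fun a b => inner ℂ a (A b)) (by simp)]
  have hsum : Summable fun p : ℕ × onbSet H => inner ℂ ((W.symm (x p.1)).1 (onb H p.2))
      (A ((W.symm (y p.1)).1 (onb H p.2))) := by
    refine Summable.of_norm_bounded ((hx'.add hy').mul_left ‖A‖) fun p => ?_
    refine (norm_inner_le_norm _ _).trans ?_
    refine (mul_le_mul_of_nonneg_left (A.le_opNorm _) (norm_nonneg _)).trans ?_
    have := two_mul_le_add_sq ‖(W.symm (x p.1)).1 (onb H p.2)‖ ‖(W.symm (y p.1)).1 (onb H p.2)‖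
    have h0 := norm_nonneg A
    have h1 := mul_nonneg (norm_nonneg ((W.symm (x p.1)).1 (onb H p.2)))
      (norm_nonneg ((W.symm (y p.1)).1 (onb H p.2)))
    nlinarith
  rw [hsum.tsum_prod]
  refine tsum_congr fun n => ?_
  conv_lhs => rw [← W.apply_symm_apply (x n), ← W.apply_symm_apply (hW.leftRep A (y n))]
  rw [hW.inner_eq_tsum]
  refine tsum_congr fun i => ?_
  rw [leftRep_apply, symm_leftMul, ContinuousLinearMap.comp_apply]

open Filter in
-- Tr AB is the sum of all entries of the Hadamard product of the matrices of Aᵀ and B. That product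
-- is positive semidefinite by Schur's theorem, each matrix being the Gram matrix of the images of
-- the basis under a square root.
theorem inner_nonneg {A B : HilbertSchmidt H} (hA : A.1.IsPositive) (hB : B.1.IsPositive) :
    0 ≤ inner ℂ (W A) (W B) := by
  set e := onb H
  have hgram : ∀ C : H →L[ℂ] H, C.IsPositive →
      (Matrix.of fun i j => inner ℂ (e i) (C (e j))).PosSemidef := by
    intro C hC
    have hC0 : 0 ≤ C := (ContinuousLinearMap.nonneg_iff_isPositive C).2 hC
    have h1 : (Matrix.of fun i j => inner ℂ (e i) (C (e j))) =
        Matrix.gram ℂ fun i => CFC.sqrt C (e i) := by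
      ext i j
      have h2 : IsSelfAdjoint (CFC.sqrt C) := (CFC.sqrt_nonneg C).isSelfAdjoint
      rw [Matrix.of_apply, Matrix.gram_apply, ← ContinuousLinearMap.adjoint_inner_right,
        ← ContinuousLinearMap.star_eq_adjoint, h2.star_eq]
      conv_lhs => rw [← CFC.sqrt_mul_sqrt_self C hC0]
      rfl
    rw [h1]
    exact gram_posSemidef _
  have hM := (hgram A.1 hA).transpose.hadamard (hgram B.1 hB)
  have hsq : ∀ C : HilbertSchmidt H,
      Summable fun p : onbSet H × onbSet H => ‖inner ℂ (e p.2) (C.1 (e p.1))‖ ^ 2 := by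
    intro C
    refine summable_sq_of_tsum_enorm_ne_top (H₁ := ℂ) ?_
    rw [ENNReal.tsum_prod']
    simp_rw [e.tsum_enorm_inner_sq]
    exact (mem_HilbertSchmidt_iff e).1 C.2
  have hsum : Summable fun p : onbSet H × onbSet H =>
      inner ℂ (A.1 (e p.1)) (e p.2) * inner ℂ (e p.2) (B.1 (e p.1)) := by
    refine Summable.of_norm_bounded ((hsq A).add (hsq B)) fun p => ?_
    rw [norm_mul, norm_inner_symm]
    have := two_mul_le_add_sq ‖inner ℂ (e p.2) (A.1 (e p.1))‖ ‖inner ℂ (e p.2) (B.1 (e p.1))‖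
    have h1 := mul_nonneg (norm_nonneg (inner ℂ (e p.2) (A.1 (e p.1))))
      (norm_nonneg (inner ℂ (e p.2) (B.1 (e p.1))))
    linarith
  have htot : inner ℂ (W A) (W B) = ∑' p : onbSet H × onbSet H,
      inner ℂ (A.1 (e p.1)) (e p.2) * inner ℂ (e p.2) (B.1 (e p.1)) := by
    rw [hW.inner_eq_tsum, hsum.tsum_prod]
    exact tsum_congr fun i => (e.tsum_inner_mul_inner _ _).symm
  rw [htot]
  -- The double sum is exhausted along squares F × F, so that each partial sum is the quadratic form
  -- of the Hadamard product at the vector equal to 1 on F.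
  have hlim := hsum.hasSum.comp (tendsto_finsetProd_atTop.comp
    (tendsto_atTop_diagonal (α := Finset (onbSet H))))
  refine ge_of_tendsto' hlim fun F => ?_
  have h1 := hM.2 (Finsupp.indicator F fun _ _ => (1 : ℂ))
  have hs : ∀ g : onbSet H → ℂ → ℂ, (∀ i, g i 0 = 0) →
      (Finsupp.indicator F fun _ _ => (1 : ℂ)).sum g = ∑ i ∈ F, g i 1 := fun g hg => by
    rw [Finsupp.sum_of_support_subset _ (Finsupp.support_indicator_subset _ _) _ fun i _ => hg i]
    exact Finset.sum_congr rfl fun i hi => by rw [Finsupp.indicator_of_mem hi]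
  rw [hs _ (fun i => by simp [Finsupp.sum])] at h1
  refine h1.trans_eq ?_
  simp only [Function.comp_apply]
  rw [Finset.sum_product]
  refine Finset.sum_comm.trans ?_ |>.symm
  refine Finset.sum_congr rfl fun j _ => ?_
  rw [hs _ (fun i => by simp)]
  refine Finset.sum_congr rfl fun i _ => ?_
  have h2 : inner ℂ (A.1 (e i)) (e j) = inner ℂ (e i) (A.1 (e j)) := hA.1 _ _
  rw [h2]
  simp

variable (W) in
omit hW in
/-- The cone of positive Hilbert--Schmidt operators. -/
def cone : Set K := W '' {A | A.1.IsPositive}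

/-- A vector dual to the cone is tested against |x)(x|, which returns its expectation at x. -/
theorem isSelfDualCone_cone : IsSelfDualCone (cone W) := by
  refine Set.Subset.antisymm ?_ ?_
  · rintro _ ⟨A, hA, rfl⟩ _ ⟨B, hB, rfl⟩
    exact hW.inner_nonneg hA hB
  · intro Φ hΦ
    refine ⟨W.symm Φ, ContinuousLinearMap.isPositive_of_inner_nonneg fun x => ?_,
      W.apply_symm_apply Φ⟩
    have h1 := hΦ _ ⟨hsRankOne x x, isPositive_hsRankOne x, rfl⟩
    rw [← W.apply_symm_apply Φ, hW.inner_hsRankOne_right] at h1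
    have h2 := star_nonneg_iff.2 h1
    rwa [RCLike.star_def, inner_conj_symm] at h2

/-- Fix a unit vector u. Since |x)(y| = |x)(u| · |u)(y|, such a T is determined by Q_y = T|u)(y|.
Indeed T|x)(y| = |x)(u|Q_y = |x)(Q_y*u|, so R y = Q_y*u. -/
theorem exists_eq_rightMul [Nontrivial H] {T : K →L[ℂ] K}
    (hT : ∀ A, hW.leftRep A * T = T * hW.leftRep A) : ∃ R, T = hW.rightMul R := by
  obtain ⟨u, hu⟩ := exists_norm_eq H zero_le_one
  have huu : inner ℂ u u = (1 : ℂ) := by rw [inner_self_eq_norm_sq_to_K, hu]; simp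
  let Q : H → HilbertSchmidt H := fun y => W.symm (T (W (hsRankOne u y)))
  have hQ : ∀ y, W (Q y) = T (W (hsRankOne u y)) := fun y => W.apply_symm_apply _
  have hadd : ∀ y y', hsRankOne u (y + y') = hsRankOne u y + hsRankOne u y' := fun y y' =>
    Subtype.ext (map_add _ _ _)
  have hsmul : ∀ (c : ℂ) y, hsRankOne u (c • y) = conj c • hsRankOne u y := fun c y =>
    Subtype.ext (by simp [hsRankOne])
  let R : H →L[ℂ] H := LinearMap.mkContinuous
    { toFun := fun y => (Q y).1.adjoint u
      map_add' := fun y y' => by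
        simp only [Q]
        rw [hadd]
        simp
      map_smul' := fun c y => by
        simp only [Q]
        rw [hsmul]
        simp [map_smulₛₗ] } ‖T‖ fun y => by
    refine ((Q y).1.adjoint.le_opNorm u).trans ?_
    rw [hu, mul_one, LinearIsometryEquiv.norm_map]
    refine (hW.opNorm_le _).trans ?_
    rw [hQ]
    refine (T.le_opNorm _).trans_eq ?_
    rw [hW.norm_hsRankOne, hu, one_mul]
  refine ⟨R, ContinuousLinearMap.ext_on (hW.dense_span_hsRankOne (S := Set.univ) (by simp)) ?_⟩
  rintro _ ⟨x, -, y, -, rfl⟩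
  rw [rightMul_hsRankOne]
  have h1 : W (hsRankOne x y) = hW.leftRep (hsRankOne x u).1 (W (hsRankOne u y)) := by
    rw [leftRep_apply, leftMul_hsRankOne, hsRankOne_apply, huu, one_smul]
  have h2 := congrArg (fun S : K →L[ℂ] K => S (W (hsRankOne u y))) (hT (hsRankOne x u).1)
  rw [h1]
  refine h2.symm.trans (hW.ext_symm ?_)
  change (W.symm (hW.leftMul _ (T (W (hsRankOne u y))))).1 = _
  rw [symm_leftMul, W.symm_apply_apply]
  ext z
  change (hsRankOne x u).1 ((Q y).1 z) = (hsRankOne x ((Q y).1.adjoint u)).1 z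
  rw [hsRankOne_apply, hsRankOne_apply, ContinuousLinearMap.adjoint_inner_left]

omit [CompleteSpace K] hW in
omit W in
-- Commuting with |x)(u| and evaluating at the unit vector u gives Ax = (u|Au)x.
theorem exists_eq_smul_of_mem_center [Nontrivial H] {A : H →L[ℂ] H}
    (hA : A ∈ Set.center (H →L[ℂ] H)) : ∃ c : ℂ, A = c • 1 := by
  obtain ⟨u, hu⟩ := exists_norm_eq H zero_le_one
  have huu : inner ℂ u u = (1 : ℂ) := by rw [inner_self_eq_norm_sq_to_K, hu]; simp
  refine ⟨inner ℂ u (A u), ContinuousLinearMap.ext fun x => ?_⟩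
  have h1 : A * (hsRankOne x u).1 = (hsRankOne x u).1 * A := hA.comm _
  have h2 := congrArg (fun S : H →L[ℂ] H => S u) h1
  change A ((hsRankOne x u).1 u) = (hsRankOne x u).1 (A u) at h2
  rw [hsRankOne_apply, hsRankOne_apply, huu, one_smul] at h2
  exact h2

theorem isStandardRep [Nontrivial H] : IsStandardRep hW.leftRep hW.conjMap (cone W) where
  injective A B h := by
    ext x
    by_cases hx : x = 0
    · simp [hx]
    have h1 := congrArg (fun S : K →L[ℂ] K => S (W (hsRankOne x x))) h
    simp only [leftRep_apply, leftMul_hsRankOne] at h1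
    have h2 := congrArg (fun S : HilbertSchmidt H => S.1 x) (W.injective h1)
    simp only [hsRankOne_apply] at h2
    exact smul_right_injective H (inner_self_ne_zero (𝕜 := ℂ).2 hx) h2
  normal ψ hψ := hW.isNormalFunctional_leftRep hψ
  involution := hW.conjMap_conjMap
  antiunitary := hW.inner_conjMap
  selfDual := hW.isSelfDualCone_cone
  commutant := by
    refine Set.Subset.antisymm ?_ ?_
    · rintro _ ⟨A, rfl⟩ _ ⟨B, rfl⟩
      refine ContinuousLinearMap.ext fun Φ => hW.ext_symm ?_
      change (W.symm (hW.leftMul B (hW.rightMul A Φ))).1 =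
        (W.symm (hW.rightMul A (hW.leftMul B Φ))).1
      rw [symm_leftMul, symm_rightMul, symm_rightMul, symm_leftMul]
      rfl
    · intro T hT
      obtain ⟨R, rfl⟩ := hW.exists_eq_rightMul fun A => hT _ ⟨A, rfl⟩
      exact ⟨R, rfl⟩
  center A hA := by
    obtain ⟨c, rfl⟩ := exists_eq_smul_of_mem_center hA
    rw [← ContinuousLinearMap.star_eq_adjoint, ← map_star]
    refine ContinuousLinearMap.ext fun Φ => hW.ext_symm ?_
    change (W.symm (hW.rightMul _ Φ)).1 = (W.symm (hW.leftMul _ Φ)).1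
    rw [symm_rightMul, symm_leftMul, ← ContinuousLinearMap.star_eq_adjoint]
    ext x
    simp
  fixed := by
    rintro _ ⟨A, hA, rfl⟩
    refine hW.ext_symm ?_
    rw [symm_conjMap, W.symm_apply_apply]
    exact hA.isSelfAdjoint.adjoint_eq
  preserves := by
    rintro A _ ⟨B, hB, rfl⟩
    -- On operators this is B ↦ A(AB)* = ABA*, for B positive.
    refine ⟨W.symm (hW.leftMul A (hW.conjMap (hW.leftMul A (W B)))), ?_, W.apply_symm_apply _⟩
    rw [Set.mem_ofPred_eq, symm_leftMul, symm_conjMap, symm_leftMul, W.symm_apply_apply,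
      ContinuousLinearMap.adjoint_comp, hB.isSelfAdjoint.adjoint_eq]
    exact hB.conj_adjoint A

/-- A unitary of the commutant preserving the cone is trivial. -/
theorem eq_one_of_commute [Nontrivial H] {T : K →L[ℂ] K}
    (hT : ∀ A, hW.leftRep A * T = T * hW.leftRep A) (hnorm : ∀ Φ, ‖T Φ‖ = ‖Φ‖)
    (hcone : ∀ Φ ∈ cone W, T Φ ∈ cone W) : T = 1 := by
  obtain ⟨R, rfl⟩ := hW.exists_eq_rightMul hT
  -- The image |x)(Rx| of |x)(x| has to be positive and of the same norm. Self-adjointness makes Rx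
  -- proportional to x, positivity makes the factor nonnegative, and the norm makes it 1.
  have hR : ∀ x, R x = x := by
    intro x
    by_cases hx : x = 0
    · simp [hx]
    have hxn : 0 < ‖x‖ := norm_pos_iff.2 hx
    have h1 : ‖R x‖ = ‖x‖ := by
      have := hnorm (W (hsRankOne x x))
      rw [rightMul_hsRankOne, hW.norm_hsRankOne, hW.norm_hsRankOne] at this
      exact mul_left_cancel₀ hxn.ne' this
    obtain ⟨B, hB, hBx⟩ := hcone _ ⟨hsRankOne x x, isPositive_hsRankOne x, rfl⟩
    rw [rightMul_hsRankOne] at hBx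
    have hBx' : B = hsRankOne x (R x) := W.injective hBx
    subst hBx'
    have h2 : (hsRankOne (R x) x).1 = (hsRankOne x (R x)).1 := by
      rw [← adjoint_hsRankOne]
      exact hB.isSelfAdjoint.adjoint_eq
    have h3 := congrArg (fun S : H →L[ℂ] H => S x) h2
    simp only [hsRankOne_apply] at h3
    have h4 := hB.inner_right_nonneg x
    rw [hsRankOne_apply, inner_smul_right] at h4
    have hxx : (inner ℂ x x : ℂ) = ((‖x‖ ^ 2 : ℝ) : ℂ) := by
      rw [inner_self_eq_norm_sq_to_K]; norm_cast
    rw [hxx] at h3 h4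
    have h5 : 0 ≤ (inner ℂ (R x) x : ℂ) := by
      have : (inner ℂ (R x) x : ℂ) = (inner ℂ (R x) x * ((‖x‖ ^ 2 : ℝ) : ℂ)) *
          (((‖x‖ ^ 2)⁻¹ : ℝ) : ℂ) := by
        rw [mul_assoc, ← Complex.ofReal_mul, mul_inv_cancel₀ (by positivity)]; simp
      rw [this]
      exact mul_nonneg h4 (by rw [Complex.zero_le_real]; positivity)
    obtain ⟨r, hr, hr'⟩ : ∃ r : ℝ, 0 ≤ r ∧ (inner ℂ (R x) x : ℂ) = r := by
      refine ⟨(inner ℂ (R x) x : ℂ).re, (Complex.le_def.1 h5).1, Complex.ext rfl ?_⟩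
      simpa using (Complex.le_def.1 h5).2.symm
    rw [hr'] at h3
    have h6 := congrArg norm h3
    rw [norm_smul, norm_smul, h1, Complex.norm_real, Complex.norm_real, Real.norm_of_nonneg hr,
      Real.norm_of_nonneg (by positivity)] at h6
    have h7 : r = ‖x‖ ^ 2 := (mul_right_cancel₀ hxn.ne' h6).symm
    rw [h7] at h3
    exact smul_right_injective H (by
      rw [Complex.ofReal_ne_zero]; positivity) h3
  refine ContinuousLinearMap.ext fun Φ => hW.ext_symm ?_
  have : R = 1 := ContinuousLinearMap.ext hR
  rw [symm_rightMul, this, ← ContinuousLinearMap.star_eq_adjoint, star_one]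
  rfl

/-- A state has at most one representative in the cone. -/
theorem representsState_unique {ω : (H →L[ℂ] H) → ℂ} {Ω Ω' : K}
    (h : RepresentsState hW.leftRep (cone W) ω Ω)
    (h' : RepresentsState hW.leftRep (cone W) ω Ω') : Ω = Ω' := by
  obtain ⟨⟨B, hB, rfl⟩, -, h1⟩ := h
  obtain ⟨⟨B', hB', rfl⟩, -, h1'⟩ := h'
  -- The state evaluated on |x)(y| returns the matrix elements of B², so the state determines B² and
  -- hence its positive root B.
  have key : ∀ B : HilbertSchmidt H, B.1.IsPositive → ∀ x y,
      inner ℂ (W B) (hW.leftRep (hsRankOne x y).1 (W B)) = inner ℂ (B.1 (B.1 y)) x := by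
    intro B hB x y
    have : hW.leftRep (hsRankOne x y).1 (W B) = W (hsRankOne x (B.1 y)) := by
      refine hW.ext_symm ?_
      rw [leftRep_apply, symm_leftMul, W.symm_apply_apply, W.symm_apply_apply,
        ← hsRankOne_comp_adjoint, hB.isSelfAdjoint.adjoint_eq]
    rw [this, hW.inner_hsRankOne_right]
  have hsq : B.1 * B.1 = B'.1 * B'.1 := by
    refine ContinuousLinearMap.ext fun y => ext_inner_right ℂ fun x => ?_
    change inner ℂ (B.1 (B.1 y)) x = inner ℂ (B'.1 (B'.1 y)) x
    rw [← key B hB, ← key B' hB', ← h1, ← h1']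
  have h2 := CFC.sqrt_unique hsq ((ContinuousLinearMap.nonneg_iff_isPositive _).2 hB)
  have h3 := CFC.sqrt_unique (rfl : B'.1 * B'.1 = _)
    ((ContinuousLinearMap.nonneg_iff_isPositive _).2 hB')
  rw [Subtype.ext (h2.symm.trans h3)]

/-- The vector of a normalized positive Hilbert--Schmidt operator `G` represents the state with
density matrix `G²`. -/
theorem inner_leftRep_eq_opTrace (G : HilbertSchmidt H) (hG : G.1.IsPositive) (A : H →L[ℂ] H) :
    inner ℂ (W G) (hW.leftRep A (W G)) = opTrace ((G.1 * G.1) * A) := by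
  -- Since G is fixed by J, antiunitarity turns left multiplication by A into right multiplication.
  -- This replaces an appeal to cyclicity of the trace.
  have h1 : inner ℂ (W G) (hW.leftRep A (W G)) =
      inner ℂ (W G) (W ⟨G.1 ∘L A, comp_mem_HilbertSchmidt' G.2 A⟩) := by
    have h2 : hW.conjMap (W G) = W G := by
      refine hW.ext_symm ?_
      rw [symm_conjMap, W.symm_apply_apply, hG.isSelfAdjoint.adjoint_eq]
    have h3 : hW.conjMap (hW.leftMul A.adjoint (W G)) =
        W ⟨G.1 ∘L A, comp_mem_HilbertSchmidt' G.2 _⟩ := by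
      refine hW.ext_symm ?_
      rw [symm_conjMap, symm_leftMul, W.symm_apply_apply, W.symm_apply_apply,
        ContinuousLinearMap.adjoint_comp, hG.isSelfAdjoint.adjoint_eq,
        ContinuousLinearMap.adjoint_adjoint]
    rw [leftRep_apply, ← ContinuousLinearMap.adjoint_adjoint A, ← hW.inner_leftMul,
      ContinuousLinearMap.adjoint_adjoint, ← inner_conj_symm, ← hW.inner_conjMap, h2, h3]
  rw [h1, hW]
  congr 1
  rw [hG.isSelfAdjoint.adjoint_eq]
  rfl

end IsHSUnitary

end Standard

/-! ### Product vectors -/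

namespace Statistics

variable (s : Statistics) {n : ℕ}

theorem char_mul (σ τ : Equiv.Perm (Fin n)) : s.char (σ * τ) = s.char σ * s.char τ := by
  cases s <;> simp [char]

theorem char_one : s.char (1 : Equiv.Perm (Fin n)) = 1 := by
  cases s <;> simp [char]

theorem char_mul_self (σ : Equiv.Perm (Fin n)) : s.char σ * s.char σ = 1 := by
  cases s
  · simp [char]
  · rcases Int.units_eq_one_or (Equiv.Perm.sign σ) with h | h <;> simp [char, h]

theorem conj_char (σ : Equiv.Perm (Fin n)) : conj (s.char σ) = s.char σ := by
  cases s <;> simp [char]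

theorem char_inv (σ : Equiv.Perm (Fin n)) : s.char σ⁻¹ = s.char σ := by
  cases s <;> simp [char]

theorem char_ne_zero (σ : Equiv.Perm (Fin n)) : s.char σ ≠ 0 :=
  left_ne_zero_of_mul_eq_one (s.char_mul_self σ)

end Statistics

section Products

variable {Z : Type*} [NormedAddCommGroup Z] [InnerProductSpace ℂ Z]

theorem tensorKernel_ofFn {n : ℕ} (z w : Fin n → Z) :
    tensorKernel (List.ofFn z) (List.ofFn w) = ∏ i, inner ℂ (z i) (w i) := by
  induction n with
  | zero => simp [tensorKernel]
  | succ n ih => simp [List.ofFn_succ, tensorKernel, ih, Fin.prod_univ_succ]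

theorem tensorKernel_eq_zero {l m : List Z} (h : l.length ≠ m.length) : tensorKernel l m = 0 := by
  induction l generalizing m with
  | nil => cases m <;> simp_all [tensorKernel]
  | cons z l ih => cases m with
    | nil => simp [tensorKernel]
    | cons w m => simp [tensorKernel, ih (m := m) (by simpa using h)]

theorem symTens_comp_perm (s : Statistics) {n : ℕ} (z : Fin n → Z) (τ : Equiv.Perm (Fin n)) :
    symTens s (z ∘ τ) = s.char τ • symTens s z := by
  unfold symTens
  rw [smul_comm, Finset.smul_sum (r := s.char τ)]
  congr 1
  refine Fintype.sum_equiv (Equiv.mulLeft τ) _ _ fun σ => ?_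
  rw [smul_smul, Equiv.coe_mulLeft, s.char_mul, ← mul_assoc, s.char_mul_self, one_mul]
  rfl

theorem inner_tens_symTens (s : Statistics) {n : ℕ} (z w : Fin n → Z) :
    inner ℂ (tens (List.ofFn z)) (symTens s w) =
      (n.factorial : ℂ)⁻¹ * ∑ σ : Equiv.Perm (Fin n), s.char σ * ∏ i, inner ℂ (z i) (w (σ i)) := by
  rw [symTens, inner_smul_right, inner_sum]
  simp only [inner_smul_right, inner_tens, tensorKernel_ofFn, Function.comp_apply]

theorem inner_tens_symTens_of_ne (s : Statistics) {n : ℕ} {l : List Z} (w : Fin n → Z)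
    (h : l.length ≠ n) : inner ℂ (tens l) (symTens s w) = 0 := by
  rw [symTens, inner_smul_right, inner_sum, Finset.sum_eq_zero, mul_zero]
  intro σ _
  rw [inner_smul_right, inner_tens, tensorKernel_eq_zero (by simpa using h), mul_zero]

theorem inner_tens_comp_perm_symTens (s : Statistics) {n : ℕ} (z w : Fin n → Z)
    (τ : Equiv.Perm (Fin n)) : inner ℂ (tens (List.ofFn (z ∘ τ))) (symTens s w) =
      s.char τ * inner ℂ (tens (List.ofFn z)) (symTens s w) := by
  rw [inner_tens_symTens, inner_tens_symTens, mul_left_comm]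
  congr 1
  rw [Finset.mul_sum]
  refine Fintype.sum_equiv (Equiv.mulRight τ⁻¹) _ _ fun σ => ?_
  have h : ∏ i, inner ℂ ((z ∘ τ) i) (w (σ i)) = ∏ i, inner ℂ (z i) (w ((σ * τ⁻¹) i)) :=
    Fintype.prod_equiv τ _ _ fun i => by simp
  rw [Equiv.coe_mulRight, s.char_mul, s.char_inv, h]
  linear_combination (- s.char σ * ∏ i, inner ℂ (z i) (w ((σ * τ⁻¹) i))) * s.char_mul_self τ

/-- The symmetrizer is a self-adjoint idempotent: averaging on one side of the inner product is
enough. -/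
theorem inner_symTens_eq (s : Statistics) {n m : ℕ} (z : Fin n → Z) (w : Fin m → Z) :
    inner ℂ (symTens s z) (symTens s w) = inner ℂ (tens (List.ofFn z)) (symTens s w) := by
  by_cases h : n = m
  · subst h
    conv_lhs => rw [symTens]
    rw [inner_smul_left, sum_inner]
    simp only [inner_smul_left, inner_tens_comp_perm_symTens, s.conj_char, ← mul_assoc,
      s.char_mul_self, one_mul]
    rw [Finset.sum_const, Finset.card_univ, Fintype.card_perm, Fintype.card_fin, nsmul_eq_mul,
      ← mul_assoc]
    simp [Nat.factorial_ne_zero]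
  · conv_lhs => rw [symTens]
    rw [inner_tens_symTens_of_ne s w (by simpa using h), inner_smul_left, sum_inner,
      Finset.sum_eq_zero, mul_zero]
    intro σ _
    rw [inner_smul_left, inner_tens_symTens_of_ne s w (by simpa using h), mul_zero]

theorem inner_symVec (s : Statistics) {n : ℕ} (z w : Fin n → Z) :
    inner ℂ (symVec s z) (symVec s w) =
      (n.factorial : ℂ)⁻¹ * ∑ σ : Equiv.Perm (Fin n), s.char σ * ∏ i, inner ℂ (z i) (w (σ i)) :=
  (inner_symTens_eq s z w).trans (inner_tens_symTens s z w)

theorem inner_symVec_of_ne (s : Statistics) {n m : ℕ} (z : Fin n → Z) (w : Fin m → Z)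
    (h : n ≠ m) : inner ℂ (symVec s z) (symVec s w) = 0 :=
  (inner_symTens_eq s z w).trans (inner_tens_symTens_of_ne s w (by simpa using h))

theorem symVec_comp_perm (s : Statistics) {n : ℕ} (z : Fin n → Z) (τ : Equiv.Perm (Fin n)) :
    symVec s (z ∘ τ) = s.char τ • symVec s z :=
  Subtype.ext (symTens_comp_perm s z τ)

theorem FockSpace.ext_inner (s : Statistics) {x y : FockSpace Z s}
    (h : ∀ (n : ℕ) (w : Fin n → Z), inner ℂ (symVec s w) x = inner ℂ (symVec s w) y) : x = y := by
  rw [← sub_eq_zero]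
  refine (span_symVec_dense s).eq_zero_of_inner_right ℂ fun v hv => ?_
  have : Submodule.span ℂ {v : FockSpace Z s | ∃ (n : ℕ) (z : Fin n → Z), v = symVec s z} ≤
      (ℂ ∙ (x - y))ᗮ := by
    refine Submodule.span_le.2 ?_
    rintro _ ⟨n, w, rfl⟩
    rw [SetLike.mem_coe, Submodule.mem_orthogonal_singleton_iff_inner_left, inner_sub_right, h,
      sub_self]
  exact Submodule.mem_orthogonal_singleton_iff_inner_left.1 (this hv)

theorem FockSpace.clm_ext {s : Statistics} {σ : ℂ →+* ℂ} {K : Type*} [NormedAddCommGroup K]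
    [NormedSpace ℂ K] {S T : FockSpace Z s →SL[σ] K}
    (h : ∀ (n : ℕ) (w : Fin n → Z), S (symVec s w) = T (symVec s w)) : S = T := by
  refine ContinuousLinearMap.ext_on (span_symVec_dense s) ?_
  rintro _ ⟨n, w, rfl⟩
  exact h n w

variable (Z) in
/-- The (anti)symmetrizer `Θ`, as the orthogonal projection of the full Fock space. -/
def symmetrizer (s : Statistics) : FullFock Z →L[ℂ] FockSpace Z s :=
  (fockSubspace Z s).orthogonalProjectionOnto

theorem inner_symmetrizer (s : Statistics) (x : FockSpace Z s) (y : FullFock Z) :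
    inner ℂ x (symmetrizer Z s y) = inner ℂ (x : FullFock Z) y :=
  Submodule.inner_orthogonalProjectionOnto_eq_of_mem_left x y

theorem norm_symmetrizer_le (s : Statistics) (y : FullFock Z) : ‖symmetrizer Z s y‖ ≤ ‖y‖ :=
  Submodule.norm_orthogonalProjectionOnto_apply_le _ y

/-- Identifies the orthogonal projection with the explicit average over permutations; the bound on
`symVec` and the later product identities rely on this. -/
theorem symmetrizer_tens_ofFn (s : Statistics) {n : ℕ} (z : Fin n → Z) :
    symmetrizer Z s (tens (List.ofFn z)) = symVec s z := by
  refine FockSpace.ext_inner s fun m w => ?_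
  rw [inner_symmetrizer]
  change inner ℂ (symTens s w) (tens (List.ofFn z)) = inner ℂ (symTens s w) (symTens s z)
  rw [← inner_conj_symm, ← inner_symTens_eq, inner_conj_symm]

theorem norm_tens_ofFn {n : ℕ} (z : Fin n → Z) : ‖tens (List.ofFn z)‖ = ∏ i, ‖z i‖ := by
  have h1 : ((‖tens (List.ofFn z)‖ ^ 2 : ℝ) : ℂ) = (((∏ i, ‖z i‖) ^ 2 : ℝ) : ℂ) := by
    have h := inner_tens (List.ofFn z) (List.ofFn z)
    rw [inner_self_eq_norm_sq_to_K, tensorKernel_ofFn] at h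
    push_cast
    rw [← Finset.prod_pow]
    simp only [inner_self_eq_norm_sq_to_K] at h
    exact h
  exact (pow_left_inj₀ (norm_nonneg _) (by positivity) two_ne_zero).1 (by exact_mod_cast h1)

theorem norm_symVec_le (s : Statistics) {n : ℕ} (z : Fin n → Z) : ‖symVec s z‖ ≤ ∏ i, ‖z i‖ := by
  rw [← symmetrizer_tens_ofFn, ← norm_tens_ofFn]
  exact norm_symmetrizer_le s _

theorem FockSpace.inner_smul_right' {s : Statistics} (x y : FockSpace Z s) (c : ℂ) :
    inner ℂ x (c • y) = c * inner ℂ x y :=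
  inner_smul_right x y c

theorem FockSpace.inner_smul_left' {s : Statistics} (x y : FockSpace Z s) (c : ℂ) :
    inner ℂ (c • x) y = conj c * inner ℂ x y :=
  inner_smul_left x y c

theorem FockSpace.inner_self_eq' {s : Statistics} (x : FockSpace Z s) :
    inner ℂ x x = (‖x‖ : ℂ) ^ 2 :=
  inner_self_eq_norm_sq_to_K x

/-- Moving σ onto w exhibits each term as a multilinear functional of z. Multilinearity of `symVec`
is then inherited through inner products. -/
theorem inner_symVec_eq_compLinearMap (s : Statistics) {n : ℕ} (w z : Fin n → Z) :
    inner ℂ (symVec s w) (symVec s z) =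
      (n.factorial : ℂ)⁻¹ * ∑ σ : Equiv.Perm (Fin n), s.char σ *
        (MultilinearMap.mkPiAlgebra ℂ (Fin n) ℂ).compLinearMap
          (fun k => (innerₛₗ ℂ (w (σ.symm k)) : Z →ₗ[ℂ] ℂ)) z := by
  rw [inner_symVec]
  congr 1
  refine Finset.sum_congr rfl fun σ _ => ?_
  congr 1
  rw [MultilinearMap.compLinearMap_apply, MultilinearMap.mkPiAlgebra_apply]
  refine Fintype.prod_equiv σ _ _ fun i => ?_
  simp

theorem symVec_update_add (s : Statistics) {n : ℕ} (z : Fin n → Z)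
    (j : Fin n) (x y : Z) : symVec s (Function.update z j (x + y)) =
      symVec s (Function.update z j x) + symVec s (Function.update z j y) := by
  refine FockSpace.ext_inner s fun m w => ?_
  rw [inner_add_right]
  by_cases h : m = n
  · subst h
    simp only [inner_symVec_eq_compLinearMap, MultilinearMap.map_update_add, mul_add,
      Finset.sum_add_distrib]
  · rw [inner_symVec_of_ne s w _ h, inner_symVec_of_ne s w _ h, inner_symVec_of_ne s w _ h,
      add_zero]

theorem symVec_update_smul (s : Statistics) {n : ℕ} (z : Fin n → Z)
    (j : Fin n) (c : ℂ) (x : Z) : symVec s (Function.update z j (c • x)) =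
      c • symVec s (Function.update z j x) := by
  refine FockSpace.ext_inner s fun m w => ?_
  rw [FockSpace.inner_smul_right']
  by_cases h : m = n
  · subst h
    simp only [inner_symVec_eq_compLinearMap, MultilinearMap.map_update_smul, smul_eq_mul,
      Finset.mul_sum]
    exact Finset.sum_congr rfl fun σ _ => by ring
  · rw [inner_symVec_of_ne s w _ h, inner_symVec_of_ne s w _ h, mul_zero]

variable (Z) in
/-- `(z₁, …, zₙ) ↦ z₁ ⊗_{s/a} ⋯ ⊗_{s/a} zₙ` as a multilinear map. -/
def symVecMultilinear (s : Statistics) (n : ℕ) :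
    MultilinearMap ℂ (fun _ : Fin n => Z) (FockSpace Z s) where
  toFun := symVec s
  map_update_add' {inst} z j x y := by
    rw [Subsingleton.elim inst (instDecidableEqFin n)]
    exact symVec_update_add s z j x y
  map_update_smul' {inst} z j c x := by
    rw [Subsingleton.elim inst (instDecidableEqFin n)]
    exact symVec_update_smul s z j c x

variable (Z) in
/-- `(z₁, …, zₙ) ↦ z₁ ⊗_{s/a} ⋯ ⊗_{s/a} zₙ` as a continuous multilinear map. -/
def symVecMul (s : Statistics) (n : ℕ) :
    ContinuousMultilinearMap ℂ (fun _ : Fin n => Z) (FockSpace Z s) :=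
  (symVecMultilinear Z s n).mkContinuous 1 fun z => by
    rw [one_mul]
    exact norm_symVec_le s z

end Products

/-! ### Isometries determined by Gram matrices -/

section Extension

/-- A family of vectors with the same Gram matrix as a total family is its image under an
isometry. -/
theorem exists_isometry_of_inner_eq {E F ι : Type*} [NormedAddCommGroup E] [InnerProductSpace ℂ E]
    [NormedAddCommGroup F] [InnerProductSpace ℂ F] [CompleteSpace F] {σ : ℂ →+* ℂ}
    (hσ : ∀ z, σ (conj z) = conj (σ z)) (hσr : ∀ r : ℝ, σ r = r)
    {a : ι → E} (ha : Dense (Submodule.span ℂ (Set.range a) : Set E)) {b : ι → F}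
    (hab : ∀ i j, inner ℂ (b i) (b j) = σ (inner ℂ (a i) (a j))) :
    ∃ G : E →SL[σ] F, (∀ i, G (a i) = b i) ∧ ∀ x, ‖G x‖ = ‖x‖ := by
  -- Formal combinations map to both spaces with equal norms, so the map f factors through the dense
  -- range of e. Allowing σ to be the identity or conjugation treats linear and antilinear maps
  -- together.
  let e : (ι →₀ ℂ) →ₗ[ℂ] E := Finsupp.linearCombination ℂ a
  let f : (ι →₀ ℂ) →ₛₗ[σ] F :=
    { toFun := fun c => c.sum fun i x => σ x • b i
      map_add' := fun c d => Finsupp.sum_add_index' (by simp) (by simp [add_smul])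
      map_smul' := fun r c => by
        rw [Finsupp.sum_smul_index (by simp), Finsupp.smul_sum]
        simp [mul_smul] }
  have hef : ∀ c, ‖f c‖ = ‖e c‖ := by
    intro c
    have h1 : inner ℂ (f c) (f c) = σ (inner ℂ (e c) (e c)) := by
      change inner ℂ (c.sum fun i x => σ x • b i) (c.sum fun i x => σ x • b i) =
        σ (inner ℂ (c.sum fun i x => x • a i) (c.sum fun i x => x • a i))
      simp only [Finsupp.sum, sum_inner, inner_sum, inner_smul_left, inner_smul_right, map_sum,
        map_mul, hab, hσ]
    rw [inner_self_eq_norm_sq_to_K, inner_self_eq_norm_sq_to_K] at h1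
    have h2 : ((‖f c‖ ^ 2 : ℝ) : ℂ) = ((‖e c‖ ^ 2 : ℝ) : ℂ) := by
      rw [← hσr (‖e c‖ ^ 2)]
      push_cast
      exact h1
    exact (pow_left_inj₀ (norm_nonneg _) (norm_nonneg _) two_ne_zero).1 (by exact_mod_cast h2)
  have hd : DenseRange e := by
    have : (Submodule.span ℂ (Set.range a) : Set E) = Set.range e := by
      rw [← Finsupp.range_linearCombination]; rfl
    rw [DenseRange, ← this]
    exact ha
  have hG : ∀ c, f.extendOfNorm e (e c) = f c := fun c =>
    LinearMap.extendOfNorm_eq hd ⟨1, fun c => by rw [one_mul, hef]⟩ c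
  refine ⟨f.extendOfNorm e, fun i => ?_, fun x => ?_⟩
  · have := hG (Finsupp.single i 1)
    simpa [e, f] using this
  · refine hd.induction_on (p := fun x => ‖f.extendOfNorm e x‖ = ‖x‖) x
      (isClosed_eq (by fun_prop) (by fun_prop)) fun c => ?_
    rw [hG, hef]

end Extension

/-! ### Operators prescribed on product vectors -/

section OfProducts

variable {Z : Type*} [NormedAddCommGroup Z] [InnerProductSpace ℂ Z] {s : Statistics}

theorem ofProducts_eq {σ : ℂ →+* ℂ} {K : Type*} [NormedAddCommGroup K] [NormedSpace ℂ K]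
    {F : (n : ℕ) → (Fin n → Z) → K} {G : FockSpace Z s →SL[σ] K}
    (hG : ∀ (n : ℕ) (z : Fin n → Z), G (symVec s z) = F n z) : ofProducts s F = G := by
  have h : ∃ G : FockSpace Z s →SL[σ] K, ∀ (n : ℕ) (z : Fin n → Z), G (symVec s z) = F n z :=
    ⟨G, hG⟩
  rw [ofProducts, dif_pos h]
  exact FockSpace.clm_ext fun n w => by rw [h.choose_spec, hG]

theorem exists_isometry_of_products {σ : ℂ →+* ℂ} (hσ : ∀ z, σ (conj z) = conj (σ z))
    (hσr : ∀ r : ℝ, σ r = r) {K : Type*} [NormedAddCommGroup K] [InnerProductSpace ℂ K]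
    [CompleteSpace K] {F : (n : ℕ) → (Fin n → Z) → K}
    (h1 : ∀ n (z w : Fin n → Z), inner ℂ (F n z) (F n w) = σ (inner ℂ (symVec s z) (symVec s w)))
    (h2 : ∀ n m (z : Fin n → Z) (w : Fin m → Z), n ≠ m → inner ℂ (F n z) (F m w) = 0) :
    ∃ G : FockSpace Z s →SL[σ] K, (∀ (n : ℕ) (z : Fin n → Z), G (symVec s z) = F n z) ∧
      ∀ x, ‖G x‖ = ‖x‖ := by
  have hset : {v : FockSpace Z s | ∃ (n : ℕ) (z : Fin n → Z), v = symVec s z} =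
      Set.range fun p : Σ n : ℕ, Fin n → Z => symVec s p.2 := by
    ext v
    exact ⟨fun ⟨n, z, h⟩ => ⟨⟨n, z⟩, h.symm⟩, fun ⟨⟨n, z⟩, h⟩ => ⟨n, z, h.symm⟩⟩
  obtain ⟨G, hG, hn⟩ := exists_isometry_of_inner_eq (ι := Σ n : ℕ, Fin n → Z) hσ hσr
    (a := fun p => symVec s p.2) (b := fun p => F p.1 p.2) (hset ▸ span_symVec_dense (Z := Z) s)
    (by
      rintro ⟨n, z⟩ ⟨m, w⟩
      by_cases h : n = m
      · subst h
        exact h1 n z w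
      · rw [h2 n m z w h, inner_symVec_of_ne s z w h, map_zero])
  exact ⟨G, fun n z => hG ⟨n, z⟩, hn⟩

theorem exists_secondQuant {u : Z → Z} (hu : ∀ z w, inner ℂ (u z) (u w) = inner ℂ z w) :
    ∃ G : FockSpace Z s →L[ℂ] FockSpace Z s,
      (∀ (n : ℕ) (z : Fin n → Z), G (symVec s z) = symVec s (u ∘ z)) ∧ ∀ x, ‖G x‖ = ‖x‖ :=
  exists_isometry_of_products (σ := RingHom.id ℂ) (fun _ => rfl) (fun _ => rfl)
    (fun n z w => by rw [inner_symVec, inner_symVec]; simp [hu])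
    fun n m z w h => inner_symVec_of_ne s _ _ h

theorem exists_antiSecondQuant {u : Z → Z} (hu : ∀ z w, inner ℂ (u z) (u w) = inner ℂ w z) :
    ∃ G : FockSpace Z s →L⋆[ℂ] FockSpace Z s,
      (∀ (n : ℕ) (z : Fin n → Z), G (symVec s z) = symVec s (u ∘ z)) ∧ ∀ x, ‖G x‖ = ‖x‖ :=
  exists_isometry_of_products (fun _ => rfl) (fun r => Complex.conj_ofReal r)
    (fun n z w => by rw [inner_symVec, inner_symVec]; simp [hu, s.conj_char])
    fun n m z w h => inner_symVec_of_ne s _ _ h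

theorem antiSecondQuant_symVec {u : Z → Z} (hu : ∀ z w, inner ℂ (u z) (u w) = inner ℂ w z)
    {n : ℕ} (z : Fin n → Z) : antiSecondQuant s u (symVec s z) = symVec s (u ∘ z) := by
  obtain ⟨G, hG, -⟩ := exists_antiSecondQuant (s := s) hu
  rw [antiSecondQuant, ofProducts_eq hG, hG]

theorem lambdaOp_symVec {n : ℕ} (z : Fin n → Z) :
    lambdaOp Z s (symVec s z) = ((-1 : ℂ) ^ (n * (n - 1) / 2)) • symVec s z := by
  obtain ⟨G, hG, -⟩ := exists_isometry_of_products (s := s) (σ := RingHom.id ℂ)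
    (F := fun n (z : Fin n → Z) => ((-1 : ℂ) ^ (n * (n - 1) / 2)) • symVec s z)
    (fun _ => rfl) (fun _ => rfl)
    (fun n z w => by
      rw [FockSpace.inner_smul_left', FockSpace.inner_smul_right', ← mul_assoc, map_pow, map_neg, map_one, ← mul_pow]
      simp)
    (fun n m z w h => by rw [FockSpace.inner_smul_left', FockSpace.inner_smul_right',
      inner_symVec_of_ne s z w h]; simp)
  rw [lambdaOp, ofProducts_eq hG, hG]

end OfProducts

/-! ### Permutations and product vectors in orthogonal blocks -/

section Blocks

variable {Z : Type*} [NormedAddCommGroup Z] [InnerProductSpace ℂ Z]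

theorem inner_symVec_comp {Y : Type*} [NormedAddCommGroup Y] [InnerProductSpace ℂ Y]
    (s : Statistics) {p : Z → Y} {q : Y → Z} (h : ∀ a b, inner ℂ (p a) b = inner ℂ a (q b))
    {n m : ℕ} (z : Fin n → Z) (w : Fin m → Y) :
    inner ℂ (symVec s (p ∘ z)) (symVec s w) = inner ℂ (symVec s z) (symVec s (q ∘ w)) := by
  by_cases hnm : n = m
  · subst hnm
    simp only [inner_symVec, Function.comp_apply, h]
  · rw [inner_symVec_of_ne _ _ _ hnm, inner_symVec_of_ne _ _ _ hnm]

theorem symVec_comp_equiv (s : Statistics) {n m : ℕ} (z : Fin n → Z) (e : Fin m ≃ Fin n) :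
    ∃ c : ℂ, c ≠ 0 ∧ symVec s (z ∘ e) = c • symVec s z := by
  obtain rfl : m = n := by simpa using Fintype.card_congr e
  exact ⟨s.char e, s.char_ne_zero e, symVec_comp_perm s z e⟩

theorem symVec_comp_cast (s : Statistics) {n m : ℕ} (z : Fin n → Z) (h : m = n) :
    symVec s (z ∘ Fin.cast h) = symVec s z := by
  subst h
  rfl

/-- Reversal inverts every one of the n(n-1)/2 pairs. The exponent is that of Λ. -/
theorem Equiv.Perm.sign_revPerm (n : ℕ) :
    Equiv.Perm.sign (Fin.revPerm : Equiv.Perm (Fin n)) = (-1) ^ (n * (n - 1) / 2) := by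
  rw [Equiv.Perm.sign_eq_prod_prod_Ioi]
  have h : ∀ i : Fin n, (∏ j ∈ Finset.Ioi i, if Fin.revPerm i < Fin.revPerm j then (1 : ℤˣ) else -1)
      = (-1) ^ (n - 1 - i : ℕ) := by
    intro i
    rw [Finset.prod_congr rfl (g := fun _ => (-1 : ℤˣ)), Finset.prod_const, Fin.card_Ioi]
    intro j hj
    rw [Finset.mem_Ioi] at hj
    rw [if_neg]
    simpa using hj.le
  rw [Finset.prod_congr rfl fun i _ => h i, Finset.prod_pow_eq_pow_sum,
    Fin.sum_univ_eq_sum_range (fun i => n - 1 - i), Finset.sum_range_reflect (fun i => i),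
    Finset.sum_range_id]

theorem symVec_comp_rev (s : Statistics) {n : ℕ} (z : Fin n → Z) :
    symVec s (z ∘ Fin.rev) = s.char (Fin.revPerm : Equiv.Perm (Fin n)) • symVec s z :=
  symVec_comp_perm s z Fin.revPerm

/-- A permutation sending no left index to the right preserves both finite blocks, hence is a pair
of permutations. -/
theorem sum_perm_sumCongr {α β M : Type*} [AddCommMonoid M] [Fintype α] [Fintype β]
    [DecidableEq α] [DecidableEq β] (F : Equiv.Perm (α ⊕ β) → M)
    (hF : ∀ σ, ∀ i j, σ (Sum.inl i) = Sum.inr j → F σ = 0) :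
    ∑ σ, F σ = ∑ p : Equiv.Perm α, ∑ q : Equiv.Perm β, F (Equiv.Perm.sumCongr p q) := by
  rw [← Fintype.sum_prod_type' (f := fun p q => F (Equiv.Perm.sumCongr p q))]
  refine (Fintype.sum_of_injective (Equiv.Perm.sumCongrHom α β) Equiv.Perm.sumCongrHom_injective
    _ _ (fun σ hσ => ?_) fun _ => rfl).symm
  by_contra hne
  refine hσ (Equiv.Perm.mem_sumCongrHom_range_of_perm_mapsTo_inl ?_)
  rintro _ ⟨i, rfl⟩
  rcases h : σ (Sum.inl i) with j | j
  · exact ⟨j, rfl⟩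
  · exact absurd (hF σ i j h) hne

/-- Orthogonality kills every permutation that mixes the blocks. The factorials compare the average
over permutations of n+m factors with the product of the two block averages. -/
theorem inner_symVec_append (s : Statistics) {n m : ℕ} (a a' : Fin n → Z) (b b' : Fin m → Z)
    (h : ∀ i j, inner ℂ (a i) (b' j) = 0) :
    inner ℂ (symVec s (Fin.append a b)) (symVec s (Fin.append a' b')) =
      ((n.factorial * m.factorial : ℂ) / (n + m).factorial) *
        (inner ℂ (symVec s a) (symVec s a') * inner ℂ (symVec s b) (symVec s b')) := by
  have hF : ∀ σ : Equiv.Perm (Fin n ⊕ Fin m),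
      s.char (finSumFinEquiv.permCongr σ) *
        ∏ i, inner ℂ (Fin.append a b i) (Fin.append a' b' (finSumFinEquiv.permCongr σ i)) =
      s.char (finSumFinEquiv.permCongr σ) *
        ((∏ i, inner ℂ (a i) (Sum.elim a' b' (σ (Sum.inl i)))) *
          ∏ j, inner ℂ (b j) (Sum.elim a' b' (σ (Sum.inr j)))) := by
    intro σ
    rw [← Equiv.prod_comp finSumFinEquiv, Fintype.prod_sum_type]
    congr 2
    · refine Finset.prod_congr rfl fun i _ => ?_
      rcases hσ : σ (Sum.inl i) with j | j <;> simp [Equiv.permCongr_apply, hσ]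
    · refine Finset.prod_congr rfl fun i _ => ?_
      rcases hσ : σ (Sum.inr i) with j | j <;> simp [Equiv.permCongr_apply, hσ]
  have hchar : ∀ (p : Equiv.Perm (Fin n)) (q : Equiv.Perm (Fin m)),
      s.char (finSumFinEquiv.permCongr (Equiv.Perm.sumCongr p q)) = s.char p * s.char q := by
    intro p q
    cases s <;> simp [Statistics.char]
  rw [inner_symVec, inner_symVec, inner_symVec,
    ← Equiv.sum_comp (finSumFinEquiv.permCongr : Equiv.Perm (Fin n ⊕ Fin m) ≃ _),
    Finset.sum_congr rfl fun σ _ => hF σ, sum_perm_sumCongr]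
  · simp only [hchar, Equiv.Perm.sumCongr_apply, Sum.map_inl, Sum.map_inr, Sum.elim_inl,
      Sum.elim_inr]
    rw [show ((n.factorial * m.factorial : ℂ) / (n + m).factorial) *
      (((n.factorial : ℂ)⁻¹ * ∑ σ : Equiv.Perm (Fin n), s.char σ * ∏ i, inner ℂ (a i) (a' (σ i))) *
        ((m.factorial : ℂ)⁻¹ * ∑ σ : Equiv.Perm (Fin m), s.char σ * ∏ i, inner ℂ (b i) (b' (σ i))))
      = ((n + m).factorial : ℂ)⁻¹ *
        ((∑ σ : Equiv.Perm (Fin n), s.char σ * ∏ i, inner ℂ (a i) (a' (σ i))) *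
        ∑ σ : Equiv.Perm (Fin m), s.char σ * ∏ i, inner ℂ (b i) (b' (σ i))) by
      have h1 : (n.factorial : ℂ) ≠ 0 := by exact_mod_cast n.factorial_ne_zero
      have h2 : (m.factorial : ℂ) ≠ 0 := by exact_mod_cast m.factorial_ne_zero
      field_simp]
    rw [Finset.sum_mul_sum]
    congr 1
    exact Finset.sum_congr rfl fun p _ => Finset.sum_congr rfl fun q _ => by ring
  · intro σ i j hij
    rw [Finset.prod_eq_zero (Finset.mem_univ i) (by rw [hij]; exact h i j)]
    ring

end Blocks

/-! ### Product vectors over a direct sum -/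

section DoubledFock

variable {Z Zc : Type*} [NormedAddCommGroup Z] [InnerProductSpace ℂ Z]
  [NormedAddCommGroup Zc] [InnerProductSpace ℂ Zc]

/-- The embedding of `Z` in `Z ⊕ Z̄`. -/
def dblInl (z : Z) : Doubled Z Zc := WithLp.toLp 2 (z, 0)

/-- The embedding of `Z̄` in `Z ⊕ Z̄`. -/
def dblInr (y : Zc) : Doubled Z Zc := WithLp.toLp 2 (0, y)

theorem inner_dblInl (z z' : Z) :
    inner ℂ (dblInl z : Doubled Z Zc) (dblInl z') = inner ℂ z z' := by
  simp [dblInl, WithLp.prod_inner_apply]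

theorem inner_dblInr (y y' : Zc) :
    inner ℂ (dblInr y : Doubled Z Zc) (dblInr y') = inner ℂ y y' := by
  simp [dblInr, WithLp.prod_inner_apply]

theorem inner_dblInl_dblInr (z : Z) (y : Zc) :
    inner ℂ (dblInl z : Doubled Z Zc) (dblInr y) = 0 := by
  simp [dblInl, dblInr, WithLp.prod_inner_apply]

theorem dblInl_add_dblInr (x : Doubled Z Zc) : dblInl x.fst + dblInr x.snd = x := by
  rw [dblInl, dblInr, ← WithLp.toLp_add, Prod.mk_add_mk, add_zero, zero_add]
  rfl

/-- `z₁ ⊗ ⋯ ⊗ zₙ ⊗ y₁ ⊗ ⋯ ⊗ yₘ`, for `zᵢ ∈ Z` and `yⱼ ∈ Z̄`. -/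
def dblVec (s : Statistics) {n m : ℕ} (z : Fin n → Z) (y : Fin m → Zc) :
    FockSpace (Doubled Z Zc) s :=
  symVec s (Fin.append (dblInl ∘ z) (dblInr ∘ y))

theorem symVec_inner_congr {Y : Type*} [NormedAddCommGroup Y] [InnerProductSpace ℂ Y]
    (s : Statistics) {p : Z → Y} (h : ∀ a b, inner ℂ (p a) (p b) = inner ℂ a b)
    {n : ℕ} (z z' : Fin n → Z) :
    inner ℂ (symVec s (p ∘ z)) (symVec s (p ∘ z')) = inner ℂ (symVec s z) (symVec s z') := by
  simp only [inner_symVec, Function.comp_apply, h]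

theorem inner_dblVec (s : Statistics) {n m : ℕ} (z z' : Fin n → Z) (y y' : Fin m → Zc) :
    inner ℂ (dblVec s z y) (dblVec s z' y') =
      ((n.factorial * m.factorial : ℂ) / (n + m).factorial) *
        (inner ℂ (symVec s z) (symVec s z') * inner ℂ (symVec s y) (symVec s y')) := by
  rw [dblVec, dblVec, inner_symVec_append s _ _ _ _ fun i j => inner_dblInl_dblInr _ _,
    symVec_inner_congr s inner_dblInl, symVec_inner_congr s inner_dblInr]

theorem symVec_append_smul (s : Statistics) {Y : Type*} [NormedAddCommGroup Y]
    [InnerProductSpace ℂ Y] {n m : ℕ} (c d : ℂ) (z : Fin n → Y) (y : Fin m → Y) :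
    symVec s (Fin.append (fun i => c • z i) (fun j => d • y j)) =
      (c ^ n * d ^ m) • symVec s (Fin.append z y) := by
  have h := (symVecMultilinear Y s (n + m)).map_smul_univ
    (Fin.append (fun _ : Fin n => c) (fun _ : Fin m => d)) (Fin.append z y)
  rw [Fin.prod_univ_add] at h
  simp only [Fin.append_left, Fin.append_right, Finset.prod_const, Finset.card_univ,
    Fintype.card_fin] at h
  rw [show Fin.append (fun i => c • z i) (fun j => d • y j) = fun i =>
    Fin.append (fun _ : Fin n => c) (fun _ : Fin m => d) i • Fin.append z y i from ?_]
  · exact h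
  · funext i
    refine Fin.addCases (fun i => ?_) (fun i => ?_) i <;> simp

/-- For equal total particle number, apply the self-adjoint map 2 ⊕ 1 to every factor. The vectors
are multiplied by 2ⁿ and 2^{n'} respectively, so different n means orthogonal. -/
theorem inner_dblVec_of_ne (s : Statistics) {n m n' m' : ℕ} (z : Fin n → Z) (y : Fin m → Zc)
    (z' : Fin n' → Z) (y' : Fin m' → Zc) (h : n ≠ n' ∨ m ≠ m') :
    inner ℂ (dblVec s z y) (dblVec s z' y') = 0 := by
  by_cases hN : n + m = n' + m'
  swap
  · exact inner_symVec_of_ne s _ _ hN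
  have hn : n ≠ n' := by omega
  let p : Doubled Z Zc → Doubled Z Zc := fun x => WithLp.toLp 2 ((2 : ℂ) • x.fst, x.snd)
  have hp : ∀ a b, inner ℂ (p a) b = inner ℂ a (p b) := fun a b => by
    have h2 : conj (2 : ℂ) = 2 := Complex.conj_ofNat 2
    simp [p, WithLp.prod_inner_apply, inner_smul_left, inner_smul_right, h2]
  have hdbl : ∀ {k l : ℕ} (z : Fin k → Z) (y : Fin l → Zc),
      symVec s (p ∘ Fin.append (dblInl ∘ z) (dblInr ∘ y)) = (2 ^ k : ℂ) • dblVec s z y := by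
    intro k l z y
    have := symVec_append_smul s (2 : ℂ) 1 (dblInl ∘ z : Fin k → Doubled Z Zc) (dblInr ∘ y)
    rw [one_pow, mul_one] at this
    rw [dblVec, ← this]
    congr 1
    funext i
    refine Fin.addCases (fun i => ?_) (fun i => ?_) i <;>
      simp [p, dblInl, dblInr, ← WithLp.toLp_smul]
  have h2 := inner_symVec_comp s hp (Fin.append (dblInl ∘ z) (dblInr ∘ y))
    (Fin.append (dblInl ∘ z') (dblInr ∘ y'))
  rw [hdbl, hdbl, FockSpace.inner_smul_left', FockSpace.inner_smul_right'] at h2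
  change _ * inner ℂ (dblVec s z y) (dblVec s z' y') =
    _ * inner ℂ (dblVec s z y) (dblVec s z' y') at h2
  rw [← sub_eq_zero, ← sub_mul, mul_eq_zero] at h2
  refine h2.resolve_left ?_
  rw [map_pow, Complex.conj_ofNat, sub_eq_zero]
  exact_mod_cast fun h' => hn (Nat.pow_right_injective le_rfl h')

/-- The product vectors with factors in `Z` followed by factors in `Z̄` are total. -/
theorem span_dblVec_dense (s : Statistics) :
    Dense (Submodule.span ℂ {v : FockSpace (Doubled Z Zc) s | ∃ (n m : ℕ) (z : Fin n → Z)
      (y : Fin m → Zc), v = dblVec s z y} : Set (FockSpace (Doubled Z Zc) s)) := by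
  refine (span_symVec_dense s).mono (SetLike.coe_subset_coe.2 (Submodule.span_le.2 ?_))
  rintro _ ⟨N, x, rfl⟩
  -- Every factor splits into its two components, and multilinearity gives one term for each set S
  -- of positions taking the Z component.
  have h1 := (symVecMultilinear (Doubled Z Zc) s N).map_add_univ
    (fun i => dblInl (x i).fst) (fun i => dblInr (x i).snd)
  have h2 : ((fun i => dblInl (x i).fst) + fun i => dblInr (x i).snd) = x :=
    funext fun i => dblInl_add_dblInr (x i)
  rw [h2] at h1
  rw [SetLike.mem_coe, show symVec s x = _ from h1]
  refine Submodule.sum_mem _ fun S _ => ?_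
  -- Lists S before its complement; the reordering only costs a nonzero scalar.
  let e : Fin (S.card + Sᶜ.card) ≃ Fin N :=
    finSumFinEquiv.symm.trans (finSumEquivOfFinset rfl rfl)
  obtain ⟨c, hc, hv⟩ := symVec_comp_equiv s
    (S.piecewise (fun i => dblInl (x i).fst) (fun i => dblInr (x i).snd) : Fin N → Doubled Z Zc) e
  have h3 : (S.piecewise (fun i => dblInl (x i).fst) (fun i => dblInr (x i).snd) :
      Fin N → Doubled Z Zc) ∘ e = Fin.append
        (dblInl ∘ fun i => (x (S.orderEmbOfFin rfl i)).fst)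
        (dblInr ∘ fun i => (x (Sᶜ.orderEmbOfFin rfl i)).snd) := by
    funext i
    refine Fin.addCases (fun i => ?_) (fun i => ?_) i
    · have : S.orderEmbOfFin rfl i ∈ S := Finset.orderEmbOfFin_mem _ _ _
      simp [e]
    · have : Sᶜ.orderEmbOfFin rfl i ∉ S := Finset.mem_compl.1 (Finset.orderEmbOfFin_mem _ _ _)
      have h4 : e (Fin.natAdd _ i) = Sᶜ.orderEmbOfFin rfl i := by
        rw [← finSumFinEquiv_apply_right]
        simp only [e, Equiv.trans_apply, Equiv.symm_apply_apply, finSumEquivOfFinset_inr]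
      rw [Fin.append_right, Function.comp_apply, h4, Finset.piecewise_eq_of_notMem _ _ _ this,
        Function.comp_apply]
  rw [h3] at hv
  change symVec s _ ∈ _
  rw [← inv_smul_smul₀ hc (symVec s _), ← hv]
  exact Submodule.smul_mem _ _ (Submodule.subset_span ⟨_, _, _, _, rfl⟩)

end DoubledFock

section Antiunitary

variable {E F : Type*} [NormedAddCommGroup E] [InnerProductSpace ℂ E]
  [NormedAddCommGroup F] [InnerProductSpace ℂ F]

/-- Real parts come from the norms of sums, imaginary parts from replacing u by iu, where
antilinearity changes the sign. -/
theorem LinearIsometryEquiv.inner_map_map' (J : E ≃ₗᵢ⋆[ℂ] F) (x y : E) :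
    inner ℂ (J x) (J y) = inner ℂ y x := by
  have h1 : ∀ u v : E, (inner ℂ (J u) (J v)).re = (inner ℂ u v).re := by
    intro u v
    have h2 := norm_add_sq (𝕜 := ℂ) (J u) (J v)
    have h3 := norm_add_sq (𝕜 := ℂ) u v
    rw [← map_add, J.norm_map, J.norm_map, J.norm_map, h3] at h2
    simpa using h2.symm
  have h2 : ∀ u v : E, (inner ℂ (J u) (J v)).im = - (inner ℂ u v).im := by
    intro u v
    have h := h1 (Complex.I • u) v
    rw [map_smulₛₗ, inner_smul_left, inner_smul_left] at h
    simp at h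
    linarith
  refine Eq.trans (Complex.ext ?_ ?_) (inner_conj_symm y x)
  · rw [h1, Complex.conj_re]
  · rw [h2, Complex.conj_im]

end Antiunitary

/-! ### The unitary W and the modular conjugation -/

section Identification

variable {Z Zc : Type*}
    [NormedAddCommGroup Z] [InnerProductSpace ℂ Z]
    [NormedAddCommGroup Zc] [InnerProductSpace ℂ Zc]

/-- The vector `√((n+m)!/(n!m!)) z₁ ⊗ ⋯ ⊗ zₙ ⊗ w̄ₘ ⊗ ⋯ ⊗ w̄₁`. -/
def pairVec (s : Statistics) (bar : Z ≃ₗᵢ⋆[ℂ] Zc) {n m : ℕ} (z : Fin n → Z) (w : Fin m → Z) :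
    FockSpace (Doubled Z Zc) s :=
  ((√(((n + m).factorial : ℝ) / (n.factorial * m.factorial)) : ℝ) : ℂ) •
    dblVec s z (bar ∘ w ∘ Fin.rev)

theorem inner_symVec_bar (s : Statistics) (bar : Z ≃ₗᵢ⋆[ℂ] Zc) {n : ℕ} (w w' : Fin n → Z) :
    inner ℂ (symVec s (bar ∘ w)) (symVec s (bar ∘ w')) = inner ℂ (symVec s w') (symVec s w) := by
  rw [inner_symVec, inner_symVec]
  congr 1
  refine Fintype.sum_equiv (Equiv.inv _) _ _ fun σ => ?_
  rw [Equiv.inv_apply, s.char_inv]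
  congr 1
  refine Fintype.prod_equiv σ _ _ fun i => ?_
  simp [bar.inner_map_map']

/-- The square of the normalizing root cancels n!m!/(n+m)! from the block formula. The sign from
reversing the w̄ occurs twice and disappears. -/
theorem inner_pairVec (s : Statistics) (bar : Z ≃ₗᵢ⋆[ℂ] Zc) {n m : ℕ} (z z' : Fin n → Z)
    (w w' : Fin m → Z) : inner ℂ (pairVec s bar z w) (pairVec s bar z' w') =
      inner ℂ (symVec s z) (symVec s z') * inner ℂ (symVec s w') (symVec s w) := by
  rw [pairVec, pairVec, FockSpace.inner_smul_left', FockSpace.inner_smul_right', inner_dblVec,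
    inner_symVec_bar, symVec_comp_rev, symVec_comp_rev, FockSpace.inner_smul_left',
    FockSpace.inner_smul_right', Complex.conj_ofReal, s.conj_char]
  set r : ℝ := ((n + m).factorial : ℝ) / (n.factorial * m.factorial) with hr
  have hr0 : 0 < r := by positivity
  have h1 : (√r : ℂ) * √r = r := by
    rw [← Complex.ofReal_mul, Real.mul_self_sqrt hr0.le]
  have h2 : (r : ℂ) * ((n.factorial * m.factorial : ℂ) / (n + m).factorial) = 1 := by
    rw [hr]
    push_cast
    have h1 : (n.factorial : ℂ) ≠ 0 := by exact_mod_cast n.factorial_ne_zero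
    have h2 : (m.factorial : ℂ) ≠ 0 := by exact_mod_cast m.factorial_ne_zero
    have h3 : ((n + m).factorial : ℂ) ≠ 0 := by exact_mod_cast (n + m).factorial_ne_zero
    field_simp
  have h3 := s.char_mul_self (Fin.revPerm : Equiv.Perm (Fin m))
  linear_combination (inner ℂ (symVec s z) (symVec s z') * inner ℂ (symVec s w') (symVec s w)) *
    (((n.factorial * m.factorial : ℂ) / (n + m).factorial) * (s.char Fin.revPerm) ^ 2 * h1 +
      (s.char Fin.revPerm) ^ 2 * h2 + h3)

theorem inner_pairVec_of_ne (s : Statistics) (bar : Z ≃ₗᵢ⋆[ℂ] Zc) {n m n' m' : ℕ} (z : Fin n → Z)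
    (w : Fin m → Z) (z' : Fin n' → Z) (w' : Fin m' → Z) (h : n ≠ n' ∨ m ≠ m') :
    inner ℂ (pairVec s bar z w) (pairVec s bar z' w') = 0 := by
  rw [pairVec, pairVec, FockSpace.inner_smul_left', FockSpace.inner_smul_right',
    inner_dblVec_of_ne s _ _ _ _ h, mul_zero, mul_zero]

theorem inner_pairVec_eq (s : Statistics) (bar : Z ≃ₗᵢ⋆[ℂ] Zc) {n m n' m' : ℕ} (z : Fin n → Z)
    (w : Fin m → Z) (z' : Fin n' → Z) (w' : Fin m' → Z) :
    inner ℂ (pairVec s bar z w) (pairVec s bar z' w') =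
      inner ℂ (symVec s z) (symVec s z') * inner ℂ (symVec s w') (symVec s w) := by
  by_cases h : n = n' ∧ m = m'
  · obtain ⟨rfl, rfl⟩ := h
    exact inner_pairVec s bar z z' w w'
  · rw [not_and_or] at h
    rw [inner_pairVec_of_ne s bar z w z' w' h]
    rcases h with h | h
    · rw [inner_symVec_of_ne s z z' h, zero_mul]
    · rw [inner_symVec_of_ne s w' w (Ne.symm h), mul_zero]

theorem span_pairVec_dense (s : Statistics) (bar : Z ≃ₗᵢ⋆[ℂ] Zc) :
    Dense (Submodule.span ℂ {v : FockSpace (Doubled Z Zc) s | ∃ (n m : ℕ) (z : Fin n → Z)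
      (w : Fin m → Z), v = pairVec s bar z w} : Set (FockSpace (Doubled Z Zc) s)) := by
  refine (span_dblVec_dense s).mono (SetLike.coe_subset_coe.2 (Submodule.span_le.2 ?_))
  rintro _ ⟨n, m, z, y, rfl⟩
  have hr : ((√(((n + m).factorial : ℝ) / (n.factorial * m.factorial)) : ℝ) : ℂ) ≠ 0 := by
    rw [Complex.ofReal_ne_zero]
    positivity
  have h : dblVec s z y = (((√(((n + m).factorial : ℝ) / (n.factorial * m.factorial)) : ℝ) : ℂ))⁻¹ •
      pairVec s bar z (bar.symm ∘ y ∘ Fin.rev) := by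
    rw [pairVec, inv_smul_smul₀ hr]
    congr 1
    funext i
    simp
  rw [h]
  exact Submodule.smul_mem _ _ (Submodule.subset_span ⟨_, _, _, _, rfl⟩)

variable [CompleteSpace Z] [CompleteSpace Zc]

/-- Rank one operators and pair vectors have equal Gram matrices and are both total. The resulting
isometry has closed and dense range. -/
theorem exists_isFockIdentification (s : Statistics) (bar : Z ≃ₗᵢ⋆[ℂ] Zc) :
    ∃ W : HilbertSchmidt (FockSpace Z s) ≃ₗ[ℂ] FockSpace (Doubled Z Zc) s,
      IsFockIdentification s bar W := by
  let ι := Σ nm : ℕ × ℕ, (Fin nm.1 → Z) × (Fin nm.2 → Z)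
  let L := lp (fun _ : onbSet (FockSpace Z s) => FockSpace Z s) 2
  let a : ι → L := fun p => hsToLp _ (hsRankOne (symVec s p.2.1) (symVec s p.2.2))
  let b : ι → FockSpace (Doubled Z Zc) s := fun p => pairVec s bar p.2.1 p.2.2
  have ha : Dense (Submodule.span ℂ (Set.range a) : Set L) := by
    have := (isHSUnitary_hsToLp (H := FockSpace Z s)).dense_span_hsRankOne (span_symVec_dense s)
    refine this.mono (Submodule.span_mono ?_)
    rintro _ ⟨_, ⟨n, z, rfl⟩, _, ⟨m, w, rfl⟩, rfl⟩
    exact ⟨⟨(n, m), (z, w)⟩, rfl⟩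
  have hb : Dense (Submodule.span ℂ (Set.range b) : Set (FockSpace (Doubled Z Zc) s)) := by
    refine (span_pairVec_dense s bar).mono (Submodule.span_mono ?_)
    rintro _ ⟨n, m, z, w, rfl⟩
    exact ⟨⟨(n, m), (z, w)⟩, rfl⟩
  have hab : ∀ p q, inner ℂ (b p) (b q) = inner ℂ (a p) (a q) := by
    rintro ⟨⟨n, m⟩, z, w⟩ ⟨⟨n', m'⟩, z', w'⟩
    simp only [a, b]
    rw [inner_pairVec_eq, IsHSUnitary.inner_hsRankOne_left isHSUnitary_hsToLp, hsRankOne_apply,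
      FockSpace.inner_smul_right', mul_comm]
  obtain ⟨G, hG, hn⟩ := exists_isometry_of_inner_eq (σ := RingHom.id ℂ) (fun _ => rfl)
    (fun _ => rfl) ha (b := b) hab
  let G' : L →ₗᵢ[ℂ] FockSpace (Doubled Z Zc) s := ⟨G.toLinearMap, hn⟩
  have hsurj : Function.Surjective G' := by
    have hcl : IsClosed (Set.range G') := G'.isometry.isClosedEmbedding.isClosed_range
    have hle : Submodule.span ℂ (Set.range b) ≤ G'.toLinearMap.range := by
      rw [Submodule.span_le]
      rintro _ ⟨p, rfl⟩
      exact ⟨a p, hG p⟩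
    rw [← Set.range_eq_univ, ← hcl.closure_eq]
    exact (hb.mono (SetLike.coe_subset_coe.2 hle)).closure_eq
  let W := (hsToLp (FockSpace Z s)).trans (LinearEquiv.ofBijective G'.toLinearMap
    ⟨G'.injective, hsurj⟩)
  refine ⟨W, fun A B => ?_, fun n m z w => ?_⟩
  · exact (G'.inner_map_map _ _).trans (isHSUnitary_hsToLp A B)
  · exact hG ⟨(n, m), (z, w)⟩

namespace IsFockIdentification

variable {s : Statistics} {bar : Z ≃ₗᵢ⋆[ℂ] Zc}
  {W : HilbertSchmidt (FockSpace Z s) ≃ₗ[ℂ] FockSpace (Doubled Z Zc) s}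

theorem isHSUnitary (hW : IsFockIdentification s bar W) : IsHSUnitary W := hW.inner_eq

theorem map_hsRankOne (hW : IsFockIdentification s bar W) {n m : ℕ} (z : Fin n → Z)
    (w : Fin m → Z) : W (hsRankOne (symVec s z) (symVec s w)) = pairVec s bar z w :=
  hW.apply_rankOne n m z w

/-- Inner products of W A with pair vectors are matrix elements of A, whichever W is used. -/
theorem unique (hW : IsFockIdentification s bar W)
    {W' : HilbertSchmidt (FockSpace Z s) ≃ₗ[ℂ] FockSpace (Doubled Z Zc) s}
    (hW' : IsFockIdentification s bar W') : W' = W := by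
  refine LinearEquiv.ext fun A => ?_
  refine (span_pairVec_dense s bar).eq_of_inner_right ℂ fun v hv => ?_
  induction hv using Submodule.span_induction with
  | mem v hv =>
    obtain ⟨n, m, z, w, rfl⟩ := hv
    conv_lhs => rw [← hW'.map_hsRankOne]
    conv_rhs => rw [← hW.map_hsRankOne]
    rw [hW.isHSUnitary.inner_hsRankOne_left, hW'.isHSUnitary.inner_hsRankOne_left]
  | zero => simp
  | add x y _ _ hx hy => rw [inner_add_left, inner_add_left, hx, hy]
  | smul c x _ hx => rw [FockSpace.inner_smul_left', FockSpace.inner_smul_left', hx]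

/-- Bounded (anti)linear maps agreeing on the images of rank one operators are equal. -/
theorem clm_ext {σ : ℂ →+* ℂ} {K : Type*} [NormedAddCommGroup K] [NormedSpace ℂ K]
    {S T : FockSpace (Doubled Z Zc) s →SL[σ] K}
    (h : ∀ (n m : ℕ) (z : Fin n → Z) (w : Fin m → Z),
      S (pairVec s bar z w) = T (pairVec s bar z w)) : S = T := by
  refine ContinuousLinearMap.ext_on (span_pairVec_dense s bar) ?_
  rintro _ ⟨n, m, z, w, rfl⟩
  exact h n m z w

end IsFockIdentification

theorem inner_epsMap (bar : Z ≃ₗᵢ⋆[ℂ] Zc) (x y : Doubled Z Zc) :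
    inner ℂ (epsMap bar x) (epsMap bar y) = inner ℂ y x := by
  simp [epsMap, WithLp.prod_inner_apply, LinearIsometryEquiv.inner_map_map', add_comm]

/-- In this form J looks the same for both statistics: Λ is precisely the sign of the reversal. -/
theorem modularConj_symVec (s : Statistics) (bar : Z ≃ₗᵢ⋆[ℂ] Zc) {n : ℕ}
    (x : Fin n → Doubled Z Zc) :
    modularConj s bar (symVec s x) = symVec s (epsMap bar ∘ x ∘ Fin.rev) := by
  rw [← Function.comp_assoc, symVec_comp_rev]
  cases s
  · rw [modularConj, antiSecondQuant_symVec (inner_epsMap bar)]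
    simp [Statistics.char]
  · rw [modularConj]
    rw [ContinuousLinearMap.comp_apply, antiSecondQuant_symVec (inner_epsMap bar), lambdaOp_symVec]
    simp [Statistics.char, Equiv.Perm.sign_revPerm]

/-- Reversing all factors exchanges the two blocks and ε returns each to its own space. This matches
the adjoint |w)(z| of |z)(w|. -/
theorem modularConj_pairVec (s : Statistics) (bar : Z ≃ₗᵢ⋆[ℂ] Zc) {n m : ℕ} (z : Fin n → Z)
    (w : Fin m → Z) : modularConj s bar (pairVec s bar z w) = pairVec s bar w z := by
  have h : (epsMap bar ∘ Fin.append (dblInl ∘ z) (dblInr ∘ bar ∘ w ∘ Fin.rev) ∘ Fin.rev :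
      Fin (n + m) → Doubled Z Zc) =
      Fin.append (dblInl ∘ w) (dblInr ∘ bar ∘ z ∘ Fin.rev) ∘ Fin.cast (Nat.add_comm n m) := by
    rw [Fin.append_comp_rev]
    funext i
    simp only [Function.comp_apply]
    generalize Fin.cast (Nat.add_comm n m) i = j
    refine Fin.addCases (fun j => ?_) (fun j => ?_) j <;> simp [epsMap, dblInl, dblInr]
  rw [pairVec, pairVec, map_smulₛₗ, dblVec, modularConj_symVec, h, symVec_comp_cast, ← dblVec,
    Complex.conj_ofReal, Nat.add_comm m n, mul_comm (m.factorial : ℝ)]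

theorem IsFockIdentification.conjMap_eq {s : Statistics} {bar : Z ≃ₗᵢ⋆[ℂ] Zc}
    {W : HilbertSchmidt (FockSpace Z s) ≃ₗ[ℂ] FockSpace (Doubled Z Zc) s}
    (hW : IsFockIdentification s bar W) : hW.isHSUnitary.conjMap = modularConj s bar := by
  refine IsFockIdentification.clm_ext (bar := bar) fun n m z w => ?_
  rw [modularConj_pairVec, ← hW.map_hsRankOne, hW.isHSUnitary.conjMap_hsRankOne,
    hW.map_hsRankOne]

end Identification

/-! ### Unitary groups from isometric groups -/

section UnitaryGroups

variable {K : Type*} [NormedAddCommGroup K] [InnerProductSpace ℂ K] [CompleteSpace K]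

theorem IsUnitaryGroup.of_norm_map {u : ℝ → K →L[ℂ] K} (h0 : u 0 = 1)
    (hadd : ∀ t r, u (t + r) = u t * u r) (hnorm : ∀ t Φ, ‖u t Φ‖ = ‖Φ‖) {S : Set K}
    (hS : Dense (Submodule.span ℂ S : Set K)) (hcont : ∀ Φ ∈ S, Continuous fun t => u t Φ) :
    IsUnitaryGroup u where
  zero := h0
  add := hadd
  unitary t := by
    have h1 : star (u t) * u t = 1 :=
      (ContinuousLinearMap.norm_map_iff_adjoint_comp_self (u t)).1 (hnorm t)
    have h2 : u t * u (-t) = 1 := by rw [← hadd, add_neg_cancel, h0]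
    have h3 : star (u t) = u (-t) := by
      rw [← mul_one (star (u t)), ← h2, ← mul_assoc, h1, one_mul]
    exact Unitary.mem_iff.2 ⟨h1, by rw [h3, h2]⟩
  continuous Φ := by
    -- Each u_t is isometric, so approximating Φ by combinations of S approximates its orbit
    -- uniformly in t.
    refine continuous_of_uniform_approx_of_continuous fun V hV => ?_
    obtain ⟨ε, hε, hεV⟩ := Metric.mem_uniformity_dist.1 hV
    obtain ⟨Ψ, hΨ, hd⟩ := Metric.dense_iff.1 hS Φ ε hε
    refine ⟨fun t => u t Ψ, ?_, fun t => hεV ?_⟩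
    · rw [SetLike.mem_coe] at hd
      clear hΨ
      induction hd using Submodule.span_induction with
      | mem x hx => exact hcont x hx
      | zero => simpa using continuous_const
      | add x y _ _ hx hy => simp only [map_add]; exact hx.add hy
      | smul c x _ hx => simp only [map_smul]; exact hx.const_smul c
    · rw [dist_eq_norm, ← map_sub, hnorm, ← dist_eq_norm, dist_comm]
      exact hΨ

end UnitaryGroups

/-! ### Second quantized groups and their generators -/

section SecondQuantizedGroup

variable {Z : Type*} [NormedAddCommGroup Z] [InnerProductSpace ℂ Z] {s : Statistics}

theorem secondQuant_symVec_of_inner {u : Z →L[ℂ] Z} (hu : ∀ z w, inner ℂ (u z) (u w) = inner ℂ z w)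
    {n : ℕ} (z : Fin n → Z) : secondQuant s u (symVec s z) = symVec s (u ∘ z) := by
  obtain ⟨G, hG, -⟩ := exists_secondQuant (s := s) hu
  rw [secondQuant, ofProducts_eq hG, hG]

theorem norm_secondQuant_of_inner {u : Z →L[ℂ] Z} (hu : ∀ z w, inner ℂ (u z) (u w) = inner ℂ z w)
    (Φ : FockSpace Z s) : ‖secondQuant s u Φ‖ = ‖Φ‖ := by
  obtain ⟨G, hG, hn⟩ := exists_secondQuant (s := s) hu
  rw [secondQuant, ofProducts_eq hG, hn]

variable [CompleteSpace Z]

theorem IsUnitaryGroup.secondQuant {u : ℝ → Z →L[ℂ] Z} (hu : IsUnitaryGroup u) :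
    IsUnitaryGroup fun t => secondQuant s (u t) := by
  refine IsUnitaryGroup.of_norm_map ?_ (fun t r => ?_)
    (fun t => norm_secondQuant_of_inner (hu.inner_map t)) (span_symVec_dense s) ?_
  · refine FockSpace.clm_ext fun n w => ?_
    rw [secondQuant_symVec_of_inner (hu.inner_map 0), hu.zero]
    rfl
  · refine FockSpace.clm_ext fun n w => ?_
    rw [secondQuant_symVec_of_inner (hu.inner_map _), mul_apply_eq_comp,
      secondQuant_symVec_of_inner (hu.inner_map r), secondQuant_symVec_of_inner (hu.inner_map t),
      hu.add]
    rfl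
  · rintro _ ⟨n, z, rfl⟩
    simp only [secondQuant_symVec_of_inner (hu.inner_map _)]
    exact (symVecMul Z s n).cont.comp (continuous_pi fun i => hu.continuous (z i))

/-- The product rule for the continuous multilinear map `symVecMul`. -/
theorem IsUnitaryGroup.hasDerivAt_secondQuant {u : ℝ → Z →L[ℂ] Z} (hu : IsUnitaryGroup u)
    {n : ℕ} {z w : Fin n → Z} (h : ∀ i, HasDerivAt (fun t => u t (z i)) (Complex.I • w i) 0) :
    HasDerivAt (fun t => _root_.secondQuant s (u t) (symVec s z))
      (Complex.I • ∑ j, symVec s (Function.update z j (w j))) 0 := by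
  simp only [secondQuant_symVec_of_inner (hu.inner_map _)]
  have h1 : HasDerivAt (fun t i => u t (z i)) (fun i => Complex.I • w i) 0 := hasDerivAt_pi.2 h
  have h2 := ((symVecMul Z s n).hasFDerivAt (fun i => u 0 (z i))).restrictScalars ℝ
  have h3 := h2.comp_hasDerivAt 0 h1
  refine HasDerivAt.congr_deriv (f := (symVecMul Z s n) ∘ fun t i => u t (z i)) h3 (Eq.symm ?_)
  change _ = (symVecMul Z s n).linearDeriv (fun i => u 0 (z i)) (fun i => Complex.I • w i)
  rw [ContinuousMultilinearMap.linearDeriv_apply, hu.zero]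
  refine Finset.smul_sum.trans ?_
  refine Finset.sum_congr rfl fun j _ => ?_
  exact (symVec_update_smul s z j Complex.I (w j)).symm

theorem Submodule.image_fst_span {E : Type*} [AddCommGroup E] [Module ℂ E] (S : Set (E × E)) :
    Prod.fst '' (Submodule.span ℂ S : Set (E × E)) = Submodule.span ℂ (Prod.fst '' S) := by
  have h := Submodule.map_span (LinearMap.fst ℂ E E) S
  exact congrArg (fun D : Submodule ℂ E => (D : Set E)) h

theorem dense_span_symVec {D : Submodule ℂ Z} (hD : Dense (D : Set Z)) :
    Dense (Submodule.span ℂ {v : FockSpace Z s | ∃ (n : ℕ) (z : Fin n → D),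
      v = symVec s (fun i => (z i : Z))} : Set (FockSpace Z s)) := by
  have h1 : ∀ (n : ℕ) (z : Fin n → Z), symVec s z ∈ closure {v : FockSpace Z s |
      ∃ (n : ℕ) (z : Fin n → D), v = symVec s (fun i => (z i : Z))} := by
    intro n z
    have hd : Dense (Set.univ.pi fun _ : Fin n => (D : Set Z)) := dense_pi _ fun _ _ => hD
    refine map_mem_closure (symVecMul Z s n).cont (hd z) fun w hw => ?_
    exact ⟨n, fun i => ⟨w i, hw i trivial⟩, rfl⟩
  rw [← dense_closure, ← Submodule.topologicalClosure_coe]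
  refine (span_symVec_dense s).mono (SetLike.coe_subset_coe.2 (Submodule.span_le.2 ?_))
  rintro _ ⟨n, z, rfl⟩
  exact closure_mono Submodule.subset_span (h1 n z)

/-- `dΓ(h)` generates the group `Γ(e^{ith})`. -/
theorem IsUnitaryGroupOf.dGamma {h : Z →ₗ.[ℂ] Z} {u : ℝ → Z →L[ℂ] Z} (hu : IsUnitaryGroupOf h u)
    (hh : Dense (h.domain : Set Z)) :
    IsUnitaryGroupOf (dGamma s h) fun t => secondQuant s (u t) := by
  have hU := hu.isUnitaryGroup
  -- Product vectors with factors in the domain of h span an invariant core, because u_t preserves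
  -- the domain and commutes with h on it.
  refine (hU.secondQuant (s := s)).isUnitaryGroupOf_closure (fun p hp => ?_) ?_ ?_
  · induction hp using Submodule.span_induction with
    | mem p hp =>
      obtain ⟨n, z, rfl⟩ := hp
      exact hU.hasDerivAt_secondQuant fun i => (hu.generator _ _).1 (h.mem_graph (z i))
    | zero => simpa using hasDerivAt_const (0 : ℝ) (0 : FockSpace Z s)
    | add p q _ _ hp hq =>
      simp only [Prod.fst_add, Prod.snd_add, map_add, smul_add]
      exact hp.add hq
    | smul c p _ hp =>
      simp only [Prod.smul_fst, Prod.smul_snd, map_smul, smul_comm Complex.I c]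
      exact hp.const_smul c
  · refine (dense_span_symVec hh).mono ?_
    rw [Submodule.image_fst_span]
    refine SetLike.coe_subset_coe.2 (Submodule.span_mono ?_)
    rintro v ⟨n, z, hv⟩
    exact ⟨(v, ∑ j : Fin n, symVec s (Function.update (fun i => (z i : Z)) j (h (z j)))),
      ⟨n, z, Prod.ext hv rfl⟩, rfl⟩
  · intro t p hp
    induction hp using Submodule.span_induction with
    | mem p hp =>
      obtain ⟨n, z, rfl⟩ := hp
      have hz : ∀ i, ∃ y : h.domain, (y : Z) = u t (z i) ∧ h y = u t (h (z i)) := fun i =>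
        (h.mem_graph_iff).1 ((hu.generator _ _).2 (hU.hasDerivAt_map
          ((hu.generator _ _).1 (h.mem_graph (z i))) t))
      choose y hy hy' using hz
      refine Submodule.subset_span ⟨n, y, ?_⟩
      simp only [map_sum, secondQuant_symVec_of_inner (hU.inner_map _), hy, hy']
      refine Prod.ext rfl ?_
      have h4 : ∀ j, symVec s (u t ∘ Function.update (fun i => (z i : Z)) j (h (z j))) =
          symVec s (Function.update (fun i => u t (z i)) j (u t (h (z j)))) := fun j =>
        congrArg _ (Function.comp_update _ _ _ _)
      simp only [h4]
    | zero => simp only [Prod.fst_zero, Prod.snd_zero, map_zero]; exact Submodule.zero_mem _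
    | add p q _ _ hp hq => simpa using add_mem hp hq
    | smul c p _ hp => simpa using Submodule.smul_mem _ c hp

theorem IsUnitaryGroupOf.dense_domain_dGamma {h : Z →ₗ.[ℂ] Z} {u : ℝ → Z →L[ℂ] Z}
    (hu : IsUnitaryGroupOf h u) (hh : Dense (h.domain : Set Z)) :
    Dense ((_root_.dGamma s h).domain : Set (FockSpace Z s)) := by
  refine (dense_span_symVec hh).mono (SetLike.coe_subset_coe.2 (Submodule.span_le.2 ?_))
  rintro _ ⟨n, z, rfl⟩
  exact LinearPMap.mem_domain_of_mem_graph (((hu.dGamma (s := s) hh).generator _ _).2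
    (hu.isUnitaryGroup.hasDerivAt_secondQuant fun i => (hu.generator _ _).1 (h.mem_graph (z i))))

end SecondQuantizedGroup

/-! ### Groups on the doubled one-particle space -/

section DirectSum

variable {Z Zc : Type*} [NormedAddCommGroup Z] [InnerProductSpace ℂ Z] [CompleteSpace Z]
  [NormedAddCommGroup Zc] [InnerProductSpace ℂ Zc] [CompleteSpace Zc]

/-- The bounded operator `p ⊕ q` on `Z ⊕ Z̄`. -/
def dblMap (p : Z →L[ℂ] Z) (q : Zc →L[ℂ] Zc) : Doubled Z Zc →L[ℂ] Doubled Z Zc :=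
  (WithLp.prodContinuousLinearEquiv 2 ℂ Z Zc).symm.toContinuousLinearMap ∘L p.prodMap q ∘L
    (WithLp.prodContinuousLinearEquiv 2 ℂ Z Zc).toContinuousLinearMap

theorem dblMap_apply (p : Z →L[ℂ] Z) (q : Zc →L[ℂ] Zc) (x : Doubled Z Zc) :
    dblMap p q x = WithLp.toLp 2 (p x.fst, q x.snd) := rfl

theorem dblMap_dblInl (p : Z →L[ℂ] Z) (q : Zc →L[ℂ] Zc) (z : Z) :
    dblMap p q (dblInl z) = dblInl (p z) := by
  simp [dblMap_apply, dblInl]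

theorem dblMap_dblInr (p : Z →L[ℂ] Z) (q : Zc →L[ℂ] Zc) (y : Zc) :
    dblMap p q (dblInr y) = dblInr (q y) := by
  simp [dblMap_apply, dblInr]

theorem IsUnitaryGroup.dblMap {u : ℝ → Z →L[ℂ] Z} {v : ℝ → Zc →L[ℂ] Zc} (hu : IsUnitaryGroup u)
    (hv : IsUnitaryGroup v) : IsUnitaryGroup fun t => dblMap (u t) (v t) := by
  refine IsUnitaryGroup.of_norm_map (S := Set.univ) ?_ (fun t r => ?_) (fun t x => ?_) (by simp)
    fun x _ => ?_
  · ext x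
    rw [dblMap_apply, hu.zero, hv.zero]
    rfl
  · ext x
    rw [dblMap_apply, hu.add, hv.add]
    rfl
  · rw [dblMap_apply, WithLp.prod_norm_eq_of_L2, WithLp.prod_norm_eq_of_L2]
    simp [hu.norm_map, hv.norm_map]
  · simp only [dblMap_apply]
    exact (WithLp.prod_continuous_toLp 2 Z Zc).comp
      ((hu.continuous x.fst).prodMk (hv.continuous x.snd))

theorem mem_graph_dirSum {p : Z →ₗ.[ℂ] Z} {q : Zc →ₗ.[ℂ] Zc} {x y : Doubled Z Zc} :
    (x, y) ∈ (dirSum p q).graph ↔ (x.fst, y.fst) ∈ p.graph ∧ (x.snd, y.snd) ∈ q.graph := by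
  simp only [LinearPMap.mem_graph_iff]
  constructor
  · rintro ⟨a, rfl, rfl⟩
    exact ⟨⟨⟨a.1.fst, a.2.1⟩, rfl, rfl⟩, ⟨⟨a.1.snd, a.2.2⟩, rfl, rfl⟩⟩
  · rintro ⟨⟨a, ha, ha'⟩, ⟨b, hb, hb'⟩⟩
    refine ⟨⟨WithLp.toLp 2 (a.1, b.1), a.2, b.2⟩, ?_, ?_⟩
    · change WithLp.toLp 2 ((a : Z), (b : Zc)) = x
      rw [ha, hb]
      rfl
    · change WithLp.toLp 2 (p a, q b) = y
      rw [ha', hb']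
      rfl

theorem IsUnitaryGroupOf.dirSum {p : Z →ₗ.[ℂ] Z} {q : Zc →ₗ.[ℂ] Zc} {u : ℝ → Z →L[ℂ] Z}
    {v : ℝ → Zc →L[ℂ] Zc} (hu : IsUnitaryGroupOf p u) (hv : IsUnitaryGroupOf q v) :
    IsUnitaryGroupOf (dirSum p q) fun t => _root_.dblMap (u t) (v t) := by
  have h := hu.isUnitaryGroup.dblMap hv.isUnitaryGroup
  refine ⟨h.zero, h.add, h.unitary, h.continuous, fun x y => ?_⟩
  rw [mem_graph_dirSum, hu.generator, hv.generator]
  constructor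
  · rintro ⟨h1, h2⟩
    exact ((WithLp.prodContinuousLinearEquiv 2 ℂ Z Zc).symm.toContinuousLinearMap.restrictScalars
      ℝ).hasFDerivAt.comp_hasDerivAt 0 (h1.prodMk h2)
  · intro h1
    have h2 := ((WithLp.prodContinuousLinearEquiv 2 ℂ Z Zc).toContinuousLinearMap.restrictScalars
      ℝ).hasFDerivAt.comp_hasDerivAt 0 h1
    exact ⟨(ContinuousLinearMap.fst ℝ Z Zc).hasFDerivAt.comp_hasDerivAt 0 h2,
      (ContinuousLinearMap.snd ℝ Z Zc).hasFDerivAt.comp_hasDerivAt 0 h2⟩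

theorem dense_domain_dirSum {p : Z →ₗ.[ℂ] Z} {q : Zc →ₗ.[ℂ] Zc} (hp : Dense (p.domain : Set Z))
    (hq : Dense (q.domain : Set Zc)) : Dense ((dirSum p q).domain : Set (Doubled Z Zc)) := by
  have := (hp.prod hq).preimage
    (WithLp.prodContinuousLinearEquiv 2 ℂ Z Zc).toHomeomorph.isOpenMap
  exact this

/-- The operator `z̄ ↦ conj (p z)` on `Z̄`. -/
def barConj (bar : Z ≃ₗᵢ⋆[ℂ] Zc) (p : Z →L[ℂ] Z) : Zc →L[ℂ] Zc :=
  ((bar : Z →L⋆[ℂ] Zc).comp p).comp (bar.symm : Zc →L⋆[ℂ] Z)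

theorem barConj_apply (bar : Z ≃ₗᵢ⋆[ℂ] Zc) (p : Z →L[ℂ] Z) (y : Zc) :
    barConj bar p y = bar (p (bar.symm y)) := rfl

/-- Conjugation turns i into -i, which is the source of the minus sign in -h̄. -/
theorem IsUnitaryGroupOf.barConj {h : Z →ₗ.[ℂ] Z} {u : ℝ → Z →L[ℂ] Z} (hu : IsUnitaryGroupOf h u)
    (bar : Z ≃ₗᵢ⋆[ℂ] Zc) : IsUnitaryGroupOf (-conjPMap bar h) fun t => _root_.barConj bar (u t) := by
  have hU := hu.isUnitaryGroup
  have hV := IsUnitaryGroup.of_norm_map (u := fun t => _root_.barConj bar (u t)) (S := Set.univ)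
    (by ext y; simp [barConj_apply, hU.zero])
    (fun t r => by ext y; simp [barConj_apply, hU.add])
    (fun t y => by simp [barConj_apply, hU.norm_map]) (by simp)
    fun y _ => bar.continuous.comp (hU.continuous _)
  refine ⟨hV.zero, hV.add, hV.unitary, hV.continuous, fun x y => ?_⟩
  have h1 : (x, y) ∈ (-conjPMap bar h).graph ↔ (bar.symm x, -bar.symm y) ∈ h.graph := by
    simp only [LinearPMap.mem_graph_iff]
    constructor
    · rintro ⟨a, rfl, rfl⟩
      refine ⟨⟨bar.symm a, a.2⟩, rfl, ?_⟩
      rw [LinearPMap.neg_apply, map_neg, neg_neg]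
      exact (bar.symm_apply_apply _).symm
    · rintro ⟨⟨a, ha⟩, rfl, ha'⟩
      refine ⟨⟨x, ha⟩, rfl, ?_⟩
      rw [LinearPMap.neg_apply]
      change -bar (h ⟨bar.symm x, ha⟩) = y
      rw [ha', map_neg, neg_neg, bar.apply_symm_apply]
  rw [h1, hu.generator]
  simp only [barConj_apply]
  constructor
  · intro h2
    have h3 := (AddMonoidHom.toRealLinearMap (bar : Z →+ Zc)
      bar.continuous).hasFDerivAt.comp_hasDerivAt 0 h2
    refine HasDerivAt.congr_deriv (f := fun t => bar (u t (bar.symm x))) h3 ?_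
    change bar _ = _
    rw [map_smulₛₗ, map_neg]
    simp
  · intro h2
    have h3 := (AddMonoidHom.toRealLinearMap (bar.symm : Zc →+ Z)
      bar.symm.continuous).hasFDerivAt.comp_hasDerivAt 0 h2
    have h4 : (fun t => u t (bar.symm x)) = fun t => bar.symm (bar (u t (bar.symm x))) := by
      funext t
      simp
    rw [h4]
    refine HasDerivAt.congr_deriv (f := fun t => bar.symm (bar (u t (bar.symm x)))) h3 ?_
    change bar.symm _ = _
    rw [map_smulₛₗ]
    simp

theorem dense_domain_conjPMap (bar : Z ≃ₗᵢ⋆[ℂ] Zc) {h : Z →ₗ.[ℂ] Z}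
    (hh : Dense (h.domain : Set Z)) : Dense ((-conjPMap bar h).domain : Set Zc) :=
  hh.preimage bar.symm.toHomeomorph.isOpenMap

end DirectSum

/-! ### The standard Liouvillean -/

section Liouvillean

variable {Z Zc : Type*} [NormedAddCommGroup Z] [InnerProductSpace ℂ Z] [CompleteSpace Z]
  [NormedAddCommGroup Zc] [InnerProductSpace ℂ Zc] [CompleteSpace Zc]
  {s : Statistics} {bar : Z ≃ₗᵢ⋆[ℂ] Zc}
  {W : HilbertSchmidt (FockSpace Z s) ≃ₗ[ℂ] FockSpace (Doubled Z Zc) s}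

theorem norm_vacuum : ‖vacuum Z s‖ = 1 := by
  have h : inner ℂ (vacuum Z s) (vacuum Z s) = 1 := by
    rw [vacuum, inner_symVec]
    simp [Finset.univ_unique, Statistics.char_one, Subsingleton.elim default (1 : Equiv.Perm (Fin 0))]
  rw [FockSpace.inner_self_eq'] at h
  have h2 : ‖vacuum Z s‖ ^ 2 = 1 := by exact_mod_cast h
  exact (pow_eq_one_iff_of_nonneg (norm_nonneg _) two_ne_zero).1 h2

/-- The commutant and center arguments need a unit vector; the vacuum provides one. -/
instance : Nontrivial (FockSpace Z s) :=
  ⟨vacuum Z s, 0, fun h => by simpa [h] using norm_vacuum (Z := Z) (s := s)⟩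

/-- B ↦ Γ(u)BΓ(u)* sends |z)(w| to |uz)(uw|, and Γ(u ⊕ ū) does the same to the corresponding pair
vectors. -/
theorem IsFockIdentification.leftMul_rightMul_eq (hW : IsFockIdentification s bar W)
    {u : Z →L[ℂ] Z} (hu : ∀ z w, inner ℂ (u z) (u w) = inner ℂ z w) :
    hW.isHSUnitary.leftMul (secondQuant s u) ∘L hW.isHSUnitary.rightMul (secondQuant s u) =
      secondQuant s (dblMap u (barConj bar u)) := by
  have hv : ∀ x y : Doubled Z Zc, inner ℂ (dblMap u (barConj bar u) x)
      (dblMap u (barConj bar u) y) = inner ℂ x y := fun x y => by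
    simp [dblMap_apply, WithLp.prod_inner_apply, hu, barConj_apply,
      LinearIsometryEquiv.inner_map_map']
  refine IsFockIdentification.clm_ext (bar := bar) fun n m z w => ?_
  rw [ContinuousLinearMap.comp_apply, ← hW.map_hsRankOne, hW.isHSUnitary.rightMul_hsRankOne,
    hW.isHSUnitary.leftMul_hsRankOne, secondQuant_symVec_of_inner hu,
    secondQuant_symVec_of_inner hu, hW.map_hsRankOne, hW.map_hsRankOne, pairVec, pairVec, map_smul,
    dblVec, dblVec, secondQuant_symVec_of_inner hv]
  congr 2
  funext i
  refine Fin.addCases (fun i => ?_) (fun i => ?_) i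
  · simp [dblMap_dblInl]
  · simp [dblMap_dblInr, barConj_apply]

/-- `dΓ(h ⊕ (-h̄))` is the standard Liouvillean of the dynamics generated by `dΓ(h)`. -/
theorem IsFockIdentification.isStandardLiouvillean (hW : IsFockIdentification s bar W)
    {h : Z →ₗ.[ℂ] Z} (hh : IsSelfAdjoint h) :
    IsStandardLiouvillean hW.isHSUnitary.leftRep (fockCone W) (fockDynamics s h)
      (dGamma s (dirSum h (-conjPMap bar h))) := by
  obtain ⟨u, hu⟩ := hh.exists_isUnitaryGroupOf
  have hd := hh.dense_domain
  have hU := hu.isUnitaryGroup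
  set hS := hW.isHSUnitary
  have hg := hu.dGamma (s := s) hd
  have hgd : Dense ((dGamma s h).domain : Set (FockSpace Z s)) := hu.dense_domain_dGamma hd
  have hG := (hu.dirSum (hu.barConj bar)).dGamma (s := s)
    (dense_domain_dirSum hd (dense_domain_conjPMap bar hd))
  have hGd : Dense ((dGamma s (dirSum h (-conjPMap bar h))).domain :
      Set (FockSpace (Doubled Z Zc) s)) := (hu.dirSum (hu.barConj bar)).dense_domain_dGamma
    (dense_domain_dirSum hd (dense_domain_conjPMap bar hd))
  have hexp := hg.expI_eq hgd
  have hExp := hG.expI_eq hGd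
  have hgU := hg.isUnitaryGroup
  have hGU := hG.isUnitaryGroup
  have hval : ∀ t Φ, (W.symm (secondQuant s (dblMap (u t) (barConj bar (u t))) Φ)).1 =
      secondQuant s (u t) ∘L ((W.symm Φ).1 ∘L (secondQuant s (u t)).adjoint) := fun t Φ => by
    rw [← hW.leftMul_rightMul_eq (hU.inner_map t), ContinuousLinearMap.comp_apply,
      hS.symm_leftMul, hS.symm_rightMul]
  have hcone : ∀ t, ∀ Φ ∈ fockCone W,
      secondQuant s (dblMap (u t) (barConj bar (u t))) Φ ∈ fockCone W := by
    rintro t _ ⟨B, hB, rfl⟩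
    refine ⟨_, ?_, W.apply_symm_apply _⟩
    rw [Set.mem_ofPred_eq, hval, W.symm_apply_apply]
    exact hB.conj_adjoint _
  have himpl : ImplementsDynamics hS.leftRep (fockCone W) (fockDynamics s h)
      (dGamma s (dirSum h (-conjPMap bar h))) := by
    refine ⟨hG.isSelfAdjoint hGd, fun t A => ?_, fun t => ?_⟩
    · rw [hExp, fockDynamics, hexp]
      refine ContinuousLinearMap.ext fun Φ => hS.ext_symm ?_
      rw [mul_apply_eq_comp, mul_apply_eq_comp, hval, hS.leftRep_apply, hS.leftRep_apply,
        hS.symm_leftMul, hS.symm_leftMul, hval, hgU.adjoint_eq, hgU.adjoint_eq, neg_neg]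
      ext x
      simp only [ContinuousLinearMap.comp_apply, mul_apply_eq_comp]
      rw [hgU.apply_neg]
    · rw [hExp]
      refine Set.Subset.antisymm (by rintro _ ⟨Φ, hΦ, rfl⟩; exact hcone t Φ hΦ) fun Φ hΦ => ?_
      exact ⟨_, hcone (-t) Φ hΦ, hGU.apply_neg t Φ⟩
  refine ⟨himpl, fun L' hL' => ?_⟩
  obtain ⟨v, hv⟩ := hL'.1.exists_isUnitaryGroupOf
  have hv' := hv.expI_eq hL'.1.dense_domain
  have hvU := hv.isUnitaryGroup
  obtain ⟨-, h1, h2⟩ := hL'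
  obtain ⟨-, h3, -⟩ := himpl
  rw [hv'] at h1 h2
  rw [hExp] at h3
  -- Two implementations differ by an isometry commuting with left multiplications and preserving
  -- the cone. It is therefore the identity.
  have hT : ∀ t, v (-t) * secondQuant s (dblMap (u t) (barConj bar (u t))) = 1 := by
    intro t
    refine hS.eq_one_of_commute (fun A => ?_) (fun Φ => ?_) fun Φ hΦ => ?_
    · have h4 := (h1 t A).symm.trans (h3 t A)
      have h5 := congrArg (fun X => v (-t) * X * secondQuant s (dblMap (u t) (barConj bar (u t)))) h4
      simp only [mul_assoc, hGU.neg_mul, mul_one] at h5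
      rw [← mul_assoc (v (-t)) (v t), hvU.neg_mul, one_mul] at h5
      rw [h5, mul_assoc]
    · rw [mul_apply_eq_comp, hvU.norm_map, hGU.norm_map]
    · rw [mul_apply_eq_comp]
      have h6 : v (-t) (secondQuant s (dblMap (u t) (barConj bar (u t))) Φ) ∈
        v (-t) '' fockCone W := ⟨_, hcone t Φ hΦ, rfl⟩
      rwa [h2] at h6
  have hvG : v = fun t => secondQuant s (dblMap (u t) (barConj bar (u t))) := by
    funext t
    rw [← mul_one (v t), ← hT t, ← mul_assoc, hvU.mul_neg, one_mul]
  rw [hvG] at hv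
  exact hv.generator_unique hG

end Liouvillean

/-! ### Eigenbases of positive trace class operators -/

section Diagonalization

universe u

variable {Z : Type u} [NormedAddCommGroup Z] [InnerProductSpace ℂ Z] [CompleteSpace Z]

/-- Rank one operators span a dense subspace in Hilbert–Schmidt norm. That norm dominates the
operator norm, in which the compact operators are closed. -/
theorem isCompactOperator_of_mem_HilbertSchmidt {A : Z →L[ℂ] Z} (hA : A ∈ HilbertSchmidt Z) :
    IsCompactOperator A := by
  have hW := isHSUnitary_hsToLp (H := Z)
  let D : Submodule ℂ (lp (fun _ : onbSet Z => Z) 2) :=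
    (compactOperator (RingHom.id ℂ) Z Z).comap
      ((HilbertSchmidt Z).subtype ∘ₗ (hsToLp Z).symm.toLinearMap)
  let F : lp (fun _ : onbSet Z => Z) 2 →L[ℂ] (Z →L[ℂ] Z) := LinearMap.mkContinuous
    ((HilbertSchmidt Z).subtype ∘ₗ (hsToLp Z).symm.toLinearMap) 1 fun Φ => by
      have := hW.opNorm_le ((hsToLp Z).symm Φ)
      rw [(hsToLp Z).apply_symm_apply] at this
      simpa using this
  have hcl : IsClosed (D : Set (lp (fun _ : onbSet Z => Z) 2)) :=
    isClosed_setOfPred_isCompactOperator.preimage F.continuous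
  have hle : Submodule.span ℂ {Φ | ∃ x ∈ (Set.univ : Set Z), ∃ y ∈ (Set.univ : Set Z),
      Φ = hsToLp Z (hsRankOne x y)} ≤ D := by
    rw [Submodule.span_le]
    rintro _ ⟨x, -, y, -, rfl⟩
    change IsCompactOperator ((hsToLp Z).symm (hsToLp Z (hsRankOne x y))).1
    rw [LinearEquiv.symm_apply_apply]
    have h1 : IsCompactOperator (id : ℂ → ℂ) :=
      (isCompactOperator_id_iff_finiteDimensional (𝕜 := ℂ)).2 inferInstance
    exact (h1.clm_comp (ContinuousLinearMap.toSpanSingleton ℂ x)).comp_clm (innerSL ℂ y)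
  have hD := ((hW.dense_span_hsRankOne (S := Set.univ) (by simp)).mono
    (SetLike.coe_subset_coe.2 hle)).closure_eq
  rw [hcl.closure_eq] at hD
  have : hsToLp Z ⟨A, hA⟩ ∈ (D : Set (lp (fun _ : onbSet Z => Z) 2)) := hD ▸ Set.mem_univ _
  change IsCompactOperator ((hsToLp Z).symm (hsToLp Z ⟨A, hA⟩)).1 at this
  rwa [LinearEquiv.symm_apply_apply] at this

variable {γ : Z →L[ℂ] Z} (hγ : γ.IsPositive)
include hγ

theorem ContinuousLinearMap.IsPositive.sqrt_mul_sqrt : CFC.sqrt γ * CFC.sqrt γ = γ :=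
  CFC.sqrt_mul_sqrt_self γ ((ContinuousLinearMap.nonneg_iff_isPositive γ).2 hγ)

omit hγ in
theorem isPositive_sqrt : (CFC.sqrt γ).IsPositive :=
  (ContinuousLinearMap.nonneg_iff_isPositive _).1 (CFC.sqrt_nonneg γ)

theorem ContinuousLinearMap.IsPositive.norm_sqrt_sq (x : Z) :
    ((‖CFC.sqrt γ x‖ ^ 2 : ℝ) : ℂ) = inner ℂ x (γ x) := by
  have h := isPositive_sqrt (γ := γ)
  conv_rhs => rw [← hγ.sqrt_mul_sqrt, mul_apply_eq_comp, ← h.isSelfAdjoint.adjoint_eq,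
    ContinuousLinearMap.adjoint_inner_right, h.isSelfAdjoint.adjoint_eq]
  rw [inner_self_eq_norm_sq_to_K]
  push_cast
  rfl

/-- For g > 0, y = γ^{1/2}x - √g x satisfies γ^{1/2}y = -√g y, impossible for a positive operator
unless y = 0. For g = 0 the norm of γ^{1/2}x is read off directly. -/
theorem ContinuousLinearMap.IsPositive.sqrt_apply_of_eigen {x : Z} {g : ℝ} (hg : 0 ≤ g)
    (hx : γ x = (g : ℂ) • x) : CFC.sqrt γ x = ((√g : ℝ) : ℂ) • x := by
  have hpos := isPositive_sqrt (γ := γ)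
  rcases hg.eq_or_lt with rfl | hg
  · have h := hγ.norm_sqrt_sq x
    rw [hx] at h
    simpa using h
  · set y := CFC.sqrt γ x - ((√g : ℝ) : ℂ) • x with hy
    have h1 : CFC.sqrt γ y + ((√g : ℝ) : ℂ) • y = 0 := by
      have h2 : CFC.sqrt γ (CFC.sqrt γ x) = (g : ℂ) • x := by
        rw [← mul_apply_eq_comp, hγ.sqrt_mul_sqrt, hx]
      have h3 : ((√g : ℝ) : ℂ) * ((√g : ℝ) : ℂ) = g := by
        rw [← Complex.ofReal_mul, Real.mul_self_sqrt hg.le]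
      rw [hy, map_sub, map_smul, h2, smul_sub, smul_smul, h3]
      abel
    have h2 : inner ℂ y (CFC.sqrt γ y) + ((√g : ℝ) : ℂ) * inner ℂ y y = 0 := by
      rw [← inner_smul_right, ← inner_add_right, h1, inner_zero_right]
    have h3 : 0 ≤ inner ℂ y (CFC.sqrt γ y) := hpos.inner_right_nonneg y
    have h4 := congrArg Complex.re h2
    rw [inner_self_eq_norm_sq_to_K, Complex.add_re] at h4
    have h5 : 0 ≤ (inner ℂ y (CFC.sqrt γ y)).re := (Complex.le_def.1 h3).1
    have h6 : (((√g : ℝ) : ℂ) * (‖y‖ : ℂ) ^ 2).re = √g * ‖y‖ ^ 2 := by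
      rw [← Complex.ofReal_pow, ← Complex.ofReal_mul, Complex.ofReal_re]
    have h7 : √g * ‖y‖ ^ 2 ≤ 0 := by
      have := h6.symm.trans_le (le_of_eq rfl)
      change _ + (((√g : ℝ) : ℂ) * (‖y‖ : ℂ) ^ 2).re = _ at h4
      rw [h6, Complex.zero_re] at h4
      linarith
    have h8 : ‖y‖ ^ 2 ≤ 0 := nonpos_of_mul_nonpos_right h7 (Real.sqrt_pos.2 hg)
    have h9 : y = 0 := by
      rw [← norm_eq_zero]
      exact pow_eq_zero_iff two_ne_zero |>.1 (le_antisymm h8 (by positivity))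
    rwa [hy, sub_eq_zero] at h9

theorem IsTraceClass.sqrt_mem_HilbertSchmidt (hγ_trace : IsTraceClass γ) :
    CFC.sqrt γ ∈ HilbertSchmidt Z := by
  rw [IsTraceClass, CFC.abs_of_nonneg γ ((ContinuousLinearMap.nonneg_iff_isPositive γ).2 hγ)]
    at hγ_trace
  refine memℓp_gen ?_
  simp only [← hγ.norm_sqrt_sq] at hγ_trace
  simpa using Complex.summable_ofReal.1 hγ_trace

/-- A positive trace class operator has an orthonormal basis of eigenvectors. -/
theorem IsTraceClass.exists_eigenbasis (hγ_trace : IsTraceClass γ) :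
    ∃ (ι : Type u) (f : HilbertBasis ι ℂ Z) (g : ι → ℝ), (∀ j, 0 ≤ g j) ∧ Summable g ∧
      ∀ j, γ (f j) = (g j : ℂ) • f j := by
  have hs := IsTraceClass.sqrt_mem_HilbertSchmidt hγ hγ_trace
  have hcomp : IsCompactOperator γ := by
    have h := (isCompactOperator_of_mem_HilbertSchmidt hs).comp_clm (CFC.sqrt γ)
    rwa [← ContinuousLinearMap.coe_comp, ← ContinuousLinearMap.mul_def, hγ.sqrt_mul_sqrt] at h
  have hsymm := hγ.isSelfAdjoint.isSymmetric
  have hbot := ContinuousLinearMap.orthogonalComplement_iSup_eigenspaces_eq_bot hcomp hsymm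
  let E : ℂ → Submodule ℂ Z := fun μ => Module.End.eigenspace (γ : Module.End ℂ Z) μ
  have hE : ∀ μ, IsClosed (E μ : Set Z) := fun μ => by
    have : (E μ : Set Z) = {x | γ x = μ • x} := by
      ext x
      simp [E]
    rw [this]
    exact isClosed_eq γ.continuous (continuous_const_smul μ)
  have hc : ∀ μ, CompleteSpace (E μ) := fun μ => (hE μ).completeSpace_coe
  let v : (Σ μ, onbSet (E μ)) → Z := fun p => (onb (E p.1) p.2 : Z)
  have hv : Orthonormal ℂ v :=
    (hsymm.orthogonalFamily_eigenspaces).orthonormal_sigma_orthonormal fun μ => (onb (E μ)).orthonormal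
  have hv' : (Submodule.span ℂ (Set.range v))ᗮ = ⊥ := by
    rw [← Submodule.orthogonal_closure, eq_bot_iff, ← hbot]
    refine Submodule.orthogonal_le (iSup_le fun μ x hx => ?_)
    have h1 := ((onb (E μ)).hasSum_repr ⟨x, hx⟩).mapL (E μ).subtypeL
    refine (Submodule.isClosed_topologicalClosure _).mem_of_tendsto h1
      (Filter.Eventually.of_forall fun F => Submodule.sum_mem _ fun i _ => ?_)
    rw [map_smul]
    exact Submodule.smul_mem _ _ (Submodule.le_topologicalClosure _
      (Submodule.subset_span ⟨⟨μ, i⟩, rfl⟩))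
  have heig : ∀ p, γ (v p) = p.1 • v p := fun p =>
    Module.End.mem_eigenspace_iff.1 (onb (E p.1) p.2).2
  have hnorm : ∀ p, ((‖CFC.sqrt γ (v p)‖ ^ 2 : ℝ) : ℂ) = p.1 := fun p => by
    rw [hγ.norm_sqrt_sq, heig, inner_smul_right, inner_self_eq_norm_sq_to_K, hv.1]
    simp
  let f := HilbertBasis.mkOfOrthogonalEqBot hv hv'
  have hf : ∀ p, f p = v p := fun p => by rw [HilbertBasis.coe_mkOfOrthogonalEqBot]
  -- Writing the eigenvalue as ‖γ^{1/2}v‖² makes it real and nonnegative. Its summability is the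
  -- Hilbert–Schmidt property of γ^{1/2}, which does not depend on the basis.
  refine ⟨(Σ μ, onbSet (E μ)), f, fun p => ‖CFC.sqrt γ (v p)‖ ^ 2, fun p => by positivity, ?_, fun p => ?_⟩
  · simp only [← hf]
    exact summable_sq_of_tsum_enorm_ne_top ((mem_HilbertSchmidt_iff f).1 hs)
  · rw [hf, hnorm, heig]

end Diagonalization

/-! ### The Fredholm determinant as a product over eigenvalues -/

section Fredholm

variable {Z : Type*} [NormedAddCommGroup Z] [InnerProductSpace ℂ Z] [CompleteSpace Z]

theorem Matrix.IsHermitian.det_one_add_smul {n : Type*} [Fintype n] [DecidableEq n]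
    {A : Matrix n n ℂ} (hA : A.IsHermitian) (c : ℂ) :
    (1 + c • A).det = ∏ i, (1 + c * hA.eigenvalues i) := by
  have h1 : 1 + c • A = Unitary.conjStarAlgAut ℂ _ hA.eigenvectorUnitary
      (Matrix.diagonal fun i => 1 + c * (hA.eigenvalues i : ℂ)) := by
    conv_lhs => rw [hA.spectral_theorem]
    rw [← map_one (Unitary.conjStarAlgAut ℂ (Matrix n n ℂ) hA.eigenvectorUnitary), ← map_smul,
      ← map_add, ← Matrix.diagonal_one, ← Matrix.diagonal_smul, Matrix.diagonal_add]
    rfl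
  rw [h1, Unitary.conjStarAlgAut_apply, Matrix.det_mul_right_comm,
    Unitary.mul_star_self_of_mem hA.eigenvectorUnitary.2, one_mul, Matrix.det_diagonal]

/-- With eigenvalues λᵢ ≥ 0, |∏(1 + cλᵢ) - 1| ≤ exp(∑λᵢ) - 1 and the exponent is the trace. -/
theorem Matrix.PosSemidef.norm_det_one_add_smul_sub_one_le {n : Type*} [Fintype n] [DecidableEq n]
    {A : Matrix n n ℂ} (hA : A.PosSemidef) {c : ℂ} (hc : ‖c‖ = 1) :
    ‖(1 + c • A).det - 1‖ ≤ Real.exp A.trace.re - 1 := by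
  rw [hA.1.det_one_add_smul]
  refine (Finset.norm_prod_one_add_sub_one_le _ _).trans (le_of_eq ?_)
  congr 2
  rw [hA.1.trace_eq_sum_eigenvalues, Complex.re_sum]
  refine Finset.sum_congr rfl fun i _ => ?_
  rw [norm_mul, hc, one_mul]
  exact (Complex.norm_real _).trans (abs_of_nonneg (hA.eigenvalues_nonneg i))

/-- Expand ‖γ^{1/2}xᵢ‖² = ∑ⱼ gⱼ|(xᵢ|fⱼ)|². Indices in F contribute nothing, and Bessel's inequality
bounds the weight of each other gⱼ by 1. -/
theorem sum_norm_sqrt_sq_le {ι : Type*} (f : HilbertBasis ι ℂ Z) {g : ι → ℝ}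
    (hg : ∀ j, 0 ≤ g j) (hsum : Summable g) {γ : Z →L[ℂ] Z} (hγf : ∀ j, γ (f j) = (g j : ℂ) • f j)
    (hγ : γ.IsPositive) (F : Finset ι) {κ : Type*} [Fintype κ] {x : κ → Z} (hx : Orthonormal ℂ x)
    (hF : ∀ j ∈ F, ∀ i, inner ℂ (x i) (f j) = 0) :
    ∑ i, ‖CFC.sqrt γ (x i)‖ ^ 2 ≤ ∑' j : {j // j ∉ F}, g j := by
  have h1 : ∀ i, HasSum (fun j => g j * ‖inner ℂ (x i) (f j)‖ ^ 2) (‖CFC.sqrt γ (x i)‖ ^ 2) := by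
    intro i
    rw [← Complex.hasSum_ofReal, hγ.norm_sqrt_sq]
    have h := f.hasSum_inner_mul_inner (x i) (γ (x i))
    refine h.congr_fun fun j => ?_
    have h2 : inner ℂ (f j) (γ (x i)) = g j * inner ℂ (f j) (x i) := by
      rw [← hγ.isSelfAdjoint.adjoint_eq, ContinuousLinearMap.adjoint_inner_right, hγf,
        inner_smul_left, Complex.conj_ofReal]
    rw [h2, ← inner_conj_symm (f j), mul_left_comm, Complex.mul_conj']
    push_cast
    rfl
  have h2 := hasSum_sum fun i (_ : i ∈ Finset.univ) => h1 i
  have h3 : ∑' j : {j // j ∉ F}, g j = ∑' j, {j | j ∉ F}.indicator g j := tsum_subtype _ _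
  rw [← h2.tsum_eq, h3]
  refine Summable.tsum_le_tsum (fun j => ?_) h2.summable (hsum.indicator _)
  rw [← Finset.mul_sum]
  by_cases hj : j ∈ F
  · rw [Set.indicator_of_notMem (by simpa using hj), Finset.sum_eq_zero fun i _ => ?_, mul_zero]
    rw [hF j hj, norm_zero, zero_pow two_ne_zero]
  · rw [Set.indicator_of_mem (by simpa using hj)]
    refine mul_le_of_le_one_right (hg j) ((hx.sum_inner_products_le (f j)).trans_eq ?_)
    rw [f.orthonormal.1, one_pow]

/-- Compressions of `1 + c γ` to finite dimensional spaces containing eigenvectors of `γ`. -/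
theorem norm_det_compression_sub_prod_le {ι : Type*} (f : HilbertBasis ι ℂ Z) {g : ι → ℝ}
    (hg : ∀ j, 0 ≤ g j) (hsum : Summable g) {γ : Z →L[ℂ] Z} (hγf : ∀ j, γ (f j) = (g j : ℂ) • f j)
    (hγ : γ.IsPositive) {c : ℂ} (hc : ‖c‖ = 1) (F : Finset ι) (S : Submodule ℂ Z)
    [FiniteDimensional ℂ S] (hS : ∀ j ∈ F, f j ∈ S) :
    ‖LinearMap.det (S.orthogonalProjectionOnto ∘L (1 + c • γ) ∘L S.subtypeL :
        S →L[ℂ] S).toLinearMap - ∏ j ∈ F, (1 + c * g j)‖ ≤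
      Real.exp (∑ j ∈ F, g j) * (Real.exp (∑' j : {j // j ∉ F}, g j) - 1) := by
  classical
  -- The eigenvectors indexed by F are completed to an orthonormal basis u of S.
  let v : Set S := {x | ∃ j ∈ F, (x : Z) = f j}
  have hv : Orthonormal ℂ ((↑) : v → S) := by
    rw [orthonormal_subtype_iff_ite]
    rintro x ⟨j, -, hx⟩ y ⟨k, -, hy⟩
    rw [Submodule.coe_inner, hx, hy, orthonormal_iff_ite.1 f.orthonormal]
    congr 1
    rw [← Subtype.coe_inj (a := x), hx, hy, f.orthonormal.linearIndependent.injective.eq_iff]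
  obtain ⟨u, b, hvu, hb⟩ := hv.exists_orthonormalBasis_extension
  have hbo : ∀ i j : u, inner ℂ (i.1 : Z) (j.1 : Z) = if i = j then 1 else 0 := fun i j => by
    have := orthonormal_iff_ite.1 b.orthonormal i j
    rwa [hb] at this
  let C : Matrix u u ℂ := fun i j => inner ℂ (i.1 : Z) (γ j.1)
  rw [← LinearMap.det_toMatrix b.toBasis]
  set M := LinearMap.toMatrix b.toBasis b.toBasis (S.orthogonalProjectionOnto ∘L (1 + c • γ) ∘L
    S.subtypeL : S →L[ℂ] S).toLinearMap with hM
  have hMC : M = 1 + c • C := by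
    ext i j
    rw [hM, LinearMap.toMatrix_apply, OrthonormalBasis.coe_toBasis_repr_apply,
      OrthonormalBasis.repr_apply_apply, OrthonormalBasis.coe_toBasis, hb]
    refine (Submodule.inner_orthogonalProjectionOnto_eq_of_mem_left i.1 _).trans ?_
    change inner ℂ (i.1 : Z) ((1 + c • γ) j.1) = _
    rw [add_apply, inner_add_right, smul_apply,
      inner_smul_right, Matrix.add_apply, Matrix.smul_apply, Matrix.one_apply, ← hbo]
    rfl
  -- Columns belonging to eigenvectors are diagonal, so the compression is block triangular and its
  -- determinant factors.
  have hp : ∀ i j : u, (j : S) ∈ v → C i j = C j j * if i = j then 1 else 0 := by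
    rintro i j ⟨k, -, hk⟩
    simp only [C]
    rw [hk, hγf, inner_smul_right, inner_smul_right, ← hk, hbo, hbo, if_pos rfl, mul_one]
  rw [Matrix.twoBlockTriangular_det M (fun i : u => (i : S) ∈ v) fun i hi j hj => ?_]
  swap
  · have hij : i ≠ j := fun h => hi (h ▸ hj)
    rw [hMC, Matrix.add_apply, Matrix.one_apply_ne hij, Matrix.smul_apply, hp i j hj, if_neg hij]
    simp
  have h1 : (M.toSquareBlockProp fun i : u => (i : S) ∈ v).det = ∏ j ∈ F, (1 + c * g j) := by
    have : M.toSquareBlockProp (fun i : u => (i : S) ∈ v) =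
        Matrix.diagonal fun i => 1 + c * C i.1 i.1 := by
      ext i j
      rw [Matrix.toSquareBlockProp_def, Matrix.of_apply, hMC, Matrix.add_apply, Matrix.smul_apply,
        hp _ _ j.2, Matrix.diagonal_apply, Matrix.one_apply]
      by_cases hij : i = j
      · simp [hij]
      · simp [hij, Subtype.coe_inj]
    rw [this, Matrix.det_diagonal]
    symm
    have hmem : ∀ j (hj : j ∈ F), (⟨f j, hS j hj⟩ : S) ∈ v := fun j hj => ⟨j, hj, rfl⟩
    refine Finset.prod_bij (fun j hj => ⟨⟨⟨f j, hS j hj⟩, hvu (hmem j hj)⟩, hmem j hj⟩)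
      (fun _ _ => Finset.mem_univ _) (fun j _ k _ h => ?_) (fun i _ => ?_) fun j hj => ?_
    · simp only [Subtype.mk.injEq] at h
      exact f.orthonormal.linearIndependent.injective h
    · obtain ⟨j, hj, h⟩ := i.2
      exact ⟨j, hj, Subtype.ext (Subtype.ext (Subtype.ext h.symm))⟩
    · simp only [C]
      rw [hγf, inner_smul_right, inner_self_eq_norm_sq_to_K, f.orthonormal.1]
      simp
  -- The complementary block is 1 + c times a Gram matrix of vectors γ^{1/2}xᵢ with xᵢ orthogonal to
  -- the eigenvectors. Its trace is at most the tail of ∑gⱼ.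
  have h2 : ‖(M.toSquareBlockProp fun i : u => ¬ (i : S) ∈ v).det - 1‖ ≤
      Real.exp (∑' j : {j // j ∉ F}, g j) - 1 := by
    have hps : (Matrix.gram ℂ fun i : {i : u // ¬ (i : S) ∈ v} =>
      CFC.sqrt γ (i.1.1 : Z)).PosSemidef := gram_posSemidef _
    have hMg : M.toSquareBlockProp (fun i : u => ¬ (i : S) ∈ v) = 1 + c •
        Matrix.gram ℂ fun i : {i : u // ¬ (i : S) ∈ v} => CFC.sqrt γ (i.1.1 : Z) := by
      ext i j
      rw [Matrix.toSquareBlockProp_def, Matrix.of_apply, hMC, Matrix.add_apply, Matrix.smul_apply,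
        Matrix.add_apply, Matrix.smul_apply, Matrix.gram_apply, Matrix.one_apply, Matrix.one_apply]
      have h3 := isPositive_sqrt (γ := γ)
      simp only [C, Subtype.coe_inj]
      conv_lhs => rw [← hγ.sqrt_mul_sqrt, mul_apply_eq_comp, ← h3.isSelfAdjoint.adjoint_eq,
        ContinuousLinearMap.adjoint_inner_right, h3.isSelfAdjoint.adjoint_eq]
    rw [hMg]
    refine (hps.norm_det_one_add_smul_sub_one_le hc).trans (sub_le_sub_right
      (Real.exp_le_exp.2 ?_) _)
    rw [Matrix.trace, Complex.re_sum]
    refine (Finset.sum_congr rfl fun i _ => ?_).trans_le (sum_norm_sqrt_sq_le f hg hsum hγf hγ F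
      (x := fun i : {i : u // ¬ (i : S) ∈ v} => (i.1.1 : Z)) ?_ fun j hj i => ?_)
    · rw [Matrix.diag_apply, Matrix.gram_apply, inner_self_eq_norm_sq_to_K]
      norm_cast
    · rw [orthonormal_iff_ite]
      intro i j
      simp [hbo, Subtype.coe_inj]
    · have hm : (⟨f j, hS j hj⟩ : S) ∈ v := ⟨j, hj, rfl⟩
      have := hbo i.1 ⟨_, hvu hm⟩
      rw [if_neg] at this
      · exact this
      · intro h
        exact i.2 (h ▸ hm)
  rw [h1, ← mul_sub_one, norm_mul]
  refine mul_le_mul ?_ h2 (norm_nonneg _) (Real.exp_nonneg _)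
  rw [norm_prod, Real.exp_sum]
  refine Finset.prod_le_prod (fun _ _ => norm_nonneg _) fun j _ => (norm_add_le _ _).trans ?_
  rw [norm_mul, hc, one_mul, Complex.norm_real, Real.norm_of_nonneg (hg j), norm_one, add_comm]
  exact Real.add_one_le_exp _

/-- The error between a compression and a partial product is bounded uniformly over all S containing
the eigenvectors of F, and the bound tends to 0 as F grows. -/
theorem hasProd_fredholmDet {ι : Type*} (f : HilbertBasis ι ℂ Z) {g : ι → ℝ}
    (hg : ∀ j, 0 ≤ g j) (hsum : Summable g) {γ : Z →L[ℂ] Z} (hγf : ∀ j, γ (f j) = (g j : ℂ) • f j)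
    (hγ : γ.IsPositive) {c : ℂ} (hc : ‖c‖ = 1) :
    HasProd (fun j => 1 + c * (g j : ℂ)) (fredholmDet (1 + c • γ)) := by
  have hmul : Multipliable fun j => 1 + c * (g j : ℂ) :=
    multipliable_one_add_of_summable (by simpa [hc, abs_of_nonneg (hg _)] using hsum)
  obtain ⟨D, hD⟩ := hmul
  suffices h : fredholmDet (1 + c • γ) = D by rwa [h]
  let P := {S : Submodule ℂ Z // FiniteDimensional ℂ S}
  have hsup : ∀ S T : P, ∃ R : P, S ≤ R ∧ T ≤ R := fun S T =>
    haveI := S.2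
    haveI := T.2
    ⟨⟨S.1 ⊔ T.1, inferInstance⟩, le_sup_left (a := S.1), le_sup_right (a := S.1)⟩
  haveI : Nonempty P := ⟨⟨⊥, inferInstance⟩⟩
  haveI : IsDirectedOrder P := ⟨hsup⟩
  refine Filter.Tendsto.limUnder_eq (Metric.tendsto_nhds.2 fun ε hε => ?_)
  have hlim : Filter.Tendsto (fun F : Finset ι => Real.exp (∑ j ∈ F, g j) *
      (Real.exp (∑' j : {j // j ∉ F}, g j) - 1)) Filter.atTop (nhds 0) := by
    have h1 := (Real.continuous_exp.tendsto _).comp hsum.hasSum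
    have h2 := (Real.continuous_exp.tendsto _).comp (tendsto_tsum_compl_atTop_zero g)
    simpa using h1.mul (h2.sub_const 1)
  obtain ⟨F, hF1, hF2⟩ := ((hlim.eventually (gt_mem_nhds (half_pos hε))).and
    (Metric.tendsto_nhds.1 hD _ (half_pos hε))).exists
  -- F is chosen first; the net is then within ε of the infinite product at every S above this span.
  let S₀ : P := ⟨Submodule.span ℂ (f '' F), FiniteDimensional.span_of_finite ℂ
    (F.finite_toSet.image f)⟩
  filter_upwards [Filter.eventually_ge_atTop S₀] with S hS
  haveI := S.2
  have h1 := norm_det_compression_sub_prod_le f hg hsum hγf hγ hc F S.1 fun j hj =>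
    hS (Submodule.subset_span ⟨j, hj, rfl⟩)
  refine (dist_triangle _ (∏ j ∈ F, (1 + c * g j)) _).trans_lt ?_
  rw [dist_eq_norm]
  linarith

end Fredholm

/-! ### Tr Γ(γ) over finitely many modes -/

section Combinatorics

/-- Words are grouped by the set S of positions of the new letter j. Invariance of φ under
reordering moves those letters to the front. -/
theorem sum_piFinset_insert {ι M : Type*} [DecidableEq ι] [AddCommMonoid M]
    {φ : (n : ℕ) → (Fin n → ι) → M}
    (hφ : ∀ m n (e : Fin m ≃ Fin n) (l : Fin n → ι), φ m (l ∘ e) = φ n l)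
    {F : Finset ι} {j : ι} (hj : j ∉ F) (k : ℕ) :
    ∑ l ∈ Fintype.piFinset (fun _ : Fin k => insert j F), φ k l =
      ∑ S : Finset (Fin k), ∑ l ∈ Fintype.piFinset (fun _ : Fin Sᶜ.card => F),
        φ (S.card + Sᶜ.card) (Fin.append (fun _ => j) l) := by
  rw [← Finset.sum_fiberwise _ (fun l : Fin k → ι => Finset.univ.filter fun i => l i = j)]
  refine Finset.sum_congr rfl fun S _ => ?_
  let e : Fin (S.card + Sᶜ.card) ≃ Fin k :=
    finSumFinEquiv.symm.trans (finSumEquivOfFinset rfl rfl)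
  have he1 : ∀ i, e (Fin.castAdd _ i) = S.orderEmbOfFin rfl i := fun i => by simp [e]
  have he2 : ∀ i, e (Fin.natAdd _ i) = Sᶜ.orderEmbOfFin rfl i := fun i => by
    rw [← finSumFinEquiv_apply_right]
    simp only [e, Equiv.trans_apply, Equiv.symm_apply_apply, finSumEquivOfFinset_inr]
  have happ : ∀ l : Fin k → ι, (∀ i, l i = j ↔ i ∈ S) →
      l ∘ e = Fin.append (fun _ => j) fun i => l (Sᶜ.orderEmbOfFin rfl i) := by
    intro l hl
    funext i
    refine Fin.addCases (fun i => ?_) (fun i => ?_) i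
    · rw [Function.comp_apply, he1, Fin.append_left, hl]
      exact Finset.orderEmbOfFin_mem _ _ _
    · rw [Function.comp_apply, he2, Fin.append_right]
  have hfil : ∀ l : Fin k → ι, (Finset.univ.filter fun i => l i = j) = S ↔
      ∀ i, l i = j ↔ i ∈ S := fun l => by simp [Finset.ext_iff]
  refine Finset.sum_nbij' (fun l i => l (Sᶜ.orderEmbOfFin rfl i))
    (fun l => Fin.append (fun _ => j) l ∘ e.symm) ?_ ?_ ?_ ?_ ?_
  · intro l hl
    rw [Finset.mem_filter, hfil, Fintype.mem_piFinset] at hl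
    refine Fintype.mem_piFinset.2 fun i => ?_
    refine (Finset.mem_insert.1 (hl.1 _)).resolve_left fun h => ?_
    exact Finset.mem_compl.1 (Finset.orderEmbOfFin_mem Sᶜ rfl i) ((hl.2 _).1 h)
  · intro l hl
    rw [Fintype.mem_piFinset] at hl
    rw [Finset.mem_filter, hfil, Fintype.mem_piFinset]
    constructor
    · intro i
      rw [Function.comp_apply]
      refine Fin.addCases (fun i => ?_) (fun i => ?_) (e.symm i)
      · simp
      · simp [hl i]
    · intro i
      obtain ⟨i, rfl⟩ := e.surjective i
      rw [Function.comp_apply, Equiv.symm_apply_apply]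
      refine Fin.addCases (fun i => ?_) (fun i => ?_) i
      · rw [he1, Fin.append_left]
        simp
      · rw [he2, Fin.append_right]
        have h1 := Finset.mem_compl.1 (Finset.orderEmbOfFin_mem Sᶜ rfl i)
        exact ⟨fun h => absurd (h ▸ hl i) hj, fun h => absurd h h1⟩
  · intro l hl
    rw [Finset.mem_filter, hfil] at hl
    change Fin.append (fun _ => j) (fun i => l (Sᶜ.orderEmbOfFin rfl i)) ∘ e.symm = l
    rw [← happ l hl.2]
    funext i
    simp
  · intro l hl
    funext i
    rw [Function.comp_apply, ← he2, Equiv.symm_apply_apply, Fin.append_right]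
  · intro l hl
    rw [Finset.mem_filter, hfil] at hl
    rw [← happ l hl.2, hφ]

variable {Z : Type*} [NormedAddCommGroup Z] [InnerProductSpace ℂ Z]

theorem norm_symVec_append_sq (s : Statistics) {n m : ℕ} (a : Fin n → Z) (b : Fin m → Z)
    (h : ∀ i j, inner ℂ (a i) (b j) = 0) :
    ‖symVec s (Fin.append a b)‖ ^ 2 = ((n.factorial * m.factorial : ℝ) / (n + m).factorial) *
      (‖symVec s a‖ ^ 2 * ‖symVec s b‖ ^ 2) := by
  have h1 := inner_symVec_append s a a b b h
  simp only [FockSpace.inner_self_eq'] at h1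
  apply Complex.ofReal_injective
  push_cast
  exact h1

theorem norm_symVec_comp_equiv (s : Statistics) {n m : ℕ} (z : Fin n → Z) (e : Fin m ≃ Fin n) :
    ‖symVec s (z ∘ e)‖ ^ 2 = ‖symVec s z‖ ^ 2 := by
  obtain rfl : m = n := by simpa using Fintype.card_congr e
  have h1 : inner ℂ (symVec s (z ∘ e)) (symVec s (z ∘ e)) = inner ℂ (symVec s z) (symVec s z) := by
    rw [symVec_comp_perm, FockSpace.inner_smul_left', FockSpace.inner_smul_right', s.conj_char,
      ← mul_assoc, s.char_mul_self, one_mul]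
  simp only [FockSpace.inner_self_eq'] at h1
  exact_mod_cast h1

/-- `‖z ⊗ ⋯ ⊗ z‖²` for a unit vector `z`. -/
def Statistics.occupation : Statistics → ℕ → ℝ
  | bose, _ => 1
  | fermi, m => if m ≤ 1 then 1 else 0

/-- For fermions with at least two equal factors, swapping the first two changes the sign of the
vector without changing it, so it vanishes. -/
theorem norm_symVec_const (s : Statistics) {z : Z} (hz : ‖z‖ = 1) (m : ℕ) :
    ‖symVec s (fun _ : Fin m => z)‖ ^ 2 = s.occupation m := by
  have h1 : ((‖symVec s (fun _ : Fin m => z)‖ ^ 2 : ℝ) : ℂ) =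
      (m.factorial : ℂ)⁻¹ * ∑ σ : Equiv.Perm (Fin m), s.char σ := by
    push_cast
    rw [← FockSpace.inner_self_eq', inner_symVec]
    simp [inner_self_eq_norm_sq_to_K, hz]
  have hm : (m.factorial : ℂ) ≠ 0 := by exact_mod_cast m.factorial_ne_zero
  cases s with
  | bose =>
    simp only [Statistics.char, Finset.sum_const, Finset.card_univ, Fintype.card_perm,
      Fintype.card_fin, nsmul_eq_mul, mul_one, inv_mul_cancel₀ hm] at h1
    exact_mod_cast h1
  | fermi =>
    rw [Statistics.occupation]
    split_ifs with h
    · have : Subsingleton (Fin m) := by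
        rw [Fin.subsingleton_iff_le_one]
        exact h
      have h2 : ∀ σ : Equiv.Perm (Fin m), Statistics.fermi.char σ = 1 := fun σ => by
        rw [Subsingleton.elim σ 1, Statistics.char_one]
      simp only [h2, Finset.sum_const, Finset.card_univ, Fintype.card_perm,
        Fintype.card_fin, nsmul_eq_mul, mul_one, inv_mul_cancel₀ hm] at h1
      exact_mod_cast h1
    · obtain ⟨k, rfl⟩ : ∃ k, m = k + 2 := ⟨m - 2, by omega⟩
      have h2 := symVec_comp_perm Statistics.fermi (fun _ : Fin (k + 2) => z) (Equiv.swap 0 1)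
      have h3 : Statistics.fermi.char (Equiv.swap (0 : Fin (k + 2)) 1) = -1 := by
        simp [Statistics.char]
      rw [h3, neg_one_smul] at h2
      have h4 := congrArg (inner ℂ (symVec Statistics.fermi (fun _ : Fin (k + 2) => z))) h2
      rw [inner_neg_right, FockSpace.inner_self_eq'] at h4
      have h5 := h4
      change inner ℂ (symVec Statistics.fermi fun _ : Fin (k + 2) => z)
        (symVec Statistics.fermi fun _ : Fin (k + 2) => z) = _ at h5
      rw [FockSpace.inner_self_eq'] at h5
      have h6 : ‖symVec Statistics.fermi (fun _ : Fin (k + 2) => z)‖ ^ 2 =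
        -‖symVec Statistics.fermi (fun _ : Fin (k + 2) => z)‖ ^ 2 := by exact_mod_cast h5
      linarith

/-- The trace of `Γ(γ)` on the `k`-particle vectors over the eigenvectors with index in `F`. -/
def sectorTrace {ι : Type*} (s : Statistics) (f : ι → Z) (g : ι → ℝ) (F : Finset ι) (k : ℕ) : ℝ :=
  ∑ l ∈ Fintype.piFinset (fun _ : Fin k => F), (∏ i, g (l i)) * ‖symVec s (f ∘ l)‖ ^ 2

variable {ι : Type*} {f : ι → Z} {g : ι → ℝ}

theorem sectorTrace_nonneg (s : Statistics) (f : ι → Z) (hg : ∀ j, 0 ≤ g j) (F : Finset ι) (k : ℕ) :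
    0 ≤ sectorTrace s f g F k :=
  Finset.sum_nonneg fun l _ => mul_nonneg (Finset.prod_nonneg fun i _ => hg _) (by positivity)

/-- There are binomially many sets S of size m, and each carries the block weight m!(k-m)!/k!. The
two cancel and leave a convolution over the occupation number m of the new mode. -/
theorem sectorTrace_insert [DecidableEq ι] (s : Statistics) (hf : Orthonormal ℂ f) {F : Finset ι}
    {j : ι} (hj : j ∉ F) (k : ℕ) : sectorTrace s f g (insert j F) k =
      ∑ p ∈ Finset.HasAntidiagonal.antidiagonal k, s.occupation p.1 * g j ^ p.1 * sectorTrace s f g F p.2 := by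
  rw [sectorTrace, sum_piFinset_insert
    (φ := fun n (l : Fin n → ι) => (∏ i, g (l i)) * ‖symVec s (f ∘ l)‖ ^ 2) ?_ hj]
  · have h1 : ∀ (m n : ℕ), ∑ l ∈ Fintype.piFinset (fun _ : Fin n => F),
        (∏ i, g ((Fin.append (fun _ : Fin m => j) l : Fin (m + n) → ι) i)) *
          ‖symVec s (f ∘ (Fin.append (fun _ : Fin m => j) l : Fin (m + n) → ι))‖ ^ 2 =
        ((m.factorial * n.factorial : ℝ) / (m + n).factorial) *
          (s.occupation m * g j ^ m * sectorTrace s f g F n) := by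
      intro m n
      rw [sectorTrace, Finset.mul_sum, Finset.mul_sum]
      refine Finset.sum_congr rfl fun l hl => ?_
      rw [Fintype.mem_piFinset] at hl
      have h2 : f ∘ (Fin.append (fun _ : Fin m => j) l : Fin (m + n) → ι) =
          Fin.append (fun _ => f j) (f ∘ l) := by
        funext i
        refine Fin.addCases (fun i => ?_) (fun i => ?_) i <;> simp
      rw [h2, norm_symVec_append_sq, norm_symVec_const s (hf.1 j), Fin.prod_univ_add]
      · simp only [Fin.append_left, Fin.append_right, Finset.prod_const, Finset.card_univ,
          Fintype.card_fin]
        ring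
      · intro _ i
        exact hf.2 fun h => hj (h ▸ hl i)
    have h2 : ∀ S : Finset (Fin k), Sᶜ.card = k - S.card := fun S => by
      rw [Finset.card_compl, Fintype.card_fin]
    simp only [h1, h2]
    rw [← Finset.powerset_univ, Finset.sum_powerset_apply_card (fun m =>
      ((m.factorial * (k - m).factorial : ℝ) / (m + (k - m)).factorial) *
          (s.occupation m * g j ^ m * sectorTrace s f g F (k - m))), Finset.card_univ,
      Fintype.card_fin, Finset.Nat.sum_antidiagonal_eq_sum_range_succ
        (fun m n => s.occupation m * g j ^ m * sectorTrace s f g F n)]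
    refine Finset.sum_congr rfl fun m hm => ?_
    have hmk : m ≤ k := by simpa [Nat.lt_succ_iff] using hm
    have h3 := Nat.choose_mul_factorial_mul_factorial hmk
    have h4 : ((k.choose m : ℝ) * m.factorial * (k - m).factorial) = k.factorial := by
      exact_mod_cast h3
    have h5 : (k.factorial : ℝ) ≠ 0 := by exact_mod_cast k.factorial_ne_zero
    rw [Nat.add_sub_cancel' hmk, nsmul_eq_mul, ← mul_assoc, mul_div_assoc',
      ← mul_assoc (k.choose m : ℝ), h4,
      div_self h5, one_mul]
  · intro m n e l
    rw [← Function.comp_assoc, norm_symVec_comp_equiv]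
    congr 1
    exact Equiv.prod_comp e fun i => g (l i)

/-- Summing the convolution over k gives a product, one factor per mode. In [0,∞] no convergence is
needed; it is a geometric series for bosons and two terms for fermions. -/
theorem tsum_sectorTrace (s : Statistics) (hf : Orthonormal ℂ f) (hg : ∀ j, 0 ≤ g j)
    (F : Finset ι) : ∑' k, ENNReal.ofReal (sectorTrace s f g F k) =
      ∏ j ∈ F, ∑' m, ENNReal.ofReal (s.occupation m * g j ^ m) := by
  classical
  have hocc : ∀ m, 0 ≤ s.occupation m := fun m => by
    cases s
    · exact zero_le_one
    · rw [Statistics.occupation]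
      split_ifs <;> norm_num
  induction F using Finset.induction_on with
  | empty =>
    rw [Finset.prod_empty, tsum_eq_single 0]
    · have h1 : ‖symVec s (f ∘ (default : Fin 0 → ι))‖ ^ 2 = 1 := by
        have h2 := inner_symVec s (f ∘ (default : Fin 0 → ι)) (f ∘ (default : Fin 0 → ι))
        rw [FockSpace.inner_self_eq'] at h2
        rw [Finset.univ_unique, Finset.sum_singleton,
          Subsingleton.elim default (1 : Equiv.Perm (Fin 0)), Statistics.char_one,
          Finset.univ_eq_empty, Finset.prod_empty, Nat.factorial_zero, Nat.cast_one, inv_one,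
          one_mul, one_mul] at h2
        exact_mod_cast h2
      rw [sectorTrace, Fintype.piFinset_of_isEmpty, Finset.univ_unique, Finset.sum_singleton, h1]
      simp
    · intro k hk
      obtain ⟨k, rfl⟩ := Nat.exists_eq_succ_of_ne_zero hk
      rw [sectorTrace, Fintype.piFinset_empty]
      simp
  | insert j F hj ih =>
    rw [Finset.prod_insert hj, ← ih, ← ENNReal.tsum_mul_right]
    simp only [← ENNReal.tsum_mul_left]
    rw [← ENNReal.tsum_prod (f := fun m n => ENNReal.ofReal (s.occupation m * g j ^ m) *
      ENNReal.ofReal (sectorTrace s f g F n)), ← Finset.HasAntidiagonal.sigmaAntidiagonalEquivProd.tsum_eq,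
      ENNReal.tsum_sigma']
    refine tsum_congr fun k => ?_
    rw [sectorTrace_insert s hf hj, ENNReal.ofReal_sum_of_nonneg, tsum_fintype,
      ← Finset.sum_coe_sort]
    · refine Finset.sum_congr rfl fun p _ => ?_
      rw [ENNReal.ofReal_mul (mul_nonneg (hocc _) (pow_nonneg (hg j) _))]
      rfl
    · exact fun p _ => mul_nonneg (mul_nonneg (hocc _) (pow_nonneg (hg j) _))
        (sectorTrace_nonneg s f hg F _)

theorem tsum_sectorTrace_bose (hf : Orthonormal ℂ f) (hg : ∀ j, 0 ≤ g j) (hg1 : ∀ j, g j < 1)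
    (F : Finset ι) : ∑' k, ENNReal.ofReal (sectorTrace .bose f g F k) =
      ENNReal.ofReal (∏ j ∈ F, (1 - g j))⁻¹ := by
  rw [tsum_sectorTrace .bose hf hg, ← Finset.prod_inv_distrib, ENNReal.ofReal_prod_of_nonneg]
  · refine Finset.prod_congr rfl fun j _ => ?_
    simp only [Statistics.occupation, one_mul]
    rw [← ENNReal.ofReal_tsum_of_nonneg (fun m => pow_nonneg (hg j) m)
      (summable_geometric_of_lt_one (hg j) (hg1 j)), tsum_geometric_of_lt_one (hg j) (hg1 j)]
  · exact fun j _ => inv_nonneg.2 (sub_nonneg.2 (hg1 j).le)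

theorem tsum_sectorTrace_fermi (hf : Orthonormal ℂ f) (hg : ∀ j, 0 ≤ g j) (F : Finset ι) :
    ∑' k, ENNReal.ofReal (sectorTrace .fermi f g F k) = ENNReal.ofReal (∏ j ∈ F, (1 + g j)) := by
  rw [tsum_sectorTrace .fermi hf hg, ENNReal.ofReal_prod_of_nonneg]
  · refine Finset.prod_congr rfl fun j _ => ?_
    rw [tsum_eq_sum (s := Finset.range 2), Finset.sum_range_succ, Finset.sum_range_one,
      ENNReal.ofReal_add zero_le_one (hg j)]
    · simp [Statistics.occupation]
    · intro m hm
      have : ¬ m ≤ 1 := by simpa using hm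
      simp [Statistics.occupation, this]
  · exact fun j _ => add_nonneg zero_le_one (hg j)

end Combinatorics

/-! ### Orthogonal series, and products of words -/

section HilbertLemmas

theorem exists_hasSum_of_orthogonal {ι K : Type*} [NormedAddCommGroup K] [InnerProductSpace ℂ K]
    [CompleteSpace K] {x : ι → K} (hx : ∀ i j, i ≠ j → inner ℂ (x i) (x j) = 0)
    (hs : Summable fun i => ‖x i‖ ^ 2) :
    Summable x ∧ ‖∑' i, x i‖ ^ 2 = ∑' i, ‖x i‖ ^ 2 := by
  have hO : OrthogonalFamily ℂ (fun i => (ℂ ∙ x i : Submodule ℂ K)) fun i => (ℂ ∙ x i).subtypeₗᵢ := by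
    intro i j hij v w
    obtain ⟨a, ha⟩ := Submodule.mem_span_singleton.1 v.2
    obtain ⟨b, hb⟩ := Submodule.mem_span_singleton.1 w.2
    simp only [Submodule.coe_subtypeₗᵢ, Submodule.coe_subtype, ← ha, ← hb, inner_smul_left,
      inner_smul_right, hx i j hij, mul_zero]
  have h1 : Summable x := (hO.summable_iff_norm_sq_summable
    fun i => ⟨x i, Submodule.mem_span_singleton_self _⟩).2 hs
  refine ⟨h1, ?_⟩
  have h2 := h1.hasSum.mapL (innerSL ℂ (∑' i, x i))
  have h3 : ∀ i, inner ℂ (∑' i, x i) (x i) = ((‖x i‖ ^ 2 : ℝ) : ℂ) := by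
    intro i
    have h4 := h1.hasSum.mapL (innerSL ℂ (x i))
    have h5 : inner ℂ (x i) (∑' i, x i) = inner ℂ (x i) (x i) := by
      refine h4.unique ?_
      refine hasSum_single i fun j hj => ?_
      exact hx i j hj.symm
    rw [← inner_conj_symm, h5, inner_self_eq_norm_sq_to_K, map_pow, RCLike.conj_ofReal]
    norm_cast
  have h6 : HasSum (fun i => ((‖x i‖ ^ 2 : ℝ) : ℂ)) ((‖∑' i, x i‖ ^ 2 : ℝ) : ℂ) := by
    have h7 : ((‖∑' i, x i‖ ^ 2 : ℝ) : ℂ) = inner ℂ (∑' i, x i) (∑' i, x i) := by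
      rw [inner_self_eq_norm_sq_to_K]
      norm_cast
    rw [h7]
    simp only [← h3]
    exact h2
  exact (Complex.hasSum_ofReal.1 h6).tsum_eq.symm

/-- Continuous multilinear maps agreeing on the vectors of an orthonormal basis are equal. -/
theorem ContinuousMultilinearMap.ext_hilbertBasis {ι E G : Type*} [NormedAddCommGroup E]
    [InnerProductSpace ℂ E] [AddCommGroup G] [Module ℂ G] [TopologicalSpace G] [T2Space G]
    (b : HilbertBasis ι ℂ E) {n : ℕ}
    {M M' : ContinuousMultilinearMap ℂ (fun _ : Fin n => E) G}
    (h : ∀ r : Fin n → ι, M (b ∘ r) = M' (b ∘ r)) (z : Fin n → E) : M z = M' z := by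
  classical
  have hlim : Filter.Tendsto (fun F : Finset ι => fun i => ∑ j ∈ F, b.repr (z i) j • b j)
      Filter.atTop (nhds z) := tendsto_pi_nhds.2 fun i => b.hasSum_repr (z i)
  refine tendsto_nhds_unique ((M.cont.tendsto z).comp hlim)
    (((M'.cont.tendsto z).comp hlim).congr fun F => ?_)
  have h1 : ∀ M : ContinuousMultilinearMap ℂ (fun _ : Fin n => E) G,
      M (fun i => ∑ j ∈ F, b.repr (z i) j • b j) = ∑ r ∈ Fintype.piFinset fun _ : Fin n => F,
        (∏ i, b.repr (z i) (r i)) • M (b ∘ r) := by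
    intro M
    have h2 := M.toMultilinearMap.map_sum_finset (fun i j => b.repr (z i) j • b j)
      (fun _ : Fin n => F)
    refine h2.trans (Finset.sum_congr rfl fun r _ => ?_)
    exact M.toMultilinearMap.map_smul_univ (fun i => b.repr (z i) (r i)) (b ∘ r)
  change M' (fun i => ∑ j ∈ F, b.repr (z i) j • b j) = M (fun i => ∑ j ∈ F, b.repr (z i) j • b j)
  rw [h1, h1]
  simp only [h]

/-- The tensor product of vectors expanded in a basis indexed by words: its coefficient at the word
`L` is the product of the coefficients at the first `m` and at the remaining letters. -/
def wordCoeff {I E : Type*} [NormedAddCommGroup E] [InnerProductSpace ℂ E]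
    (e : HilbertBasis (List I) ℂ E) (m : ℕ) (Φ Ψ : E) (L : List I) : ℂ :=
  if m ≤ L.length then inner ℂ (e (L.take m)) Φ * inner ℂ (e (L.drop m)) Ψ else 0

section WordMul

variable {I E : Type*} [NormedAddCommGroup E] [InnerProductSpace ℂ E]
    (e : HilbertBasis (List I) ℂ E) (m : ℕ)

theorem HilbertBasis.hasSum_norm_inner_sq {κ : Type*} (b : HilbertBasis κ ℂ E) (x : E) :
    HasSum (fun l => ‖inner ℂ (b l) x‖ ^ 2) (‖x‖ ^ 2) := by
  have h := b.hasSum_inner_mul_inner x x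
  have h2 : ((‖x‖ ^ 2 : ℝ) : ℂ) = inner ℂ x x := by
    rw [inner_self_eq_norm_sq_to_K]
    norm_cast
  rw [← Complex.hasSum_ofReal, h2]
  refine h.congr_fun fun l => ?_
  rw [← inner_conj_symm x, ← Complex.normSq_eq_conj_mul_self, Complex.normSq_eq_norm_sq]

/-- Cutting a word after m letters is injective, so the squared coefficients are dominated by part
of a product of two summable families. -/
theorem wordCoeff_memℓp (Φ Ψ : E) : Summable (fun L => ‖wordCoeff e m Φ Ψ L‖ ^ 2) ∧
    ∑' L, ‖wordCoeff e m Φ Ψ L‖ ^ 2 ≤ (‖Φ‖ * ‖Ψ‖) ^ 2 := by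
  let a : List I → ℝ := fun l => ‖inner ℂ (e l) Φ‖ ^ 2
  let b : List I → ℝ := fun l => ‖inner ℂ (e l) Ψ‖ ^ 2
  have ha : HasSum a (‖Φ‖ ^ 2) := e.hasSum_norm_inner_sq Φ
  have hb : HasSum b (‖Ψ‖ ^ 2) := e.hasSum_norm_inner_sq Ψ
  have ha0 : ∀ l, 0 ≤ a l := fun l => sq_nonneg _
  have hb0 : ∀ l, 0 ≤ b l := fun l => sq_nonneg _
  have h2 : HasSum (fun p : List I × List I => a p.1 * b p.2) (‖Φ‖ ^ 2 * ‖Ψ‖ ^ 2) :=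
    ha.mul hb (ha.summable.mul_of_nonneg hb.summable ha0 hb0)
  have hinj : Function.Injective fun L : List I => (L.take m, L.drop m) := fun L L' h => by
    simp only [Prod.mk.injEq] at h
    rw [← List.take_append_drop m L, h.1, h.2, List.take_append_drop]
  have h3 : ∀ L, ‖wordCoeff e m Φ Ψ L‖ ^ 2 ≤ a (L.take m) * b (L.drop m) := by
    intro L
    rw [wordCoeff]
    split_ifs
    · rw [norm_mul, mul_pow]
    · rw [norm_zero, zero_pow two_ne_zero]
      exact mul_nonneg (ha0 _) (hb0 _)
  have h4 := h2.summable.comp_injective hinj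
  have h5 := Summable.of_nonneg_of_le (fun L => sq_nonneg _) h3 h4
  refine ⟨h5, ?_⟩
  rw [mul_pow, ← h2.tsum_eq]
  exact h5.tsum_le_tsum_of_inj (fun L : List I => (L.take m, L.drop m)) hinj
    (fun p _ => mul_nonneg (ha0 _) (hb0 _)) h3 h2.summable

/-- The product of the basis words, extended to a bounded bilinear map. -/
def wordMul (Φ Ψ : E) : E :=
  e.repr.symm ⟨wordCoeff e m Φ Ψ, memℓp_gen (by simpa using (wordCoeff_memℓp e m Φ Ψ).1)⟩

theorem inner_wordMul (Φ Ψ : E) (L : List I) :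
    inner ℂ (e L) (wordMul e m Φ Ψ) = wordCoeff e m Φ Ψ L := by
  rw [← e.repr_apply_apply, wordMul, LinearIsometryEquiv.apply_symm_apply]

theorem HilbertBasis.ext_inner {κ : Type*} (b : HilbertBasis κ ℂ E) {x y : E}
    (h : ∀ i, inner ℂ (b i) x = inner ℂ (b i) y) : x = y := by
  refine b.repr.injective (lp.ext (funext fun i => ?_))
  rw [b.repr_apply_apply, b.repr_apply_apply, h]

theorem norm_wordMul_le (Φ Ψ : E) : ‖wordMul e m Φ Ψ‖ ≤ ‖Φ‖ * ‖Ψ‖ := by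
  refine le_of_sq_le_sq ?_ (by positivity)
  refine le_trans (le_of_eq ?_) (wordCoeff_memℓp e m Φ Ψ).2
  rw [wordMul, LinearIsometryEquiv.norm_map]
  have := lp.norm_rpow_eq_tsum (p := 2) (by norm_num)
    (⟨wordCoeff e m Φ Ψ, memℓp_gen (by simpa using (wordCoeff_memℓp e m Φ Ψ).1)⟩ :
      lp (fun _ : List I => ℂ) 2)
  simpa using this

/-- `wordMul` as a bounded bilinear map. -/
def wordMulL : E →L[ℂ] E →L[ℂ] E :=
  LinearMap.mkContinuous₂ (LinearMap.mk₂ ℂ (wordMul e m)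
    (fun _ _ _ => e.ext_inner fun L => by
      simp only [inner_add_right, inner_wordMul, wordCoeff]
      split_ifs <;> ring)
    (fun _ _ _ => e.ext_inner fun L => by
      simp only [inner_smul_right, inner_wordMul, wordCoeff]
      split_ifs <;> ring)
    (fun _ _ _ => e.ext_inner fun L => by
      simp only [inner_add_right, inner_wordMul, wordCoeff]
      split_ifs <;> ring)
    (fun _ _ _ => e.ext_inner fun L => by
      simp only [inner_smul_right, inner_wordMul, wordCoeff]
      split_ifs <;> ring)) 1 fun Φ Ψ => by
    rw [one_mul]
    exact norm_wordMul_le e m Φ Ψ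

theorem wordMulL_apply (Φ Ψ : E) : wordMulL e m Φ Ψ = wordMul e m Φ Ψ := rfl

/-- When Φ has only words of length m, a pair of words with nonzero coefficient is recovered by
cutting its concatenation after m letters. -/
theorem hasSum_wordMul {Φ : E} (hΦ : ∀ l : List I, l.length ≠ m → inner ℂ (e l) Φ = 0) (Ψ : E) :
    HasSum (fun p : List I × List I => (inner ℂ (e p.1) Φ * inner ℂ (e p.2) Ψ) • e (p.1 ++ p.2))
      (wordMul e m Φ Ψ) := by
  have hinj : Function.Injective fun L : List I => (L.take m, L.drop m) := fun L L' h => by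
    simp only [Prod.mk.injEq] at h
    rw [← List.take_append_drop m L, h.1, h.2, List.take_append_drop]
  refine (hinj.hasSum_iff fun p hp => ?_).1 ?_
  · by_cases h : p.1.length = m
    · refine absurd ⟨p.1 ++ p.2, ?_⟩ hp
      simp [← h]
    · rw [hΦ _ h, zero_mul, zero_smul]
  · have h := e.hasSum_repr (wordMul e m Φ Ψ)
    convert h using 1
    funext L
    rw [e.repr_apply_apply, inner_wordMul, Function.comp_apply, List.take_append_drop, wordCoeff]
    split_ifs with hL
    · rfl
    · rw [hΦ _ (by rw [List.length_take]; omega), zero_mul]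

end WordMul

end HilbertLemmas

/-! ### The word basis of the full Fock space and creation operators -/

section FullFockBasis

variable {Z : Type*} [NormedAddCommGroup Z] [InnerProductSpace ℂ Z]

theorem FullFock.ext_inner {x y : FullFock Z}
    (h : ∀ l : List Z, inner ℂ (tens l) x = inner ℂ (tens l) y) : x = y := by
  refine span_tens_dense.eq_of_inner_right ℂ fun v hv => ?_
  induction hv using Submodule.span_induction with
  | mem v hv =>
    obtain ⟨l, rfl⟩ := hv
    exact h l
  | zero => rw [inner_zero_left, inner_zero_left]
  | add v w _ _ hv hw => rw [inner_add_left, inner_add_left, hv, hw]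
  | smul c v _ hv => rw [inner_smul_left, inner_smul_left, hv]

theorem inner_tens_ofFn_eq_compLinearMap {n : ℕ} (w z : Fin n → Z) :
    inner ℂ (tens (List.ofFn w)) (tens (List.ofFn z)) =
      (MultilinearMap.mkPiAlgebra ℂ (Fin n) ℂ).compLinearMap
        (fun k => (innerₛₗ ℂ (w k) : Z →ₗ[ℂ] ℂ)) z := by
  rw [inner_tens, tensorKernel_ofFn, MultilinearMap.compLinearMap_apply,
    MultilinearMap.mkPiAlgebra_apply]
  rfl

theorem tens_ofFn_update_add {n : ℕ} (z : Fin n → Z) (j : Fin n) (x y : Z) :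
    tens (List.ofFn (Function.update z j (x + y))) =
      tens (List.ofFn (Function.update z j x)) + tens (List.ofFn (Function.update z j y)) := by
  refine FullFock.ext_inner fun l => ?_
  rw [inner_add_right]
  obtain ⟨k, w, rfl⟩ : ∃ k, ∃ w : Fin k → Z, l = List.ofFn w := ⟨_, _, (List.ofFn_get l).symm⟩
  by_cases h : k = n
  · subst h
    simp only [inner_tens_ofFn_eq_compLinearMap, MultilinearMap.map_update_add]
  · simp only [inner_tens]
    rw [tensorKernel_eq_zero (by simpa using h), tensorKernel_eq_zero (by simpa using h),
      tensorKernel_eq_zero (by simpa using h), add_zero]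

theorem tens_ofFn_update_smul {n : ℕ} (z : Fin n → Z) (j : Fin n) (c : ℂ) (x : Z) :
    tens (List.ofFn (Function.update z j (c • x))) =
      c • tens (List.ofFn (Function.update z j x)) := by
  refine FullFock.ext_inner fun l => ?_
  rw [inner_smul_right]
  obtain ⟨k, w, rfl⟩ : ∃ k, ∃ w : Fin k → Z, l = List.ofFn w := ⟨_, _, (List.ofFn_get l).symm⟩
  by_cases h : k = n
  · subst h
    simp only [inner_tens_ofFn_eq_compLinearMap, MultilinearMap.map_update_smul, smul_eq_mul]
  · simp only [inner_tens]
    rw [tensorKernel_eq_zero (by simpa using h), tensorKernel_eq_zero (by simpa using h), mul_zero]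

variable (Z) in
/-- `(z₁, …, zₙ) ↦ z₁ ⊗ ⋯ ⊗ zₙ` as a multilinear map. -/
def tensMultilinear (n : ℕ) : MultilinearMap ℂ (fun _ : Fin n => Z) (FullFock Z) where
  toFun z := tens (List.ofFn z)
  map_update_add' {inst} z j x y := by
    rw [Subsingleton.elim inst (instDecidableEqFin n)]
    exact tens_ofFn_update_add z j x y
  map_update_smul' {inst} z j c x := by
    rw [Subsingleton.elim inst (instDecidableEqFin n)]
    exact tens_ofFn_update_smul z j c x

variable (Z) in
/-- `(z₁, …, zₙ) ↦ z₁ ⊗ ⋯ ⊗ zₙ` as a continuous multilinear map. -/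
def tensMul (n : ℕ) : ContinuousMultilinearMap ℂ (fun _ : Fin n => Z) (FullFock Z) :=
  (tensMultilinear Z n).mkContinuous 1 fun z => by
    rw [one_mul]
    exact (norm_tens_ofFn z).le

theorem tensorKernel_append {l l' m m' : List Z} (h : l.length = m.length) :
    tensorKernel (l ++ l') (m ++ m') = tensorKernel l m * tensorKernel l' m' := by
  induction l generalizing m with
  | nil =>
    obtain rfl : m = [] := List.length_eq_zero_iff.1 h.symm
    simp [tensorKernel]
  | cons z l ih => cases m with
    | nil => simp at h
    | cons w m => simp [tensorKernel, ih (m := m) (by simpa using h), mul_assoc]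

variable [CompleteSpace Z]

open scoped Classical in
theorem tensorKernel_onb (l m : List (onbSet Z)) :
    tensorKernel (l.map (onb Z)) (m.map (onb Z)) = if l = m then 1 else 0 := by
  induction l generalizing m with
  | nil => cases m <;> simp [tensorKernel]
  | cons i l ih => cases m with
    | nil => simp [tensorKernel]
    | cons j m =>
      rw [List.map_cons, List.map_cons, tensorKernel, ih, orthonormal_iff_ite.1 (onb Z).orthonormal]
      by_cases h1 : i = j <;> by_cases h2 : l = m <;> simp [h1, h2]

theorem orthonormal_basisTens : Orthonormal ℂ (basisTens (Z := Z)) := by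
  classical
  rw [orthonormal_iff_ite]
  intro l m
  rw [basisTens, basisTens, inner_tens, tensorKernel_onb]

/-- A vector orthogonal to all basis words defines a continuous multilinear functional that vanishes
on the basis, hence on all simple tensors. -/
theorem orthogonal_basisTens :
    (Submodule.span ℂ (Set.range (basisTens (Z := Z))))ᗮ = ⊥ := by
  rw [eq_bot_iff]
  intro x hx
  rw [Submodule.mem_bot]
  refine FullFock.ext_inner fun l => ?_
  rw [inner_zero_right, ← inner_conj_symm, ← List.ofFn_get l]
  have h := ContinuousMultilinearMap.ext_hilbertBasis (onb Z)
    (M := (innerSL ℂ x).compContinuousMultilinearMap (tensMul Z l.length)) (M' := 0)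
    (fun r => ?_) l.get
  · have h2 : inner ℂ x (tens (List.ofFn l.get)) = 0 := h
    rw [h2, map_zero]
  · change inner ℂ x (tens (List.ofFn (onb Z ∘ r))) = 0
    rw [← List.map_ofFn]
    exact (Submodule.mem_orthogonal' _ x).1 hx _ (Submodule.subset_span ⟨List.ofFn r, rfl⟩)

variable (Z) in
/-- The orthonormal basis `basisTens` of the full Fock space. -/
def wordBasis : HilbertBasis (List (onbSet Z)) ℂ (FullFock Z) :=
  HilbertBasis.mkOfOrthogonalEqBot orthonormal_basisTens orthogonal_basisTens

theorem wordBasis_apply (l : List (onbSet Z)) : wordBasis Z l = basisTens l := by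
  rw [wordBasis, HilbertBasis.coe_mkOfOrthogonalEqBot]

/-- The product defined through one chosen basis is concatenation for arbitrary simple tensors. -/
theorem wordMul_tens (l l' : List Z) :
    wordMul (wordBasis Z) l.length (tens l) (tens l') = tens (l ++ l') := by
  refine (wordBasis Z).ext_inner fun L => ?_
  rw [inner_wordMul, wordCoeff, wordBasis_apply, wordBasis_apply, wordBasis_apply, basisTens,
    basisTens, basisTens, inner_tens, inner_tens, inner_tens]
  split_ifs with h
  · conv_rhs => rw [← List.take_append_drop l.length L, List.map_append]
    rw [tensorKernel_append (by simpa using h)]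
  · rw [tensorKernel_eq_zero]
    rw [List.length_map, List.length_append]
    omega

variable (Z) in
/-- The `n`-particle vectors of the full Fock space. -/
def particleSpace (n : ℕ) : Submodule ℂ (FullFock Z) :=
  (Submodule.span ℂ {v | ∃ l : List Z, l.length ≠ n ∧ v = tens l})ᗮ

omit [CompleteSpace Z] in
theorem mem_particleSpace_iff {n : ℕ} {x : FullFock Z} :
    x ∈ particleSpace Z n ↔ ∀ l : List Z, l.length ≠ n → inner ℂ (tens l) x = 0 := by
  rw [particleSpace, Submodule.mem_orthogonal]
  constructor
  · exact fun h l hl => h _ (Submodule.subset_span ⟨l, hl, rfl⟩)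
  · intro h v hv
    induction hv using Submodule.span_induction with
    | mem v hv =>
      obtain ⟨l, hl, rfl⟩ := hv
      exact h l hl
    | zero => rw [inner_zero_left]
    | add v w _ _ hv hw => rw [inner_add_left, hv, hw, add_zero]
    | smul c v _ hv => rw [inner_smul_left, hv, mul_zero]

omit [CompleteSpace Z] in
theorem isClosed_particleSpace (n : ℕ) : IsClosed (particleSpace Z n : Set (FullFock Z)) :=
  Submodule.isClosed_orthogonal _

omit [CompleteSpace Z] in
theorem tens_mem_particleSpace (l : List Z) : tens l ∈ particleSpace Z l.length :=
  mem_particleSpace_iff.2 fun m hm => by rw [inner_tens, tensorKernel_eq_zero hm]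

omit [CompleteSpace Z] in
theorem symVec_mem_particleSpace (s : Statistics) {n : ℕ} (z : Fin n → Z) :
    (symVec s z : FullFock Z) ∈ particleSpace Z n :=
  mem_particleSpace_iff.2 fun _ hm => inner_tens_symTens_of_ne s z hm

/-- For homogeneous vectors only words of lengths m and n contribute, so the square root is constant
and the defining series becomes a bounded bilinear map. -/
theorem creation_eq (s : Statistics) {m n : ℕ} {Φ : FullFock Z} (hΦ : Φ ∈ particleSpace Z m)
    {Ψ : FockSpace Z s} (hΨ : (Ψ : FullFock Z) ∈ particleSpace Z n) :
    creation s Φ Ψ = ((√(((n + 1).ascFactorial m : ℕ) : ℝ) : ℝ) : ℂ) •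
      symmetrizer Z s (wordMulL (wordBasis Z) m Φ Ψ) := by
  have h1 : ∀ l : List (onbSet Z), l.length ≠ m → inner ℂ (wordBasis Z l) Φ = 0 := fun l hl => by
    rw [wordBasis_apply]
    exact mem_particleSpace_iff.1 hΦ _ (by simpa using hl)
  have h2 : ∀ l : List (onbSet Z), l.length ≠ n → inner ℂ (wordBasis Z l) (Ψ : FullFock Z) = 0 :=
    fun l hl => by
      rw [wordBasis_apply]
      exact mem_particleSpace_iff.1 hΨ _ (by simpa using hl)
  have h3 := (hasSum_wordMul (wordBasis Z) m h1 (Ψ : FullFock Z)).mapL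
    ((((√(((n + 1).ascFactorial m : ℕ) : ℝ) : ℝ) : ℂ)) • symmetrizer Z s)
  rw [creation]
  refine HasSum.tsum_eq (Eq.mpr ?_ h3)
  congr 1
  funext p
  have h4 : symVec s (fun i => onb Z ((p.1 ++ p.2).get i)) =
      symmetrizer Z s (wordBasis Z (p.1 ++ p.2)) := by
    rw [wordBasis_apply, basisTens, ← symmetrizer_tens_ofFn]
    congr 2
    conv_rhs => rw [← List.ofFn_get (p.1 ++ p.2), List.map_ofFn]
    rfl
  rw [h4, map_smul, smul_apply, smul_smul, ← wordBasis_apply, ← wordBasis_apply]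
  by_cases hp : p.1.length = m ∧ p.2.length = n
  · rw [hp.1, hp.2]
    congr 1
    ring
  · rw [not_and_or] at hp
    rcases hp with hp | hp
    · rw [h1 _ hp]
      simp
    · rw [h2 _ hp]
      simp

/-- Symmetrizing the last n factors first is absorbed by the full symmetrizer. -/
theorem symmetrizer_wordMul (s : Statistics) {m n : ℕ} (a : Fin m → Z) (z : Fin n → Z) :
    symmetrizer Z s (wordMulL (wordBasis Z) m (tens (List.ofFn a)) (symVec s z)) =
      symVec s (Fin.append a z) := by
  have h1 : ∀ σ : Equiv.Perm (Fin n), symmetrizer Z s (wordMulL (wordBasis Z) m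
      (tens (List.ofFn a)) (tens (List.ofFn (z ∘ σ)))) = s.char σ • symVec s (Fin.append a z) := by
    intro σ
    let τ : Equiv.Perm (Fin (m + n)) := finSumFinEquiv.permCongr (Equiv.Perm.sumCongr 1 σ)
    have h2 : Fin.append a (z ∘ σ) = Fin.append a z ∘ τ := by
      funext i
      refine Fin.addCases (fun i => ?_) (fun i => ?_) i <;> simp [τ, Equiv.permCongr_apply]
    have h3 : s.char τ = s.char σ := by
      cases s <;> simp [Statistics.char, τ]
    have h4 := wordMul_tens (List.ofFn a) (List.ofFn (z ∘ σ))
    rw [List.length_ofFn, ← List.ofFn_fin_append, h2] at h4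
    rw [wordMulL_apply, h4, symmetrizer_tens_ofFn, symVec_comp_perm, h3]
  change symmetrizer Z s (wordMulL (wordBasis Z) m (tens (List.ofFn a)) (symTens s z)) = _
  rw [symTens, map_smul, map_sum, map_smul, map_sum]
  simp only [map_smul, h1, smul_smul, s.char_mul_self, one_smul]
  rw [Finset.sum_const, Finset.card_univ, Fintype.card_perm, Fintype.card_fin, ← Nat.cast_smul_eq_nsmul ℂ,
    inv_smul_smul₀]
  exact_mod_cast n.factorial_ne_zero

end FullFockBasis

/-! ### The two-particle vector of c in the eigenbasis -/

section PairVector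

variable {Z : Type*} [NormedAddCommGroup Z] [InnerProductSpace ℂ Z] [CompleteSpace Z]
variable {ι : Type*} (f : HilbertBasis ι ℂ Z) {g : ι → ℝ} (hg : ∀ j, 0 ≤ g j) (hsum : Summable g)
  {γ : Z →L[ℂ] Z} (hγf : ∀ j, γ (f j) = (g j : ℂ) • f j) (hγ : γ.IsPositive)

include hγf hγ in
theorem hasSum_norm_sqrt_sq (x : Z) :
    HasSum (fun j => g j * ‖inner ℂ (f j) x‖ ^ 2) (‖CFC.sqrt γ x‖ ^ 2) := by
  rw [← Complex.hasSum_ofReal, hγ.norm_sqrt_sq]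
  have h := f.hasSum_inner_mul_inner x (γ x)
  refine h.congr_fun fun j => ?_
  have h2 : inner ℂ (f j) (γ x) = g j * inner ℂ (f j) x := by
    rw [← hγ.isSelfAdjoint.adjoint_eq, ContinuousLinearMap.adjoint_inner_right, hγf,
      inner_smul_left, Complex.conj_ofReal]
  rw [h2, ← inner_conj_symm x (f j), mul_left_comm, ← Complex.normSq_eq_conj_mul_self,
    Complex.normSq_eq_norm_sq]
  push_cast
  rfl

include f hγf hγ hg hsum in
-- Used for the two components of the doubled space: p is a component map, conjugated for Z̄, and vⱼ
-- is the copy of fⱼ there. Summing over the basis first turns ∑gⱼ|(vⱼ|eᵢ)|² into ∑gⱼ.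
theorem summable_norm_sqrt_sq {κ E : Type*} [NormedAddCommGroup E] [InnerProductSpace ℂ E]
    (e : HilbertBasis κ ℂ E) (p : E → Z) (v : ι → E) (hv : ∀ j, ‖v j‖ = 1)
    (hp : ∀ j x, ‖inner ℂ (f j) (p x)‖ = ‖inner ℂ (v j) x‖) :
    Summable fun i => ‖CFC.sqrt γ (p (e i))‖ ^ 2 := by
  have h1 : ∀ j, HasSum (fun i => g j * ‖inner ℂ (v j) (e i)‖ ^ 2) (g j) := by
    intro j
    have h := (e.hasSum_norm_inner_sq (v j)).mul_left (g j)
    rw [hv, one_pow, mul_one] at h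
    refine h.congr_fun fun i => ?_
    rw [norm_inner_symm]
  have h2 : Summable fun q : ι × κ => g q.1 * ‖inner ℂ (v q.1) (e q.2)‖ ^ 2 := by
    rw [summable_prod_of_nonneg fun q => mul_nonneg (hg _) (sq_nonneg _)]
    refine ⟨fun j => (h1 j).summable, hsum.congr fun j => ?_⟩
    exact (h1 j).tsum_eq.symm
  refine h2.prod_symm.prod.congr fun i => ?_
  rw [← (hasSum_norm_sqrt_sq f hγf hγ (p (e i))).tsum_eq]
  refine tsum_congr fun j => ?_
  simp only [hp]
  rfl

variable {Zc : Type*} [NormedAddCommGroup Zc] [InnerProductSpace ℂ Zc] [CompleteSpace Zc]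
variable (s : Statistics) (bar : Z ≃ₗᵢ⋆[ℂ] Zc)

theorem inner_tens_pair {E : Type*} [NormedAddCommGroup E] [InnerProductSpace ℂ E] (x y a b : E) :
    inner ℂ (tens [x, y]) (tens [a, b]) = inner ℂ x a * inner ℂ y b := by
  rw [inner_tens]
  simp [tensorKernel]

/-- `z ⊗ z̄ ± z̄ ⊗ z`. -/
def pairTens (z : Z) : FullFock (Doubled Z Zc) :=
  tens [dblInl z, dblInr (bar z)] + s.sign • tens [dblInr (bar z), dblInl z]

theorem Statistics.norm_sign : ‖s.sign‖ = 1 := by cases s <;> simp [Statistics.sign]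

theorem Statistics.conj_sign : conj s.sign = s.sign := by cases s <;> simp [Statistics.sign]

theorem Statistics.sign_mul_self : s.sign * s.sign = 1 := by cases s <;> simp [Statistics.sign]

theorem inner_pairTens (z w : Z) :
    inner ℂ (pairTens s bar z) (pairTens s bar w) =
      2 * (inner ℂ z w * inner ℂ (bar z) (bar w)) := by
  have h : inner ℂ (dblInr (bar z) : Doubled Z Zc) (dblInl w) = 0 := by
    rw [← inner_conj_symm, inner_dblInl_dblInr, map_zero]
  simp only [pairTens, inner_add_left, inner_add_right, inner_smul_left, inner_smul_right,
    inner_tens_pair, inner_dblInl, inner_dblInr, inner_dblInl_dblInr, h, s.conj_sign]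
  linear_combination (inner ℂ z w * inner ℂ (bar z) (bar w)) * s.sign_mul_self

include hg hsum in
theorem summable_pairTens :
    Summable fun j => ((√(g j) : ℝ) : ℂ) • pairTens s bar (f j) := by
  refine (exists_hasSum_of_orthogonal (fun i j hij => ?_) ?_).1
  · rw [inner_smul_left, inner_smul_right, inner_pairTens, f.orthonormal.2 hij]
    ring
  · refine (hsum.mul_left 2).congr fun j => ?_
    have h : ‖pairTens s bar (f j)‖ ^ 2 = 2 := by
      have h1 := inner_self_eq_norm_sq_to_K (𝕜 := ℂ) (pairTens s bar (f j))
      rw [inner_pairTens, inner_self_eq_norm_sq_to_K, inner_self_eq_norm_sq_to_K,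
        bar.norm_map, f.orthonormal.1 j] at h1
      have h2 : ((‖pairTens s bar (f j)‖ ^ 2 : ℝ) : ℂ) = (2 : ℝ) := by
        push_cast
        rw [← show _ = ((‖pairTens s bar (f j)‖ : ℂ)) ^ 2 from h1]
        simp
      exact_mod_cast h2
    rw [norm_smul, mul_pow, h, Complex.norm_real, Real.norm_eq_abs, sq_abs, Real.sq_sqrt (hg j)]
    ring

variable (γ) in
/-- The pair operator `c`, precomposed with the conjugation `Z ⊕ Z̄ → Z̄ ⊕ Z`. -/
def pairMap (x : Doubled Z Zc) : Doubled Z Zc :=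
  WithLp.toLp 2 (CFC.sqrt γ (bar.symm x.snd), s.sign • bar (CFC.sqrt γ x.fst))

theorem norm_pairMap_sq (x : Doubled Z Zc) :
    ‖pairMap γ s bar x‖ ^ 2 = ‖CFC.sqrt γ (bar.symm x.snd)‖ ^ 2 + ‖CFC.sqrt γ x.fst‖ ^ 2 := by
  rw [WithLp.prod_norm_sq_eq_of_L2, pairMap]
  simp [norm_smul, s.norm_sign]

omit [CompleteSpace Zc] in
theorem inner_conj_right (z : Z) (y : Zc) : inner ℂ z (bar.symm y) = inner ℂ y (bar z) := by
  rw [← bar.inner_map_map', bar.apply_symm_apply]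

include hγ in
-- The bilinear form of c is symmetric for bosons and antisymmetric for fermions; the sign in the
-- lower entry of c is there for this.
theorem inner_pairMap (x y : Doubled Z Zc) :
    inner ℂ x (pairMap γ s bar y) = s.sign * inner ℂ y (pairMap γ s bar x) := by
  have hs : ∀ a b : Z, inner ℂ (CFC.sqrt γ a) b = inner ℂ a (CFC.sqrt γ b) :=
    isPositive_sqrt.isSymmetric
  have h : ∀ (a : Z) (b : Zc),
      inner ℂ a (CFC.sqrt γ (bar.symm b)) = inner ℂ b (bar (CFC.sqrt γ a)) := fun a b => by
    rw [← hs, inner_conj_right]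
  simp only [pairMap, WithLp.prod_inner_apply, inner_smul_right]
  change inner ℂ x.fst (CFC.sqrt γ (bar.symm y.snd)) +
      s.sign * inner ℂ x.snd (bar (CFC.sqrt γ y.fst)) =
    s.sign * (inner ℂ y.fst (CFC.sqrt γ (bar.symm x.snd)) +
      s.sign * inner ℂ y.snd (bar (CFC.sqrt γ x.fst)))
  rw [h, h, mul_add, ← mul_assoc, s.sign_mul_self, one_mul, add_comm]

include f hγf hγ hg hsum in
-- `twoParticle` is expanded in an unrelated basis of the doubled space. Both series converge,
-- having orthogonal terms with summable squared norms, and pair with a simple tensor x⊗y to the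
-- same matrix element of c.
theorem hasSum_twoParticle :
    HasSum (fun j => ((√(g j) : ℝ) : ℂ) • pairTens s bar (f j))
      (twoParticle (fun x : Doubled Z Zc => (WithLp.toLp 2 (bar x.fst, bar.symm x.snd) :
        Doubled Zc Z)) (pairOp s bar γ)) := by
  let e := onb (Doubled Z Zc)
  have h0 : twoParticle (fun x : Doubled Z Zc => (WithLp.toLp 2 (bar x.fst, bar.symm x.snd) :
        Doubled Zc Z)) (pairOp s bar γ) = ∑' i, tens [pairMap γ s bar (e i), e i] := by
    refine tsum_congr fun i => ?_
    simp only [pairOp, pairMap, WithLp.toLp_fst, WithLp.toLp_snd, bar.symm_apply_apply, e]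
  have h1 : Summable fun i => tens [pairMap γ s bar (e i), e i] := by
    refine (exists_hasSum_of_orthogonal (fun i j hij => ?_) ?_).1
    · rw [inner_tens_pair, e.orthonormal.2 hij, mul_zero]
    · have h2 := summable_norm_sqrt_sq f hg hsum hγf hγ e (fun x => bar.symm x.snd)
        (fun j => dblInr (bar (f j))) (fun j => ?_) (fun j x => ?_)
      · have h3 := summable_norm_sqrt_sq f hg hsum hγf hγ e (fun x => x.fst)
          (fun j => dblInl (f j)) (fun j => ?_) (fun j x => ?_)
        · refine (h2.add h3).congr fun i => ?_
          have h4 := inner_self_eq_norm_sq_to_K (𝕜 := ℂ) (tens [pairMap γ s bar (e i), e i])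
          rw [inner_tens_pair, inner_self_eq_norm_sq_to_K, inner_self_eq_norm_sq_to_K,
            e.orthonormal.1 i] at h4
          rw [← norm_pairMap_sq]
          have h5 : (((1 : ℝ) : ℂ)) ^ 2 = 1 := by norm_num
          have h6 : ((‖pairMap γ s bar (e i)‖ : ℂ)) ^ 2 * ((1 : ℝ) : ℂ) ^ 2 =
            (‖tens [pairMap γ s bar (e i), e i]‖ : ℂ) ^ 2 := h4
          rw [h5, mul_one] at h6
          exact_mod_cast h6
        · simp [dblInl, f.orthonormal.1 j]
        · simp [dblInl, WithLp.prod_inner_apply]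
      · simp [dblInr, f.orthonormal.1 j]
      · rw [inner_conj_right bar, norm_inner_symm]
        simp [dblInr, WithLp.prod_inner_apply]
  have h2 := (summable_pairTens f hg hsum s bar).hasSum
  suffices h : ∑' j, ((√(g j) : ℝ) : ℂ) • pairTens s bar (f j) =
      ∑' i, tens [pairMap γ s bar (e i), e i] by
    rw [h0, ← h]
    exact h2
  refine FullFock.ext_inner fun l => ?_
  rw [← innerSL_apply_apply ℂ, ← innerSL_apply_apply ℂ, ContinuousLinearMap.map_tsum _ h2.summable,
    ContinuousLinearMap.map_tsum _ h1]
  simp only [innerSL_apply_apply, inner_smul_right, pairTens, inner_add_right]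
  by_cases hl : l.length = 2
  · obtain ⟨x, y, rfl⟩ := List.length_eq_two.1 hl
    have h3 : HasSum (fun i => inner ℂ (tens [x, y]) (tens [pairMap γ s bar (e i), e i]))
        (s.sign * inner ℂ y (pairMap γ s bar x)) := by
      refine ((e.hasSum_inner_mul_inner y (pairMap γ s bar x)).mul_left s.sign).congr_fun
        fun i => ?_
      rw [inner_tens_pair, inner_pairMap hγ]
      ring
    have hs : ∀ a b : Z, inner ℂ (CFC.sqrt γ a) b = inner ℂ a (CFC.sqrt γ b) :=
      isPositive_sqrt.isSymmetric
    have h4 : ∀ (a : Z) (b : Zc), HasSum (fun j => ((√(g j) : ℝ) : ℂ) *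
        (inner ℂ a (f j) * inner ℂ b (bar (f j)))) (inner ℂ a (CFC.sqrt γ (bar.symm b))) := by
      intro a b
      rw [← hs]
      refine (f.hasSum_inner_mul_inner (CFC.sqrt γ a) (bar.symm b)).congr_fun fun j => ?_
      rw [hs, hγ.sqrt_apply_of_eigen (hg j) (hγf j), inner_smul_right, inner_conj_right]
      ring
    rw [h3.tsum_eq]
    refine HasSum.tsum_eq ?_
    have h5 := (h4 x.fst y.snd).add ((h4 y.fst x.snd).mul_left s.sign)
    have h6 : inner ℂ x.fst (CFC.sqrt γ (bar.symm y.snd)) + s.sign *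
        inner ℂ y.fst (CFC.sqrt γ (bar.symm x.snd)) = s.sign * inner ℂ y (pairMap γ s bar x) := by
      have h7 : inner ℂ x.fst (CFC.sqrt γ (bar.symm y.snd)) =
          inner ℂ y.snd (bar (CFC.sqrt γ x.fst)) := by rw [← hs, inner_conj_right]
      simp only [pairMap, WithLp.prod_inner_apply, inner_smul_right]
      rw [mul_add, ← mul_assoc, s.sign_mul_self, one_mul, add_comm, h7]
      rfl
    rw [h6] at h5
    refine h5.congr_fun fun j => ?_
    rw [inner_tens_pair, inner_tens_pair]
    have h8 : ∀ a : Z, inner ℂ x (dblInl a : Doubled Z Zc) = inner ℂ x.fst a := fun a => by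
      simp [dblInl, WithLp.prod_inner_apply]
    have h9 : ∀ a : Zc, inner ℂ x (dblInr a : Doubled Z Zc) = inner ℂ x.snd a := fun a => by
      simp [dblInr, WithLp.prod_inner_apply]
    have h10 : ∀ a : Z, inner ℂ y (dblInl a : Doubled Z Zc) = inner ℂ y.fst a := fun a => by
      simp [dblInl, WithLp.prod_inner_apply]
    have h11 : ∀ a : Zc, inner ℂ y (dblInr a : Doubled Z Zc) = inner ℂ y.snd a := fun a => by
      simp [dblInr, WithLp.prod_inner_apply]
    rw [h8, h9, h10, h11]
    ring
  · have h3 : ∀ a b : Doubled Z Zc, inner ℂ (tens l) (tens [a, b]) = 0 := fun a b => by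
      rw [inner_tens, tensorKernel_eq_zero]
      exact hl
    simp [h3]

end PairVector

/-! ### Iterated pair creation -/

section PairSum

variable {Z : Type*} [NormedAddCommGroup Z] [InnerProductSpace ℂ Z]

theorem sum_piFinset_succ {ι M : Type*} [AddCommMonoid M] (F : Finset ι) {k : ℕ}
    (φ : (Fin (k + 1) → ι) → M) :
    ∑ l ∈ Fintype.piFinset (fun _ : Fin (k + 1) => F), φ l =
      ∑ j ∈ F, ∑ l ∈ Fintype.piFinset (fun _ : Fin k => F), φ (Fin.cons j l) := by
  rw [← Finset.sum_product']
  refine Finset.sum_nbij' (fun l => (l 0, Fin.tail l)) (fun p => Fin.cons p.1 p.2) ?_ ?_ ?_ ?_ ?_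
  · intro l hl
    rw [Fintype.mem_piFinset] at hl
    exact Finset.mem_product.2 ⟨hl 0, Fintype.mem_piFinset.2 fun i => hl i.succ⟩
  · intro p hp
    rw [Finset.mem_product, Fintype.mem_piFinset] at hp
    rw [Fintype.mem_piFinset]
    exact Fin.cases hp.1 hp.2
  · exact fun l _ => Fin.cons_self_tail l
  · exact fun p _ => rfl
  · intro l _
    rw [Fin.cons_self_tail]

variable [CompleteSpace Z]

theorem symmetrizer_tens_append_singleton (s : Statistics) (q : List Z) (b : Z) :
    symmetrizer Z s (tens (q ++ [b])) = s.sign ^ q.length • symmetrizer Z s (tens (b :: q)) := by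
  obtain ⟨n, w, rfl⟩ : ∃ n, ∃ w : Fin n → Z, q = List.ofFn w := ⟨_, _, (List.ofFn_get q).symm⟩
  have h1 : List.ofFn w ++ [b] = List.ofFn (Fin.snoc w b : Fin (n + 1) → Z) := by
    rw [List.ofFn_succ']
    simp
  have h2 : b :: List.ofFn w = List.ofFn (Fin.cons b w : Fin (n + 1) → Z) := by
    rw [List.ofFn_succ]
    simp
  have h3 : (Fin.snoc w b : Fin (n + 1) → Z) = (Fin.cons b w : Fin (n + 1) → Z) ∘ finRotate (n + 1) :=
    Fin.snoc_eq_cons_rotate w b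
  rw [h1, h2, h3, symmetrizer_tens_ofFn, symmetrizer_tens_ofFn, symVec_comp_perm, List.length_ofFn]
  congr 1
  cases s <;> simp [Statistics.char, Statistics.sign, sign_finRotate]

theorem symmetrizer_tens_swap (s : Statistics) (q : List Z) (a b : Z) :
    symmetrizer Z s (tens (a :: b :: q)) = s.sign • symmetrizer Z s (tens (b :: a :: q)) := by
  obtain ⟨n, w, rfl⟩ : ∃ n, ∃ w : Fin n → Z, q = List.ofFn w := ⟨_, _, (List.ofFn_get q).symm⟩
  have h2 : ∀ a b : Z, a :: b :: List.ofFn w =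
      List.ofFn (Fin.cons a (Fin.cons b w : Fin (n + 1) → Z) : Fin (n + 2) → Z) := fun a b => by
    rw [List.ofFn_succ, List.ofFn_succ]
    simp
  have h3 : (Fin.cons a (Fin.cons b w : Fin (n + 1) → Z) : Fin (n + 2) → Z) =
      (Fin.cons b (Fin.cons a w : Fin (n + 1) → Z) : Fin (n + 2) → Z) ∘ Equiv.swap 0 1 := by
    funext i
    refine Fin.cases ?_ (fun i => Fin.cases ?_ (fun i => ?_) i) i
    · simp
    · simp
    · rw [Function.comp_apply, Equiv.swap_apply_of_ne_of_ne (Fin.succ_ne_zero _)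
        (by simp [Fin.ext_iff])]
      rfl
  rw [h2, h2, h3, symmetrizer_tens_ofFn, symmetrizer_tens_ofFn, symVec_comp_perm]
  congr 1
  cases s <;> simp [Statistics.char, Statistics.sign]

/-- Creation of a pair, moved to the outer positions. -/
theorem symmetrizer_wordMul_pair (s : Statistics) {k : ℕ} (a b : Z) (u v : Fin k → Z) :
    symmetrizer Z s (wordMulL (wordBasis Z) 2 (tens [a, b] + s.sign • tens [b, a])
      (symVec s (Fin.append u v))) =
      (2 : ℂ) • symVec s (Fin.append (Fin.cons a u : Fin (k + 1) → Z) (Fin.snoc v b : Fin (k + 1) → Z)) := by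
  have h0 : ∀ a b : Z, symmetrizer Z s (wordMulL (wordBasis Z) 2 (tens [a, b])
      (symVec s (Fin.append u v))) =
      symmetrizer Z s (tens (a :: b :: (List.ofFn u ++ List.ofFn v))) := by
    intro a b
    have h := symmetrizer_wordMul s ![a, b] (Fin.append u v)
    have h' : symVec s (Fin.append ![a, b] (Fin.append u v)) =
        symmetrizer Z s (tens (a :: b :: (List.ofFn u ++ List.ofFn v))) := by
      rw [← symmetrizer_tens_ofFn, List.ofFn_fin_append, List.ofFn_fin_append]
      simp
    rw [← h', ← h]
    simp
  have h1 : symVec s (Fin.append (Fin.cons a u : Fin (k + 1) → Z) (Fin.snoc v b : Fin (k + 1) → Z)) =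
      symmetrizer Z s (tens ((a :: (List.ofFn u ++ List.ofFn v)) ++ [b])) := by
    rw [← symmetrizer_tens_ofFn, List.ofFn_fin_append, List.ofFn_succ, List.ofFn_succ']
    simp
  -- Moving b past the 2k+1 other factors costs one sign, the same as swapping a and b. Hence the
  -- two terms of the pair agree and add up to the factor 2.
  have h2 : s.sign ^ (a :: (List.ofFn u ++ List.ofFn v)).length = s.sign := by
    rw [List.length_cons, List.length_append, List.length_ofFn, List.length_ofFn, pow_succ, pow_add,
      ← mul_pow, s.sign_mul_self, one_pow, one_mul]
  rw [h1, symmetrizer_tens_append_singleton, h2, map_add, add_apply, map_smul, smul_apply, map_add,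
    map_smul, h0, h0, symmetrizer_tens_swap s _ a b, two_smul]

variable {Zc : Type*} [NormedAddCommGroup Zc] [InnerProductSpace ℂ Zc] [CompleteSpace Zc]
variable (s : Statistics) (bar : Z ≃ₗᵢ⋆[ℂ] Zc)

/-- The vector corresponding to the restriction of `Γ(γ^{1/2})` to the `k`-particle vectors over
`span {fⱼ | j ∈ F}`, where `γ fⱼ = gⱼ fⱼ`. -/
def pairSum {ι : Type*} (f : ι → Z) (g : ι → ℝ) (k : ℕ) (F : Finset ι) : FockSpace (Doubled Z Zc) s :=
  ∑ l ∈ Fintype.piFinset (fun _ : Fin k => F),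
    ((∏ i, √(g (l i)) : ℝ) : ℂ) • pairVec s bar (f ∘ l) (f ∘ l)

/-- The new z goes first and z̄ last, which is the order in which `pairVec` lists the reversed w̄.
The constants match because k!√((2k)!/(k!)²) = √((2k)!) and the creation factor raises this to
√((2k+2)!). -/
theorem symmetrizer_wordMul_pairTens {k : ℕ} (z : Z) (w : Fin k → Z) :
    (1 / 2 : ℂ) • ((√((((k + k) + 1).ascFactorial 2 : ℕ) : ℝ) : ℝ) : ℂ) •
      symmetrizer (Doubled Z Zc) s (wordMulL (wordBasis (Doubled Z Zc)) 2 (pairTens s bar z)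
        ((k.factorial : ℂ) • pairVec s bar w w : FockSpace (Doubled Z Zc) s)) =
      ((k + 1).factorial : ℂ) • pairVec s bar (Fin.cons z w : Fin (k + 1) → Z)
        (Fin.cons z w : Fin (k + 1) → Z) := by
  have h1 : ∀ n : ℕ, (n.factorial : ℂ) * ((√(((n + n).factorial : ℝ) /
      (n.factorial * n.factorial)) : ℝ) : ℂ) = ((√((n + n).factorial : ℝ) : ℝ) : ℂ) := by
    intro n
    rw [Real.sqrt_div (by positivity), Real.sqrt_mul_self (by positivity)]
    push_cast
    field_simp
  have h2 : ((√(((k + k + 1).ascFactorial 2 : ℕ) : ℝ) : ℝ) : ℂ) * ((√((k + k).factorial : ℝ) : ℝ) : ℂ) =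
      ((√((k + 1 + (k + 1)).factorial : ℝ) : ℝ) : ℂ) := by
    rw [← Complex.ofReal_mul, ← Real.sqrt_mul (by positivity), mul_comm, ← Nat.cast_mul,
      Nat.factorial_mul_ascFactorial, show k + k + 2 = k + 1 + (k + 1) by ring]
  have h3 : (bar ∘ (Fin.cons z w : Fin (k + 1) → Z) ∘ Fin.rev) =
      (Fin.snoc (bar ∘ w ∘ Fin.rev) (bar z) : Fin (k + 1) → Zc) := by
    funext i
    refine Fin.lastCases ?_ (fun i => ?_) i <;> simp [Fin.rev_castSucc]
  have h4 : (dblInl ∘ (Fin.cons z w : Fin (k + 1) → Z)) =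
      (Fin.cons (dblInl z) (dblInl ∘ w) : Fin (k + 1) → Doubled Z Zc) := by
    funext i
    refine Fin.cases ?_ (fun i => ?_) i <;> simp
  have h5 : (dblInr ∘ (Fin.snoc (bar ∘ w ∘ Fin.rev) (bar z) : Fin (k + 1) → Zc)) =
      (Fin.snoc (dblInr ∘ bar ∘ w ∘ Fin.rev) (dblInr (bar z)) : Fin (k + 1) → Doubled Z Zc) := by
    funext i
    refine Fin.lastCases ?_ (fun i => ?_) i <;> simp
  rw [pairVec, pairVec, smul_smul, smul_smul, smul_smul, h1, h1, dblVec, dblVec, h3, h4, h5, Submodule.coe_smul,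
    map_smul, map_smul, pairTens, symmetrizer_wordMul_pair, smul_smul, smul_smul, ← h2]
  congr 1
  ring

/-- `½ a*(Φ)` on `k`-pair vectors. -/
def pairCreation (k : ℕ) (Φ : FullFock Z) : FockSpace Z s →L[ℂ] FockSpace Z s :=
  ((1 / 2 : ℂ) * ((√((((k + k) + 1).ascFactorial 2 : ℕ) : ℝ) : ℝ) : ℂ)) •
    (symmetrizer Z s ∘L wordMulL (wordBasis Z) 2 Φ ∘L (fockSubspace Z s).subtypeL)

theorem pairCreation_apply (k : ℕ) (Φ : FullFock Z) (Ψ : FockSpace Z s) :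
    pairCreation s k Φ Ψ = ((1 / 2 : ℂ) * ((√((((k + k) + 1).ascFactorial 2 : ℕ) : ℝ) : ℝ) : ℂ)) •
      symmetrizer Z s (wordMulL (wordBasis Z) 2 Φ Ψ) := rfl

theorem pairCreation_sum {ι : Type*} (k : ℕ) (F : Finset ι) (c : ι → ℂ) (Φ : ι → FullFock Z)
    (Ψ : FockSpace Z s) :
    pairCreation s k (∑ j ∈ F, c j • Φ j) Ψ = ∑ j ∈ F, c j • pairCreation s k (Φ j) Ψ := by
  simp only [pairCreation_apply]
  rw [map_sum, sum_apply, map_sum, Finset.smul_sum]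
  refine Finset.sum_congr rfl fun j _ => ?_
  rw [map_smul, smul_apply, map_smul, smul_comm]

theorem tendsto_apply_apply {E α : Type*} [NormedAddCommGroup E] [NormedSpace ℂ E]
    (B : E →L[ℂ] E →L[ℂ] E) {l : Filter α} {x y : α → E} {x₀ y₀ : E}
    (hx : Filter.Tendsto x l (nhds x₀)) (hy : Filter.Tendsto y l (nhds y₀)) :
    Filter.Tendsto (fun a => B (x a) (y a)) l (nhds (B x₀ y₀)) := by
  have h : Continuous fun p : E × E => B p.1 p.2 := by fun_prop
  exact (h.tendsto (x₀, y₀)).comp (hx.prodMk_nhds hy)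

theorem tendsto_pairCreation {α : Type*} {l : Filter α} (k : ℕ) {Φ : α → FullFock Z}
    {Φ₀ : FullFock Z} {Ψ : α → FockSpace Z s} {Ψ₀ : FockSpace Z s}
    (hΦ : Filter.Tendsto Φ l (nhds Φ₀)) (hΨ : Filter.Tendsto Ψ l (nhds Ψ₀)) :
    Filter.Tendsto (fun a => pairCreation s k (Φ a) (Ψ a)) l (nhds (pairCreation s k Φ₀ Ψ₀)) := by
  have h1 : Filter.Tendsto (fun a => (Ψ a : FullFock Z)) l (nhds (Ψ₀ : FullFock Z)) :=
    (continuous_subtype_val.tendsto Ψ₀).comp hΨ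
  have h2 : Filter.Tendsto (fun a => wordMulL (wordBasis Z) 2 (Φ a) (Ψ a)) l
      (nhds (wordMulL (wordBasis Z) 2 Φ₀ Ψ₀)) := tendsto_apply_apply (wordMulL (wordBasis Z) 2) hΦ h1
  have h3 : Filter.Tendsto (fun a => symmetrizer Z s (wordMulL (wordBasis Z) 2 (Φ a) (Ψ a))) l
      (nhds (symmetrizer Z s (wordMulL (wordBasis Z) 2 Φ₀ Ψ₀))) :=
    ((symmetrizer Z s).continuous.tendsto _).comp h2
  simp only [pairCreation_apply]
  exact h3.const_smul _

/-- A word of length k+1 over F is a letter followed by a word of length k, and its weight factors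
accordingly. -/
theorem pairCreation_pairSum {ι : Type*} (f : ι → Z) (g : ι → ℝ) (k : ℕ) (F : Finset ι) :
    pairCreation s k (∑ j ∈ F, ((√(g j) : ℝ) : ℂ) • pairTens s bar (f j))
      ((k.factorial : ℂ) • pairSum s bar f g k F) =
      ((k + 1).factorial : ℂ) • pairSum s bar f g (k + 1) F := by
  conv_rhs => rw [pairSum, sum_piFinset_succ, Finset.smul_sum]
  rw [pairCreation_sum, pairSum]
  refine Finset.sum_congr rfl fun j _ => ?_
  rw [map_smul (pairCreation s k (pairTens s bar (f j))) (k.factorial : ℂ),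
    map_sum (pairCreation s k (pairTens s bar (f j))), Finset.smul_sum,
    Finset.smul_sum, Finset.smul_sum]
  refine Finset.sum_congr rfl fun l _ => ?_
  have h := symmetrizer_wordMul_pairTens s bar (f j) (f ∘ l)
  rw [smul_smul, ← pairCreation_apply, map_smul] at h
  have h2 : f ∘ (Fin.cons j l : Fin (k + 1) → ι) = (Fin.cons (f j) (f ∘ l) : Fin (k + 1) → Z) := by
    funext i
    refine Fin.cases ?_ (fun i => ?_) i <;> simp
  rw [h2, smul_comm _ (_ : ℂ) (pairVec s bar (Fin.cons (f j) (f ∘ l)) _), ← h, map_smul,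
    Fin.prod_univ_succ]
  simp only [Fin.cons_zero, Fin.cons_succ, smul_smul]
  congr 1
  push_cast
  ring

theorem pairSum_mem_particleSpace {ι : Type*} (f : ι → Z) (g : ι → ℝ) (k : ℕ) (F : Finset ι) :
    (pairSum s bar f g k F : FullFock (Doubled Z Zc)) ∈ particleSpace (Doubled Z Zc) (k + k) := by
  rw [pairSum, Submodule.coe_sum]
  refine Submodule.sum_mem _ fun l _ => ?_
  rw [Submodule.coe_smul, pairVec, Submodule.coe_smul]
  exact Submodule.smul_mem _ _ (Submodule.smul_mem _ _ (symVec_mem_particleSpace s _))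

theorem pairTens_mem_particleSpace (z : Z) :
    pairTens s bar z ∈ particleSpace (Doubled Z Zc) 2 := by
  have h : ∀ a b : Doubled Z Zc, tens [a, b] ∈ particleSpace (Doubled Z Zc) 2 := fun a b =>
    tens_mem_particleSpace [a, b]
  rw [pairTens]
  exact Submodule.add_mem _ (h _ _) (Submodule.smul_mem _ _ (h _ _))

variable {ι : Type*} (f : HilbertBasis ι ℂ Z) {g : ι → ℝ} (hg : ∀ j, 0 ≤ g j) (hsum : Summable g)
  {γ : Z →L[ℂ] Z} (hγf : ∀ j, γ (f j) = (g j : ℂ) • f j) (hγ : γ.IsPositive)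

/-- At fixed particle number pair creation is jointly continuous in the two-particle vector and its
argument, so the finite-mode recursion passes to the limit by induction on k. -/
theorem tendsto_iterate_creation {Φ : FullFock (Doubled Z Zc)}
    (hΦ : HasSum (fun j => ((√(g j) : ℝ) : ℂ) • pairTens s bar (f j)) Φ) (k : ℕ) :
    Filter.Tendsto (fun F => (k.factorial : ℂ) • pairSum s bar f g k F) Filter.atTop
      (nhds ((fun Ψ : FockSpace (Doubled Z Zc) s => (1 / 2 : ℂ) • creation s Φ Ψ)^[k]
        (vacuum (Doubled Z Zc) s))) := by
  have hΦ' : Filter.Tendsto (fun F => ∑ j ∈ F, ((√(g j) : ℝ) : ℂ) • pairTens s bar (f j))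
      Filter.atTop (nhds Φ) := by
    rw [HasSum, SummationFilter.unconditional_filter] at hΦ
    exact hΦ
  have hΦ2 : Φ ∈ particleSpace (Doubled Z Zc) 2 :=
    (isClosed_particleSpace 2).mem_of_tendsto hΦ' (Filter.Eventually.of_forall fun F =>
      Submodule.sum_mem _ fun j _ => Submodule.smul_mem _ _ (pairTens_mem_particleSpace s bar _))
  induction k with
  | zero =>
    refine tendsto_const_nhds.congr fun F => ?_
    rw [pairSum, Fintype.piFinset_of_isEmpty]
    simp [pairVec, vacuum, dblVec]
    congr 1
    funext i
    exact i.elim0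
  | succ k ih =>
    rw [Function.iterate_succ_apply']
    set U := (fun Ψ : FockSpace (Doubled Z Zc) s => (1 / 2 : ℂ) • creation s Φ Ψ)^[k]
        (vacuum (Doubled Z Zc) s)
    have hU : (U : FullFock (Doubled Z Zc)) ∈ particleSpace (Doubled Z Zc) (k + k) :=
      (isClosed_particleSpace (k + k)).mem_of_tendsto
        ((continuous_subtype_val.tendsto U).comp ih) (Filter.Eventually.of_forall fun F =>
          Submodule.smul_mem _ _ (pairSum_mem_particleSpace s bar f g k F))
    rw [creation_eq s hΦ2 hU, smul_smul, ← pairCreation_apply]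
    refine (tendsto_pairCreation s k hΦ' ih).congr fun F => ?_
    exact pairCreation_pairSum s bar f g k F

end PairSum

/-! ### The exponential vector as W(Γ(γ^{1/2})) -/

section PairLimit

variable {Z : Type*} [NormedAddCommGroup Z] [InnerProductSpace ℂ Z] [CompleteSpace Z]

theorem inner_symVec_orthonormal {ι : Type*} [DecidableEq ι] {f : ι → Z} (hf : Orthonormal ℂ f)
    (s : Statistics) {n : ℕ} (l i : Fin n → ι) :
    inner ℂ (symVec s (f ∘ l)) (symVec s (f ∘ i)) =
      (n.factorial : ℂ)⁻¹ * ∑ σ : Equiv.Perm (Fin n), if l = i ∘ σ then s.char σ else 0 := by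
  rw [inner_symVec]
  congr 1
  refine Finset.sum_congr rfl fun σ _ => ?_
  simp only [Function.comp_apply, orthonormal_iff_ite.1 hf]
  rw [Finset.prod_ite_zero, Finset.prod_const_one]
  simp only [Finset.mem_univ, true_imp_iff, funext_iff, Function.comp_apply, mul_ite, mul_one,
    mul_zero]

theorem hasSum_inner_right {ι E : Type*} [NormedAddCommGroup E] [InnerProductSpace ℂ E] (x : E)
    {u : ι → E} {v : E} (h : HasSum u v) : HasSum (fun i => inner ℂ x (u i)) (inner ℂ x v) :=
  (innerSL ℂ x).hasSum h

/-- The vectors `Θ (f_{l₁} ⊗ ⋯ ⊗ f_{lₙ})` form a tight frame of their span. -/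
theorem sum_inner_smul_symVec {ι : Type*} {f : ι → Z} (hf : Orthonormal ℂ f) (s : Statistics)
    {n : ℕ} {F : Finset ι} (c : (Fin n → ι) → ℂ) (hc : ∀ l (σ : Equiv.Perm (Fin n)), c (l ∘ σ) = c l)
    (i : Fin n → ι) (hi : ∀ k, i k ∈ F) (x : FockSpace Z s) :
    ∑ l ∈ Fintype.piFinset (fun _ : Fin n => F), c l * inner ℂ x (symVec s (f ∘ l)) *
      inner ℂ (symVec s (f ∘ l)) (symVec s (f ∘ i)) = c i * inner ℂ x (symVec s (f ∘ i)) := by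
  classical
  simp only [inner_symVec_orthonormal hf]
  have h1 : ∀ l : Fin n → ι, c l * inner ℂ x (symVec s (f ∘ l)) *
      ((n.factorial : ℂ)⁻¹ * ∑ σ : Equiv.Perm (Fin n), if l = i ∘ σ then s.char σ else 0) =
      ∑ σ : Equiv.Perm (Fin n), if l = i ∘ σ then
        (n.factorial : ℂ)⁻¹ * (c i * inner ℂ x (symVec s (f ∘ i))) else 0 := by
    intro l
    rw [Finset.mul_sum, Finset.mul_sum]
    refine Finset.sum_congr rfl fun σ _ => ?_
    split_ifs with h
    · rw [h, hc, ← Function.comp_assoc, symVec_comp_perm, FockSpace.inner_smul_right']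
      linear_combination ((n.factorial : ℂ)⁻¹ * (c i * inner ℂ x (symVec s (f ∘ i)))) *
        s.char_mul_self σ
    · ring
  simp only [h1]
  rw [Finset.sum_comm]
  have h2 : ∀ σ : Equiv.Perm (Fin n), i ∘ σ ∈ Fintype.piFinset (fun _ : Fin n => F) := fun σ =>
    Fintype.mem_piFinset.2 fun k => hi _
  simp only [Finset.sum_ite_eq', h2, if_true]
  rw [Finset.sum_const, Finset.card_univ, Fintype.card_perm, Fintype.card_fin, nsmul_eq_mul,
    mul_inv_cancel_left₀]
  exact_mod_cast n.factorial_ne_zero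

variable {Zc : Type*} [NormedAddCommGroup Zc] [InnerProductSpace ℂ Zc] [CompleteSpace Zc]
variable (s : Statistics) (bar : Z ≃ₗᵢ⋆[ℂ] Zc)
variable {ι : Type*} {f : ι → Z} {g : ι → ℝ}

/-- This says that the operator of `pairSum` multiplies the product vector of the word j by ∏√g. The
sum runs over all ordered words, an overcomplete family, so the tight frame identity is what is
needed. -/
theorem inner_pairVec_pairSum (hf : Orthonormal ℂ f) {n k : ℕ} (a : Fin n → Z) (j : Fin k → ι)
    {F : Finset ι} (hj : ∀ i, j i ∈ F) :
    inner ℂ (pairVec s bar a (f ∘ j)) (pairSum s bar f g k F) =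
      ((∏ i, √(g (j i)) : ℝ) : ℂ) * inner ℂ (symVec s a) (symVec s (f ∘ j)) := by
  rw [← sum_inner_smul_symVec hf s (fun l => ((∏ i, √(g (l i)) : ℝ) : ℂ)) ?_ j hj, pairSum, inner_sum]
  · refine Finset.sum_congr rfl fun l _ => ?_
    rw [FockSpace.inner_smul_right', inner_pairVec_eq, mul_assoc]
  · intro l σ
    exact congrArg _ (Fintype.prod_equiv σ _ _ fun i => rfl)

theorem inner_pairVec_pairSum_of_ne {n m k : ℕ} (a : Fin n → Z) (b : Fin m → Z) (h : m ≠ k)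
    (F : Finset ι) : inner ℂ (pairVec s bar a b) (pairSum s bar f g k F) = 0 := by
  rw [pairSum, inner_sum]
  refine Finset.sum_eq_zero fun l _ => ?_
  rw [FockSpace.inner_smul_right', inner_pairVec_eq, inner_symVec_of_ne s _ _ h.symm, mul_zero,
    mul_zero]

theorem inner_pairSum_of_ne {k k' : ℕ} (h : k ≠ k') (F : Finset ι) :
    inner ℂ (pairSum s bar f g k F) (pairSum s bar f g k' F) = 0 := by
  rw [pairSum, sum_inner]
  refine Finset.sum_eq_zero fun l _ => ?_
  rw [FockSpace.inner_smul_left', inner_pairVec_pairSum_of_ne s bar _ _ h, mul_zero]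

theorem norm_pairSum_sq (hf : Orthonormal ℂ f) (hg : ∀ j, 0 ≤ g j) (k : ℕ) (F : Finset ι) :
    ‖pairSum s bar f g k F‖ ^ 2 = sectorTrace s f g F k := by
  have h : ((‖pairSum s bar f g k F‖ ^ 2 : ℝ) : ℂ) = (sectorTrace s f g F k : ℝ) := by
    rw [Complex.ofReal_pow, ← FockSpace.inner_self_eq']
    conv_lhs => rw [pairSum, sum_inner]
    rw [sectorTrace, Complex.ofReal_sum]
    refine Finset.sum_congr rfl fun l hl => ?_
    rw [FockSpace.inner_smul_left', ← pairSum, inner_pairVec_pairSum s bar hf _ _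
      (Fintype.mem_piFinset.1 hl), FockSpace.inner_self_eq', Complex.conj_ofReal, ← mul_assoc,
      ← Complex.ofReal_mul, ← Finset.prod_mul_distrib]
    simp only [Real.mul_self_sqrt (hg _)]
    push_cast
    rfl
  exact_mod_cast h

theorem sectorTrace_mono (s : Statistics) (f : ι → Z) (hg : ∀ j, 0 ≤ g j) (k : ℕ) :
    Monotone fun F => sectorTrace s f g F k := fun F F' h => by
  refine Finset.sum_le_sum_of_subset_of_nonneg (Fintype.piFinset_subset _ _ fun _ => h) fun l _ _ => ?_
  have := Finset.prod_nonneg fun i (_ : i ∈ Finset.univ) => hg (l i)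
  positivity

section Limit

variable {T : ℕ → FockSpace (Doubled Z Zc) s}
  (hT : ∀ k, Filter.Tendsto (pairSum s bar f g k) Filter.atTop (nhds (T k)))

include hT in
theorem inner_limit_of_ne {k k' : ℕ} (h : k ≠ k') : inner ℂ (T k) (T k') = 0 :=
  tendsto_nhds_unique ((hT k).inner (hT k')) (tendsto_const_nhds.congr fun F =>
    (inner_pairSum_of_ne s bar h F).symm)

include hT in
theorem tendsto_sectorTrace (hf : Orthonormal ℂ f) (hg : ∀ j, 0 ≤ g j) (k : ℕ) :
    Filter.Tendsto (fun F => sectorTrace s f g F k) Filter.atTop (nhds (‖T k‖ ^ 2)) :=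
  ((hT k).norm.pow 2).congr fun F => norm_pairSum_sq s bar hf hg k F

include hT in
-- Here d F is the trace over the modes F. Sector traces increase to ‖T k‖² as F grows: finite sums
-- over k bound the total by D from above, and monotonicity in F gives the reverse bound. The T k
-- are orthogonal, so they sum.
theorem summable_limit (hf : Orthonormal ℂ f) (hg : ∀ j, 0 ≤ g j) {d : Finset ι → ℝ} {D : ℝ}
    (hd : ∀ F, ∑' k, ENNReal.ofReal (sectorTrace s f g F k) = ENNReal.ofReal (d F))
    (hd0 : ∀ F, 0 ≤ d F) (hD : Filter.Tendsto d Filter.atTop (nhds D)) :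
    Summable T ∧ ‖∑' k, T k‖ ^ 2 = D := by
  have hD0 : 0 ≤ D := ge_of_tendsto' hD hd0
  have h1 : ∑' k, ENNReal.ofReal (‖T k‖ ^ 2) = ENNReal.ofReal D := by
    refine le_antisymm ?_ ?_
    · rw [ENNReal.tsum_eq_iSup_sum]
      refine iSup_le fun K => ?_
      refine le_of_tendsto_of_tendsto' (tendsto_finsetSum K fun k _ =>
        ENNReal.tendsto_ofReal (tendsto_sectorTrace s bar hT hf hg k))
        (ENNReal.tendsto_ofReal hD) fun F => ?_
      rw [← hd]
      exact ENNReal.sum_le_tsum K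
    · refine le_of_tendsto' (ENNReal.tendsto_ofReal hD) fun F => ?_
      rw [← hd]
      exact ENNReal.tsum_le_tsum fun k => ENNReal.ofReal_le_ofReal
        ((sectorTrace_mono s f hg k).ge_of_tendsto (tendsto_sectorTrace s bar hT hf hg k) F)
  have h2 : Summable fun k => ‖T k‖ ^ 2 := by
    have h := ENNReal.summable_toReal (h1.trans_ne ENNReal.ofReal_ne_top)
    refine h.congr fun k => ?_
    rw [ENNReal.toReal_ofReal (sq_nonneg _)]
  obtain ⟨h3, h4⟩ := exists_hasSum_of_orthogonal (fun i j h => inner_limit_of_ne s bar hT h) h2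
  refine ⟨h3, ?_⟩
  rw [h4]
  rw [← ENNReal.ofReal_tsum_of_nonneg (fun _ => sq_nonneg _) h2] at h1
  exact (ENNReal.ofReal_eq_ofReal_iff (tsum_nonneg fun _ => sq_nonneg _) hD0).1 h1

include hT in
theorem inner_pairVec_tsum (hf : Orthonormal ℂ f) (hs : Summable T) {n m : ℕ} (a : Fin n → Z)
    (j : Fin m → ι) : inner ℂ (pairVec s bar a (f ∘ j)) (∑' k, T k) =
      ((∏ i, √(g (j i)) : ℝ) : ℂ) * inner ℂ (symVec s a) (symVec s (f ∘ j)) := by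
  have h1 := hasSum_inner_right (pairVec s bar a (f ∘ j)) hs.hasSum
  refine h1.unique ?_
  have h2 : ∀ k, k ≠ m → inner ℂ (pairVec s bar a (f ∘ j)) (T k) = 0 := fun k hk =>
    tendsto_nhds_unique (tendsto_const_nhds.inner (hT k)) (tendsto_const_nhds.congr fun F =>
      (inner_pairVec_pairSum_of_ne s bar _ _ hk.symm F).symm)
  have h3 : inner ℂ (pairVec s bar a (f ∘ j)) (T m) =
      ((∏ i, √(g (j i)) : ℝ) : ℂ) * inner ℂ (symVec s a) (symVec s (f ∘ j)) := by
    classical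
    refine tendsto_nhds_unique (tendsto_const_nhds.inner (hT m)) (tendsto_const_nhds.congr' ?_)
    filter_upwards [Filter.eventually_ge_atTop (Finset.univ.image j)] with F hF
    exact (inner_pairVec_pairSum s bar hf a j fun i =>
      hF (Finset.mem_image_of_mem j (Finset.mem_univ i))).symm
  rw [← h3]
  exact hasSum_single m h2

include hT in
theorem inner_tsum_nonneg (hs : Summable T) (Φ : FockSpace (Doubled Z Zc) s)
    (hΦ : ∀ k (z : Fin k → Z), 0 ≤ inner ℂ Φ (pairVec s bar z z)) : 0 ≤ inner ℂ Φ (∑' k, T k) := by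
  rw [← (hasSum_inner_right Φ hs.hasSum).tsum_eq]
  refine tsum_nonneg fun k => ?_
  refine ge_of_tendsto' (tendsto_const_nhds.inner (hT k)) fun F => ?_
  rw [pairSum, inner_sum]
  refine Finset.sum_nonneg fun l _ => ?_
  rw [FockSpace.inner_smul_right']
  exact mul_nonneg (by exact_mod_cast Finset.prod_nonneg fun i _ => Real.sqrt_nonneg _) (hΦ k _)

end Limit

section Operator

variable {W : HilbertSchmidt (FockSpace Z s) ≃ₗ[ℂ] FockSpace (Doubled Z Zc) s}
  (hW : IsFockIdentification s bar W)
  (f : HilbertBasis ι ℂ Z) (hg : ∀ j, 0 ≤ g j) {γ : Z →L[ℂ] Z}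
  (hγf : ∀ j, γ (f j) = (g j : ℂ) • f j) (hγ : γ.IsPositive)
  {T : ℕ → FockSpace (Doubled Z Zc) s}
  (hT : ∀ k, Filter.Tendsto (pairSum s bar f g k) Filter.atTop (nhds (T k))) (hs : Summable T)

include hW hT hs in
-- The vector is a limit of nonnegative combinations of the images of |z)(z|.
theorem isPositive_symm_tsum : (W.symm (∑' k, T k)).1.IsPositive := by
  refine ContinuousLinearMap.isPositive_of_inner_nonneg fun x => ?_
  rw [← hW.isHSUnitary.inner_hsRankOne_left, W.apply_symm_apply]
  refine inner_tsum_nonneg s bar hT hs _ fun k z => ?_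
  rw [← hW.map_hsRankOne, hW.isHSUnitary.inner_hsRankOne_left]
  exact (isPositive_hsRankOne (symVec s z)).inner_nonneg_right x

include hW hg hγf hγ hT hs in
-- Both sides are continuous and multilinear in z, so it is enough to compare them on words of
-- eigenvectors.
theorem symm_tsum_apply_symVec {n : ℕ} (z : Fin n → Z) :
    (W.symm (∑' k, T k)).1 (symVec s z) = symVec s (⇑(CFC.sqrt γ) ∘ z) := by
  refine ContinuousMultilinearMap.ext_hilbertBasis f
    (M := (W.symm (∑' k, T k)).1.compContinuousMultilinearMap (symVecMul Z s n))
    (M' := (symVecMul Z s n).compContinuousLinearMap fun _ => CFC.sqrt γ) (fun r => ?_) z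
  change (W.symm (∑' k, T k)).1 (symVec s (f ∘ r)) = symVec s (⇑(CFC.sqrt γ) ∘ f ∘ r)
  have h1 : ⇑(CFC.sqrt γ) ∘ f ∘ r = fun i => ((√(g (r i)) : ℝ) : ℂ) • (f ∘ r) i := by
    funext i
    exact hγ.sqrt_apply_of_eigen (hg _) (hγf _)
  have h2 : symVec s (⇑(CFC.sqrt γ) ∘ f ∘ r) = ((∏ i, √(g (r i)) : ℝ) : ℂ) • symVec s (f ∘ r) := by
    rw [h1, Complex.ofReal_prod]
    exact (symVecMultilinear Z s n).map_smul_univ (fun i => ((√(g (r i)) : ℝ) : ℂ)) (f ∘ r)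
  refine FockSpace.ext_inner s fun m w => ?_
  rw [h2, FockSpace.inner_smul_right', ← hW.isHSUnitary.inner_hsRankOne_left, W.apply_symm_apply,
    hW.map_hsRankOne, inner_pairVec_tsum s bar hT f.orthonormal hs]

include hW hg hγf hγ hT hs in
theorem secondQuant_eq_symm_tsum_mul :
    secondQuant s γ = (W.symm (∑' k, T k)).1 * (W.symm (∑' k, T k)).1 := by
  refine ofProducts_eq fun n z => ?_
  rw [mul_apply_eq_comp,
    symm_tsum_apply_symVec s bar hW f hg hγf hγ hT hs,
    symm_tsum_apply_symVec s bar hW f hg hγf hγ hT hs, ← Function.comp_assoc]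
  congr 2
  funext x
  exact congrArg (fun A : Z →L[ℂ] Z => A x) hγ.sqrt_mul_sqrt

end Operator

end PairLimit

/-! ### Normalization of the Gaussian vector -/

section Gaussian

variable {Z : Type*} [NormedAddCommGroup Z] [InnerProductSpace ℂ Z] [CompleteSpace Z]
variable {ι : Type*} (f : HilbertBasis ι ℂ Z) {g : ι → ℝ} (hg : ∀ j, 0 ≤ g j) (hsum : Summable g)
  {γ : Z →L[ℂ] Z} (hγf : ∀ j, γ (f j) = (g j : ℂ) • f j) (hγ : γ.IsPositive)

include hγf in
theorem eigenvalue_lt_one (h1 : (1 - γ).IsPositive) (h2 : ∀ z, γ z = z → z = 0) (j : ι) :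
    g j < 1 := by
  have h3 := h1.inner_nonneg_right (f j)
  have h4 : inner ℂ (f j) ((1 - γ) (f j)) = ((1 - g j : ℝ) : ℂ) := by
    rw [sub_apply, one_apply_eq_self, hγf, inner_sub_right, inner_smul_right,
      inner_self_eq_norm_sq_to_K, f.orthonormal.1]
    simp
  rw [h4] at h3
  have h5 : 0 ≤ 1 - g j := by exact_mod_cast h3
  refine lt_of_le_of_ne (by linarith) fun h => f.orthonormal.ne_zero j (h2 _ ?_)
  rw [hγf, h, Complex.ofReal_one, one_smul]

theorem tendsto_prod_one_add {a : ι → ℝ} (ha : Summable a) :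
    Filter.Tendsto (fun F => ∏ j ∈ F, (1 + a j)) Filter.atTop (nhds (∏' j, (1 + a j))) := by
  have h := (Real.multipliable_one_add_of_summable ha).hasProd
  rw [HasProd, SummationFilter.unconditional_filter] at h
  exact h

include f hg hsum hγf hγ in
theorem fredholmDet_one_add (c : ℝ) (hc : |c| = 1) :
    fredholmDet (1 + (c : ℂ) • γ) = ((∏' j, (1 + c * g j) : ℝ) : ℂ) := by
  have h1 := hasProd_fredholmDet f hg hsum hγf hγ (c := (c : ℂ)) (by simpa using hc)
  have h2 := (Real.multipliable_one_add_of_summable (hsum.mul_left c)).hasProd.map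
    Complex.ofRealHom Complex.continuous_ofReal
  refine h1.unique (h2.congr_fun fun j => ?_)
  simp

include f hg hsum hγf hγ in
-- Puts both statistics in one form: D is the limit of the finite-mode traces, that is
-- det(1∓γ)^{∓1}, and the prefactor of the Gaussian vector is D^{-1/2}.
theorem exists_normalization (s : Statistics)
    (hbose : s = .bose → (1 - γ).IsPositive ∧ ∀ z, γ z = z → z = 0) :
    ∃ (d : Finset ι → ℝ) (D : ℝ),
      (∀ F, ∑' k, ENNReal.ofReal (sectorTrace s f g F k) = ENNReal.ofReal (d F)) ∧
      (∀ F, 0 ≤ d F) ∧ Filter.Tendsto d Filter.atTop (nhds D) ∧ 0 < D ∧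
      fredholmDet (1 - s.sign • γ) ^ (s.sign / 2) = (((√D)⁻¹ : ℝ) : ℂ) := by
  cases s with
  | bose =>
    have hg1 : ∀ j, g j < 1 := eigenvalue_lt_one f hγf (hbose rfl).1 (hbose rfl).2
    have h1 := fredholmDet_one_add f hg hsum hγf hγ (-1) (by simp)
    have h2 := tendsto_prod_one_add (hsum.mul_left (-1))
    set P := ∏' j, (1 + -1 * g j)
    have hpos : ∀ F : Finset ι, 0 < ∏ j ∈ F, (1 + -1 * g j) := fun F =>
      Finset.prod_pos fun j _ => by linarith [hg1 j]
    -- An infinite product with nonzero factors and summable deviations from 1 does not vanish. The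
    -- factors are nonzero because 1 is not an eigenvalue of γ.
    have hP : 0 < P := by
      refine lt_of_le_of_ne (ge_of_tendsto' h2 fun F => (hpos F).le) (Ne.symm ?_)
      refine tprod_one_add_ne_zero_of_summable (f := fun j => -1 * g j) (fun j => ?_) ?_
      · linarith [hg1 j]
      · exact (hsum.mul_left (-1)).norm
    refine ⟨fun F => (∏ j ∈ F, (1 + -1 * g j))⁻¹, P⁻¹, fun F => ?_, fun F => inv_nonneg.2 (hpos F).le,
      h2.inv₀ hP.ne', inv_pos.2 hP, ?_⟩
    · rw [tsum_sectorTrace_bose f.orthonormal hg hg1]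
      simp [sub_eq_add_neg]
    · have h3 : (1 - Statistics.bose.sign • γ) = 1 + ((-1 : ℝ) : ℂ) • γ := by
        simp [Statistics.sign, sub_eq_add_neg]
      rw [h3, h1, Real.sqrt_inv, inv_inv, Real.sqrt_eq_rpow, Complex.ofReal_cpow hP.le]
      simp [Statistics.sign]
  | fermi =>
    have h1 := fredholmDet_one_add f hg hsum hγf hγ 1 (by simp)
    have h2 := tendsto_prod_one_add (hsum.mul_left 1)
    set P := ∏' j, (1 + 1 * g j)
    have hone : ∀ F : Finset ι, 1 ≤ ∏ j ∈ F, (1 + 1 * g j) := fun F =>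
      Finset.prod_const_one.symm.le.trans
        (Finset.prod_le_prod (fun _ _ => zero_le_one) fun j _ => by linarith [hg j])
    have hP : 0 < P := one_pos.trans_le (ge_of_tendsto' h2 hone)
    refine ⟨fun F => ∏ j ∈ F, (1 + 1 * g j), P, fun F => ?_, fun F => zero_le_one.trans (hone F),
      h2, hP, ?_⟩
    · rw [tsum_sectorTrace_fermi f.orthonormal hg]
      simp
    · have h3 : (1 - Statistics.fermi.sign • γ) = 1 + ((1 : ℝ) : ℂ) • γ := by
        simp [Statistics.sign]
      rw [h3, h1, Real.sqrt_eq_rpow, ← Real.rpow_neg hP.le, Complex.ofReal_cpow hP.le]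
      simp [Statistics.sign, neg_div]

end Gaussian

/-! ### The standard vector representative and the theorem -/

section Final

variable {Z Zc : Type*} [NormedAddCommGroup Z] [InnerProductSpace ℂ Z] [CompleteSpace Z]
  [NormedAddCommGroup Zc] [InnerProductSpace ℂ Zc] [CompleteSpace Zc]
  {s : Statistics} {bar : Z ≃ₗᵢ⋆[ℂ] Zc}
  {W : HilbertSchmidt (FockSpace Z s) ≃ₗ[ℂ] FockSpace (Doubled Z Zc) s}

theorem IsFockIdentification.isStandardVector (hW : IsFockIdentification s bar W)
    {γ : Z →L[ℂ] Z} (hγ : γ.IsPositive) (htr : IsTraceClass γ)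
    (hbose : s = .bose → (1 - γ).IsPositive ∧ ∀ z, γ z = z → z = 0) :
    IsStandardVector hW.isHSUnitary.leftRep (fockCone W) (gibbsState s γ)
      (gaussianVector s bar γ) := by
  obtain ⟨ι, f, g, hg, hsum, hγf⟩ := htr.exists_eigenbasis hγ
  obtain ⟨d, D, hd, hd0, hdD, hD, hdet⟩ := exists_normalization f hg hsum hγf hγ s hbose
  set Φ := twoParticle
      (fun x : Doubled Z Zc => (WithLp.toLp 2 (bar x.fst, bar.symm x.snd) : Doubled Zc Z))
      (pairOp s bar γ) with hΦ
  have hΦs := hasSum_twoParticle f hg hsum hγf hγ s bar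
  rw [← hΦ] at hΦs
  let T : ℕ → FockSpace (Doubled Z Zc) s := fun k => ((k.factorial : ℂ)⁻¹) •
    (fun Ψ : FockSpace (Doubled Z Zc) s => (1 / 2 : ℂ) • creation s Φ Ψ)^[k]
      (vacuum (Doubled Z Zc) s)
  have hT : ∀ k, Filter.Tendsto (pairSum s bar f g k) Filter.atTop (nhds (T k)) := fun k => by
    have h := (tendsto_iterate_creation s bar f hΦs k).const_smul ((k.factorial : ℂ)⁻¹)
    refine h.congr fun F => ?_
    rw [inv_smul_smul₀]
    exact_mod_cast k.factorial_ne_zero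
  obtain ⟨hs, hn⟩ := summable_limit s bar hT f.orthonormal hg hd hd0 hdD
  have hpos := isPositive_symm_tsum s bar hW f hT hs
  have hsq := secondQuant_eq_symm_tsum_mul s bar hW f hg hγf hγ hT hs
  set V := ∑' k, T k with hV
  -- V = exp(½a*(c))Ω is W of a positive operator with square Γ(γ), so only the scalar remains to be
  -- fixed.
  have hr : gaussianVector s bar γ = ((((√D)⁻¹ : ℝ)) : ℂ) • V := by
    rw [gaussianVector, hdet]
    rfl
  set U := hW.isHSUnitary
  have hstate : ∀ A, inner ℂ V (U.leftRep A V) = opTrace (secondQuant s γ * A) := fun A => by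
    have h := U.inner_leftRep_eq_opTrace (W.symm V) hpos A
    rw [W.apply_symm_apply] at h
    rw [h, hsq]
  -- The trace formula at A = 1 makes ‖V‖² both Tr Γ(γ) and D.
  have h1 : opTrace (secondQuant s γ) = (D : ℂ) := by
    have h := hstate 1
    rw [mul_one, map_one, one_apply_eq_self, FockSpace.inner_self_eq'] at h
    rw [← h, ← hn, Complex.ofReal_pow]
  have hsD : √D * √D = D := Real.mul_self_sqrt hD.le
  have hsD0 : 0 < √D := Real.sqrt_pos.2 hD
  have hrep : RepresentsState U.leftRep (fockCone W) (gibbsState s γ) (gaussianVector s bar γ) := by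
    rw [hr]
    refine ⟨⟨((((√D)⁻¹ : ℝ)) : ℂ) • W.symm V, ?_, ?_⟩, ?_, fun A => ?_⟩
    · exact hpos.smul_of_nonneg (by exact_mod_cast (inv_pos.2 hsD0).le)
    · rw [map_smul, W.apply_symm_apply]
    · rw [norm_smul, Complex.norm_real, Real.norm_eq_abs, abs_of_pos (inv_pos.2 hsD0)]
      have h2 : ‖V‖ = √D := by rw [← hn, Real.sqrt_sq (norm_nonneg _)]
      rw [h2, inv_mul_cancel₀ hsD0.ne']
    · rw [map_smul, FockSpace.inner_smul_left', FockSpace.inner_smul_right', hstate, gibbsState, h1,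
        Complex.conj_ofReal, ← mul_assoc, ← Complex.ofReal_mul, ← mul_inv, hsD, div_eq_inv_mul,
        Complex.ofReal_inv]
  exact ⟨hrep, fun Ω' h' => U.representsState_unique h' hrep⟩

end Final

end

theorem mainTheorem8 {Z Zc : Type*}
    [NormedAddCommGroup Z] [InnerProductSpace ℂ Z] [CompleteSpace Z]
    [NormedAddCommGroup Zc] [InnerProductSpace ℂ Zc] [CompleteSpace Zc]
    (bar : Z ≃ₗᵢ⋆[ℂ] Zc) (s : Statistics)
    (γ : Z →L[ℂ] Z) (hγ : γ.IsPositive) (hγ_trace : IsTraceClass γ)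
    (hγ_bose : s = Statistics.bose → (1 - γ).IsPositive ∧ ∀ z, γ z = z → z = 0)
    (h : Z →ₗ.[ℂ] Z) (hh : IsSelfAdjoint h) :
    ∃ W : HilbertSchmidt (FockSpace Z s) ≃ₗ[ℂ] FockSpace (Doubled Z Zc) s,
      IsFockIdentification s bar W ∧ (∀ W', IsFockIdentification s bar W' → W' = W) ∧
      ∃ (θl : (FockSpace Z s →L[ℂ] FockSpace Z s) →⋆ₐ[ℂ]
            (FockSpace (Doubled Z Zc) s →L[ℂ] FockSpace (Doubled Z Zc) s))
        (θr : (FockSpace Z s →L[ℂ] FockSpace Z s) →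
            (FockSpace (Doubled Z Zc) s →L[ℂ] FockSpace (Doubled Z Zc) s)),
        (∀ A Φ, (W.symm (θl A Φ)).1 = A ∘L (W.symm Φ).1) ∧
        (∀ A Φ, (W.symm (θr A Φ)).1 = (W.symm Φ).1 ∘L A.adjoint) ∧
        IsStandardRep θl (modularConj s bar) (fockCone W) ∧
        (∀ A, antiConj (modularConj s bar) (θl A) = θr A) ∧
        IsStandardLiouvillean θl (fockCone W) (fockDynamics s h)
          (dGamma s (dirSum h (-conjPMap bar h))) ∧
        IsStandardVector θl (fockCone W) (gibbsState s γ) (gaussianVector s bar γ) := by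
  obtain ⟨W, hW⟩ := exists_isFockIdentification s bar
  refine ⟨W, hW, fun W' hW' => hW.unique hW', hW.isHSUnitary.leftRep, hW.isHSUnitary.rightMul,
    hW.isHSUnitary.symm_leftMul, hW.isHSUnitary.symm_rightMul, ?_, fun A => ?_,
    hW.isStandardLiouvillean hh, hW.isStandardVector hγ hγ_trace hγ_bose⟩
  · rw [← hW.conjMap_eq]
    exact hW.isHSUnitary.isStandardRep
  · rw [← hW.conjMap_eq]
    rfl
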